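/- **Quasi-Hopf algebras.** Let $k$ be a field. A quasi-Hopf algebra is a unital associative $k$-algebra $H$ with algebra maps $\Delta:H\to H\otimes H$, $\varepsilon:H\to k$, an invertible $\Phi\in H\otimes H\otimes H$, elements $\alpha,\beta\in H$ and a bijective $k$-linear anti-multiplicative map $S:H\to H$. Write $\Delta(h)=h^1\otimes h^2$, $\Phi=X\otimes Y\otimes Z=X'\otimes Y'\otimes Z'$, $\Phi^{-1}=P\otimes Q\otimes R$ (summation understood; primed letters denote an independent copy). The axioms are $(\mathrm{id}\otimes\Delta)\Delta(a)=\Phi\,(\Delta\otimes \mathrm{id})\Delta(a)\,\Phi^{-1}$; $(\mathrm{id}\otimes \mathrm{id}\otimes\Delta)(\Phi)\,(\Delta\otimes \mathrm{id}\otimes \mathrm{id})(\Phi)=(1\otimes\Phi)\,(\mathrm{id}\otimes\Delta\otimes \mathrm{id})(\Phi)\,(\Phi\otimes1)$; $(\varepsilon\otimes \mathrm{id})\Delta=\mathrm{id}=(\mathrm{id}\otimes\varepsilon)\Delta$; $(\mathrm{id}\otimes\varepsilon\otimes \mathrm{id})(\Phi)=1\otimes 1$; $S(h^1)\alpha h^2=\varepsilon(h)\alpha$;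 $h^1\beta S(h^2)=\varepsilon(h)\beta$; $X\beta S(Y)\alpha Z=1$; $S(P)\alpha Q\beta S(R)=1$. The category $H\text{-mod}$ of left $H$-modules is monoidal: $h(v\otimes w)=h^1v\otimes h^2w$, the associator $(U\otimes V)\otimes W\to U\otimes(V\otimes W)$ is the action of $\Phi$, the unit object is $k$ via $\varepsilon$, with the usual unit isomorphisms. **Contragradient bimodule category.** For $H$-modules $V,M$ let $V\triangleleft M=\mathrm{Hom}^l(V,M)$ and $M\triangleright V=\mathrm{Hom}^r(V,M)$. Both have underlying space $\mathrm{Hom}_k(V,M)$; the actions are $h\cdot\varphi=h^1\varphi(S(h^2)-)$ and $h\cdot\varphi=h^2\varphi(S^{-1}(h^1)-)$ respectively. There are natural bijections $$\mathrm{Hom}_H(N\otimes V,M)\cong \mathrm{Hom}_H(N,V\triangleleft M),\qquad f\mapsto\big(n\mapsto f(Pn\otimes Q\beta S(R)-)\big),$$ $$\mathrm{Hom}_H(V\otimes N,M)\cong \mathrm{Hom}_H(N,M\triangleright V),\qquad f\mapsto\big(n\mapsto f(YS^{-1}(\beta)S^{-1}(X)-\otimes Zn)\big).$$ All arrows below are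 written in $H\text{-mod}$. The isomorphisms $V\triangleleft(W\triangleleft M)\cong(V\otimes W)\triangleleft M$, $V\triangleleft(M\triangleright W)\cong(V\triangleleft M)\triangleright W$, $M\triangleright(V\otimes W)\cong(M\triangleright V)\triangleright W$, $k\triangleleft M\cong M\cong M\triangleright k$ are the ones that correspond under these adjunctions to the associator and unit isomorphisms of $H\text{-mod}$. **Weak center.** An object of $\text{w-}\mathcal Z_{H\text{-mod}}(H\text{-mod}^{op})$ is a pair $(M,\tau)$ of an $H$-module $M$ and a natural family of $H$-linear maps $\tau_V:V\triangleleft M\to M\triangleright V$ ($V\in H\text{-mod}$), not necessarily invertible, such that for all $V,W$ the composites $$V\triangleleft(W\triangleleft M)\xrightarrow{\ V\triangleleft\tau_W\ }V\triangleleft(M\triangleright W)\cong(V\triangleleft M)\triangleright W\xrightarrow{\ \tau_V\triangleright W\ }(M\triangleright V)\triangleright W,$$ $$V\triangleleft(W\triangleleft M)\cong(V\otimes W)\triangleleft M\xrightarrow{\ \tau_{V\otimes W}\ }M\triangleright(V\otimes W)\cong(M\triangleright V)\triangleright W$$ agree, and $\tau_k$ is the identity of $M$ under $k\triangleleft M\cong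 M\cong M\triangleright k$. A morphism $(M,\tau)\to(M',\tau')$ is an $H$-linear map $t:M\to M'$ with $\tau'_V\circ(V\triangleleft t)=(t\triangleright V)\circ\tau_V$ for all $V$. **Type I contramodules.** Let $F,F^{-1}\in H\otimes H$ be Drinfeld's twist and its inverse: $$F=(S\otimes S)(\Delta^{op}(P))\,\gamma\,\Delta(Q\beta S(R)),\qquad F^{-1}=\Delta(S(P)\alpha Q)\,\delta\,(S\otimes S)(\Delta^{op}(R)),$$ where $\gamma=S(a^2)\alpha a^3\otimes S(a^1)\alpha a^4$ with $a^1\otimes a^2\otimes a^3\otimes a^4=(\Phi\otimes1)(\Delta\otimes \mathrm{id}\otimes \mathrm{id})(\Phi^{-1})$ and $\delta=b^1\beta S(b^4)\otimes b^2\beta S(b^3)$ with $b^1\otimes b^2\otimes b^3\otimes b^4=(\Delta\otimes \mathrm{id}\otimes \mathrm{id})(\Phi)(\Phi^{-1}\otimes1)$. Put $G=(S^{-1}\otimes S^{-1})(\sigma(F^{-1}))$ with $\sigma$ the flip. (If $\Phi=1\otimes1\otimes1$ and $\alpha=\beta=1$, i.e. for a Hopf algebra, $F=G=1\otimes1$.)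 A left-right anti-Yetter-Drinfeld contramodule of type I is an $H$-module $M$ with a $k$-linear map $\mu:\mathrm{Hom}_k(H,M)\to M$ such that 1. (aYD condition) $h^2\,\mu(f(-S^{-1}(h^1)))=\mu(h^1f(S(h^2)-))$ for all $h\in H$, $f\in\mathrm{Hom}_k(H,M)$; 2. ($\Phi$-twisted contraassociativity) for every $k$-linear $f:H\to\mathrm{Hom}_k(H,M)$, $a\mapsto f_a$, with $\tilde f(a\otimes b)=f_a(b)$, $$\mu\big(h\mapsto Y\mu(x\mapsto f_{S(Z)h}(xS^{-1}(X)))\big)=Z'\,\mu\Big(h\mapsto X\,\tilde f\big((S(Z)\otimes S(Y))\,F\,\Delta(h)\,G\,(S^{-1}(Y')\otimes S^{-1}(X'))\big)\Big);$$ 3. (unit) $\mu(x\mapsto\varepsilon(x)m)=m$ for all $m\in M$. A morphism $(M,\mu)\to(M',\mu')$ is an $H$-linear map $t:M\to M'$ with $t(\mu(f))=\mu'(t\circ f)$ for all $f$. **Theorem.** For every quasi-Hopf algebra $H$, the category of left-right anti-Yetter-Drinfeld contramodules of type I is isomorphic to $\text{w-}\mathcal Z_{H\text{-mod}}(H\text{-mod}^{op})$.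 The isomorphism is the identity on underlying $H$-modules and on underlying maps, and it sends $(M,\mu)$ to $(M,\tau)$ with $\tau_V(f)(v)=\mu(x\mapsto f(xv))$. -/

import Mathlib

open CategoryTheory MonoidalCategory TensorProduct
universe v u

/-- A biclosed monoidal category: besides the right internal homs `ihom V` (right adjoint to
`V ⊗ -`, supplied by `MonoidalClosed`), every functor `- ⊗ V` has a chosen right adjoint, the left
internal hom `homL V`. -/
class BiclosedCategory (C : Type u) [Category.{v} C] [MonoidalCategory.{v} C] extends
    MonoidalClosed C where
  /-- the left internal hom `Hom^l(V, -)` -/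
  homL : C → C ⥤ C
  /-- `Hom(W ⊗ V, M) ≃ Hom(W, Hom^l(V, M))` -/
  adjL : ∀ V : C, tensorRight V ⊣ homL V

namespace Contragradient

variable {C : Type u} [Category.{v} C] [MonoidalCategory.{v} C] [BiclosedCategory C]

/-- The left action `V ◁ M = Hom^l(V, M)` on the contragradient category, as a functor of `M`.
All arrows are written in `C`. -/
abbrev actL (V : C) : C ⥤ C := BiclosedCategory.homL V

/-- The right action `M ▷ V = Hom^r(V, M)`, as a functor of `M`. -/
abbrev actR (V : C) : C ⥤ C := ihom V

/-- The adjunction `Hom(W ⊗ V, M) ≃ Hom(W, V ◁ M)`. -/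
abbrev adjL (V : C) : tensorRight V ⊣ actL V := BiclosedCategory.adjL V

/-- The adjunction `Hom(V ⊗ W, M) ≃ Hom(W, M ▷ V)`. -/
abbrev adjR (V : C) : tensorLeft V ⊣ actR V := ihom.adjunction V

/-- Functoriality of `V ◁ M` in `V`: an arrow `f : V ⟶ W` gives `W ◁ M ⟶ V ◁ M`. -/
def actLPre {V W : C} (f : V ⟶ W) : actL W ⟶ actL V :=
  conjugateEquiv (adjL W) (adjL V) ((tensoringRight C).map f)

/-- Functoriality of `M ▷ V` in `V`: an arrow `f : V ⟶ W` gives `M ▷ W ⟶ M ▷ V`. -/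
def actRPre {V W : C} (f : V ⟶ W) : actR W ⟶ actR V :=
  conjugateEquiv (adjR W) (adjR V) ((tensoringLeft C).map f)

/-- The associativity isomorphism `V ◁ (W ◁ M) ≅ (V ⊗ W) ◁ M`: both sides are right adjoint to
`N ↦ (N ⊗ V) ⊗ W ≅ N ⊗ (V ⊗ W)`. -/
def assocL (V W : C) : actL W ⋙ actL V ≅ actL (V ⊗ W) :=
  conjugateIsoEquiv ((adjL V).comp (adjL W)) (adjL (V ⊗ W)) (tensorRightTensor V W)

/-- The associativity isomorphism `V ◁ (M ▷ W) ≅ (V ◁ M) ▷ W`: both sides are right adjoint to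
`N ↦ W ⊗ (N ⊗ V) ≅ (W ⊗ N) ⊗ V`. -/
def assocM (V W : C) : actR W ⋙ actL V ≅ actL V ⋙ actR W :=
  conjugateIsoEquiv ((adjL V).comp (adjR W)) ((adjR W).comp (adjL V))
    (NatIso.ofComponents (fun N => α_ W N V))

/-- The associativity isomorphism `M ▷ (V ⊗ W) ≅ (M ▷ V) ▷ W`: both sides are right adjoint to
`N ↦ (V ⊗ W) ⊗ N ≅ V ⊗ (W ⊗ N)`. -/
def assocR (V W : C) : actR (V ⊗ W) ≅ actR V ⋙ actR W :=
  conjugateIsoEquiv (adjR (V ⊗ W)) ((adjR W).comp (adjR V)) (tensorLeftTensor V W).symm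

/-- The unit isomorphism `𝟙 ◁ M ≅ M`. -/
def unitL : actL (𝟙_ C) ≅ 𝟭 C :=
  conjugateIsoEquiv (adjL (𝟙_ C)) Adjunction.id (rightUnitorNatIso C).symm

/-- The unit isomorphism `M ▷ 𝟙 ≅ M`. -/
def unitR : actR (𝟙_ C) ≅ 𝟭 C :=
  conjugateIsoEquiv (adjR (𝟙_ C)) Adjunction.id (leftUnitorNatIso C).symm

/-- A weak half braiding on `M`: a natural family `τ_V : V ◁ M ⟶ M ▷ V`, not required to be
invertible, satisfying the hexagon and the unit axiom. -/
structure WeakHalfBraiding (M : C) where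
  τ : ∀ V : C, (actL V).obj M ⟶ (actR V).obj M
  naturality : ∀ {V W : C} (f : V ⟶ W),
    (actLPre f).app M ≫ τ V = τ W ≫ (actRPre f).app M
  hexagon : ∀ V W : C,
    (assocL V W).hom.app M ≫ τ (V ⊗ W) ≫ (assocR V W).hom.app M =
      (actL V).map (τ W) ≫ (assocM V W).hom.app M ≫ (actR W).map (τ V)
  unit : τ (𝟙_ C) ≫ unitR.hom.app M = unitL.hom.app M

variable (C) in
/-- The weak center of the contragradient bimodule category of `C`. -/
structure WeakCenter where
  obj : C
  braiding : WeakHalfBraiding obj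

namespace WeakCenter

/-- A morphism `(M, τ) ⟶ (M', τ')`: an arrow `t : M ⟶ M'` of `C` with
`τ'_V ∘ (V ◁ t) = (t ▷ V) ∘ τ_V` for all `V`. -/
@[ext]
structure Hom (X Y : WeakCenter C) where
  hom : X.obj ⟶ Y.obj
  comm : ∀ V : C, (actL V).map hom ≫ Y.braiding.τ V = X.braiding.τ V ≫ (actR V).map hom

instance : Category (WeakCenter C) where
  Hom := Hom
  id X := ⟨𝟙 _, fun V => by simp⟩
  comp f g := ⟨f.hom ≫ g.hom, fun V => by
    rw [Functor.map_comp, Category.assoc, g.comm, ← Category.assoc, f.comm, Category.assoc,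
      Functor.map_comp]⟩

variable (C) in
/-- The forgetful functor `(M, τ) ↦ M`. -/
def forget : WeakCenter C ⥤ C where
  obj X := X.obj
  map f := Hom.hom f

end WeakCenter

end Contragradient

/-- The linear map `a ⊗ b ↦ f a * x * g b`. -/
noncomputable def sandwich {k H : Type*} [Field k] [Ring H] [Algebra k H] (f g : H →ₗ[k] H)
    (x : H) : H ⊗[k] H →ₗ[k] H :=
  LinearMap.mul' k H ∘ₗ TensorProduct.map (LinearMap.mulRight k x ∘ₗ f) g

@[simp]
theorem sandwich_tmul {k H : Type*} [Field k] [Ring H] [Algebra k H] (f g : H →ₗ[k] H)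
    (x a b : H) : sandwich f g x (a ⊗ₜ b) = f a * x * g b := rfl

/-- A quasi-bialgebra `(H, Δ, ε, Φ)` over the field `k`. -/
class QuasiBialgebra (k H : Type*) [Field k] [Ring H] [Algebra k H] where
  /-- the comultiplication `Δ` -/
  Δ : H →ₐ[k] H ⊗[k] H
  /-- the counit `ε` -/
  ε : H →ₐ[k] k
  /-- the invertible associator `Φ ∈ H ⊗ H ⊗ H` -/
  Φ : (H ⊗[k] (H ⊗[k] H))ˣ
  /-- `(id ⊗ Δ)(Δ a) = Φ ((Δ ⊗ id)(Δ a)) Φ⁻¹` -/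
  coassoc : ∀ a : H, Algebra.TensorProduct.map (AlgHom.id k H) Δ (Δ a) =
    (Φ : H ⊗[k] (H ⊗[k] H)) * Algebra.TensorProduct.assoc k k k H H H
      (Algebra.TensorProduct.map Δ (AlgHom.id k H) (Δ a)) * (Φ⁻¹ : (H ⊗[k] (H ⊗[k] H))ˣ)
  /-- `(id ⊗ id ⊗ Δ)(Φ) (Δ ⊗ id ⊗ id)(Φ) = (1 ⊗ Φ) (id ⊗ Δ ⊗ id)(Φ) (Φ ⊗ 1)` -/
  pentagon :
    Algebra.TensorProduct.map (AlgHom.id k H) (Algebra.TensorProduct.map (AlgHom.id k H) Δ)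
        (Φ : H ⊗[k] (H ⊗[k] H)) *
      Algebra.TensorProduct.assoc k k k H H (H ⊗[k] H)
        (Algebra.TensorProduct.map Δ (AlgHom.id k (H ⊗[k] H)) (Φ : H ⊗[k] (H ⊗[k] H))) =
    (1 : H) ⊗ₜ[k] (Φ : H ⊗[k] (H ⊗[k] H)) *
      Algebra.TensorProduct.map (AlgHom.id k H)
        ((Algebra.TensorProduct.assoc k k k H H H).toAlgHom.comp
          (Algebra.TensorProduct.map Δ (AlgHom.id k H))) (Φ : H ⊗[k] (H ⊗[k] H)) *
      Algebra.TensorProduct.map (AlgHom.id k H)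
        (Algebra.TensorProduct.assoc k k k H H H).toAlgHom
        (Algebra.TensorProduct.assoc k k k H (H ⊗[k] H) H
          ((Φ : H ⊗[k] (H ⊗[k] H)) ⊗ₜ[k] (1 : H)))
  /-- `(ε ⊗ id)(Δ a) = a` -/
  counit_left : ∀ a : H, Algebra.TensorProduct.lid k H
    (Algebra.TensorProduct.map ε (AlgHom.id k H) (Δ a)) = a
  /-- `(id ⊗ ε)(Δ a) = a` -/
  counit_right : ∀ a : H, Algebra.TensorProduct.rid k k H
    (Algebra.TensorProduct.map (AlgHom.id k H) ε (Δ a)) = a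
  /-- `(id ⊗ ε ⊗ id)(Φ) = 1 ⊗ 1` -/
  counit_mid : Algebra.TensorProduct.map (AlgHom.id k H)
    ((Algebra.TensorProduct.lid k H).toAlgHom.comp
      (Algebra.TensorProduct.map ε (AlgHom.id k H))) (Φ : H ⊗[k] (H ⊗[k] H)) = 1

/-- A quasi-Hopf algebra: a quasi-bialgebra with elements `α`, `β` and an (invertible) algebra
anti-automorphism `S`. -/
class QuasiHopfAlgebra (k H : Type*) [Field k] [Ring H] [Algebra k H] extends
    QuasiBialgebra k H where
  /-- the antipode -/
  S : H ≃ₗ[k] H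
  α : H
  β : H
  S_mul : ∀ a b : H, S (a * b) = S b * S a
  /-- `S(h¹) α h² = ε(h) α` -/
  S_α : ∀ h : H, sandwich S.toLinearMap LinearMap.id α (Δ h) = ε h • α
  /-- `h¹ β S(h²) = ε(h) β` -/
  β_S : ∀ h : H, sandwich LinearMap.id S.toLinearMap β (Δ h) = ε h • β
  /-- `X β S(Y) α Z = 1` for `Φ = X ⊗ Y ⊗ Z` -/
  Φ_β_α : sandwich LinearMap.id LinearMap.id β
    ((sandwich S.toLinearMap LinearMap.id α).lTensor H (Φ : H ⊗[k] (H ⊗[k] H))) = 1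
  /-- `S(P) α Q β S(R) = 1` for `Φ⁻¹ = P ⊗ Q ⊗ R` -/
  Φ_α_β : sandwich S.toLinearMap LinearMap.id α
    ((sandwich LinearMap.id S.toLinearMap β).lTensor H
      ((Φ⁻¹ : (H ⊗[k] (H ⊗[k] H))ˣ) : H ⊗[k] (H ⊗[k] H))) = 1

namespace QuasiHopf

open QuasiBialgebra QuasiHopfAlgebra

/-- A left `H`-module over the `k`-algebra `H`: a `k`-vector space with a `k`-algebra homomorphism
`ρ : H → End_k(V)`, i.e. `h · v = ρ h v`. -/
structure HMod (k H : Type u) [Field k] [Ring H] [Algebra k H] : Type (u + 1) where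
  carrier : Type u
  [addCommGroup : AddCommGroup carrier]
  [module : Module k carrier]
  ρ : H →ₐ[k] Module.End k carrier

attribute [instance] HMod.addCommGroup HMod.module

namespace HMod

section Basic

variable {k H : Type u} [Field k] [Ring H] [Algebra k H]

instance : CoeSort (HMod k H) (Type u) := ⟨HMod.carrier⟩

/-- Homomorphisms of `H`-modules. -/
@[ext]
structure Hom (V W : HMod k H) where
  lin : V →ₗ[k] W
  comm : ∀ h : H, lin ∘ₗ V.ρ h = W.ρ h ∘ₗ lin

instance : Category (HMod k H) where
  Hom := Hom
  id V := ⟨LinearMap.id, fun _ => rfl⟩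
  comp f g := ⟨g.lin ∘ₗ f.lin, fun h => by
    rw [LinearMap.comp_assoc, f.comm, ← LinearMap.comp_assoc, g.comm, LinearMap.comp_assoc]⟩

@[ext]
theorem hom_ext {V W : HMod k H} {f g : V ⟶ W} (h : f.lin = g.lin) : f = g := Hom.ext h

@[simp] theorem id_lin (V : HMod k H) : Hom.lin (𝟙 V) = LinearMap.id := rfl
@[simp] theorem comp_lin {U V W : HMod k H} (f : U ⟶ V) (g : V ⟶ W) :
    (f ≫ g).lin = g.lin ∘ₗ f.lin := rfl

theorem comm_apply {V W : HMod k H} (f : V ⟶ W) (h : H) (v : V) :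
    f.lin (V.ρ h v) = W.ρ h (f.lin v) := LinearMap.congr_fun (f.comm h) v

/-- An `H`-linear `k`-linear isomorphism is an isomorphism of `H`-modules. -/
def mkIso {V W : HMod k H} (e : V ≃ₗ[k] W)
    (he : ∀ h : H, e.toLinearMap ∘ₗ V.ρ h = W.ρ h ∘ₗ e.toLinearMap) : V ≅ W where
  hom := ⟨e.toLinearMap, he⟩
  inv := ⟨e.symm.toLinearMap, fun h => by
    ext w
    have := LinearMap.congr_fun (he h) (e.symm w)
    simp at this
    simp [← this]⟩
  hom_inv_id := by ext x; simp
  inv_hom_id := by ext x; simp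

/-- The action of `A ⊗ B` on `V ⊗ W` for an `A`-module `V` and a `B`-module `W`. -/
noncomputable def box {A B V W : Type*} [Ring A] [Algebra k A] [Ring B] [Algebra k B]
    [AddCommGroup V] [Module k V] [AddCommGroup W] [Module k W]
    (ρ : A →ₐ[k] Module.End k V) (σ : B →ₐ[k] Module.End k W) :
    A ⊗[k] B →ₐ[k] Module.End k (V ⊗[k] W) :=
  (Module.endTensorEndAlgHom (R := k) (S := k) (A := k)).comp (Algebra.TensorProduct.map ρ σ)

@[simp]
theorem box_tmul {A B V W : Type*} [Ring A] [Algebra k A] [Ring B] [Algebra k B]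
    [AddCommGroup V] [Module k V] [AddCommGroup W] [Module k W]
    (ρ : A →ₐ[k] Module.End k V) (σ : B →ₐ[k] Module.End k W) (a : A) (b : B) :
    box ρ σ (a ⊗ₜ b) = TensorProduct.map (ρ a) (σ b) := rfl

end Basic

section Monoidal

variable {k H : Type u} [Field k] [Ring H] [Algebra k H] [QuasiBialgebra k H]

/-- `V ⊗ W` with `h (v ⊗ w) = h¹ v ⊗ h² w`. -/
noncomputable def tensor (V W : HMod k H) : HMod k H where
  carrier := V ⊗[k] W
  ρ := (box V.ρ W.ρ).comp Δ

variable (k H) in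
/-- The trivial module `k` with `h · c = ε(h) c`. -/
noncomputable def triv : HMod k H where
  carrier := k
  ρ := (Algebra.lsmul k k k).comp ε

/-- Naturality of the action of `A ⊗ B` on `V ⊗ W`. -/
theorem box_natural {A B V W V' W' : Type*} [Ring A] [Algebra k A] [Ring B] [Algebra k B]
    [AddCommGroup V] [Module k V] [AddCommGroup W] [Module k W]
    [AddCommGroup V'] [Module k V'] [AddCommGroup W'] [Module k W']
    (ρ : A →ₐ[k] Module.End k V) (σ : B →ₐ[k] Module.End k W)
    (ρ' : A →ₐ[k] Module.End k V') (σ' : B →ₐ[k] Module.End k W')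
    (f : V →ₗ[k] V') (g : W →ₗ[k] W') (hf : ∀ a, f ∘ₗ ρ a = ρ' a ∘ₗ f)
    (hg : ∀ b, g ∘ₗ σ b = σ' b ∘ₗ g) (t : A ⊗[k] B) :
    TensorProduct.map f g ∘ₗ box ρ σ t = box ρ' σ' t ∘ₗ TensorProduct.map f g := by
  induction t with
  | zero => simp
  | add x y hx hy => rw [map_add, map_add, LinearMap.comp_add, LinearMap.add_comp, hx, hy]
  | tmul a b =>
    rw [box_tmul, box_tmul, ← TensorProduct.map_comp, ← TensorProduct.map_comp, hf, hg]

noncomputable def tensorMap {V V' W W' : HMod k H} (f : V ⟶ V') (g : W ⟶ W') :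
    tensor V W ⟶ tensor V' W' where
  lin := TensorProduct.map f.lin g.lin
  comm h := box_natural _ _ _ _ _ _ f.comm g.comm (Δ h)

/-- Compatibility of the threefold actions with reassociation. -/
theorem box_assoc {A B D U V W : Type*} [Ring A] [Algebra k A] [Ring B] [Algebra k B]
    [Ring D] [Algebra k D] [AddCommGroup U] [Module k U] [AddCommGroup V] [Module k V]
    [AddCommGroup W] [Module k W] (ρ : A →ₐ[k] Module.End k U) (σ : B →ₐ[k] Module.End k V)
    (π : D →ₐ[k] Module.End k W) (t : (A ⊗[k] B) ⊗[k] D) :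
    (TensorProduct.assoc k U V W).toLinearMap ∘ₗ box (box ρ σ) π t =
      box ρ (box σ π) (Algebra.TensorProduct.assoc k k k A B D t) ∘ₗ
        (TensorProduct.assoc k U V W).toLinearMap := by
  induction t with
  | zero => simp
  | add x y hx hy =>
    rw [map_add, map_add, map_add, LinearMap.comp_add, LinearMap.add_comp, hx, hy]
  | tmul s d =>
    induction s with
    | zero => simp
    | add x y hx hy =>
      rw [add_tmul, map_add, map_add, map_add, LinearMap.comp_add, LinearMap.add_comp, hx, hy]
    | tmul a b => ext u v w; simp

theorem box_comp_map {A B A' B' V W : Type*} [Ring A] [Algebra k A] [Ring B] [Algebra k B]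
    [Ring A'] [Algebra k A'] [Ring B'] [Algebra k B']
    [AddCommGroup V] [Module k V] [AddCommGroup W] [Module k W]
    (ρ : A →ₐ[k] Module.End k V) (σ : B →ₐ[k] Module.End k W) (f : A' →ₐ[k] A) (g : B' →ₐ[k] B)
    (t : A' ⊗[k] B') :
    box ρ σ (Algebra.TensorProduct.map f g t) = box (ρ.comp f) (σ.comp g) t := by
  induction t with
  | zero => simp
  | add x y hx hy => simp only [map_add, hx, hy]
  | tmul a b => rfl

/-- The action of a unit of an algebra as a linear equivalence. -/
noncomputable def unitEquiv {A V : Type*} [Ring A] [Algebra k A] [AddCommGroup V] [Module k V]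
    (ρ : A →ₐ[k] Module.End k V) (x : Aˣ) : V ≃ₗ[k] V :=
  LinearEquiv.ofLinearMap (ρ x) (ρ (x⁻¹ : Aˣ))
    (by rw [← Module.End.mul_eq_comp, ← map_mul, x.mul_inv, map_one]; rfl)
    (by rw [← Module.End.mul_eq_comp, ← map_mul, x.inv_mul, map_one]; rfl)

/-- The associator `(U ⊗ V) ⊗ W ≅ U ⊗ (V ⊗ W)`, `(u ⊗ v) ⊗ w ↦ X u ⊗ (Y v ⊗ Z w)`. -/
noncomputable def associator (U V W : HMod k H) :
    tensor (tensor U V) W ≅ tensor U (tensor V W) :=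
  mkIso (V := tensor (tensor U V) W) (W := tensor U (tensor V W))
    ((TensorProduct.assoc k U V W).trans (unitEquiv (box U.ρ (box V.ρ W.ρ)) (Φ (k := k)))) (by
      intro h
      change (box U.ρ (box V.ρ W.ρ) (Φ : (H ⊗[k] (H ⊗[k] H))ˣ) ∘ₗ
        (TensorProduct.assoc k U V W).toLinearMap) ∘ₗ
          box ((box U.ρ V.ρ).comp Δ) W.ρ (Δ h) =
        box U.ρ ((box V.ρ W.ρ).comp Δ) (Δ h) ∘ₗ
          (box U.ρ (box V.ρ W.ρ) (Φ : (H ⊗[k] (H ⊗[k] H))ˣ) ∘ₗ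
            (TensorProduct.assoc k U V W).toLinearMap)
      have h1 := box_comp_map (box U.ρ V.ρ) W.ρ Δ (AlgHom.id k H) (Δ h)
      have h2 := box_comp_map U.ρ (box V.ρ W.ρ) (AlgHom.id k H) Δ (Δ h)
      rw [AlgHom.comp_id] at h1 h2
      rw [← h1, ← h2, LinearMap.comp_assoc, box_assoc, coassoc, map_mul, map_mul]
      simp only [Module.End.mul_eq_comp, LinearMap.comp_assoc]
      congr 2
      rw [← LinearMap.comp_assoc, ← Module.End.mul_eq_comp, ← map_mul, Units.inv_mul, map_one]
      rfl)

theorem lid_box {B W : Type*} [Ring B] [Algebra k B] [AddCommGroup W] [Module k W]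
    (σ : B →ₐ[k] Module.End k W) (t : k ⊗[k] B) :
    (TensorProduct.lid k W).toLinearMap ∘ₗ box (Algebra.lsmul k k k) σ t =
      σ (Algebra.TensorProduct.lid k B t) ∘ₗ (TensorProduct.lid k W).toLinearMap := by
  induction t with
  | zero => simp
  | add x y hx hy => simp only [map_add, LinearMap.comp_add, LinearMap.add_comp, hx, hy]
  | tmul a b => ext; simp

theorem rid_box {B W : Type*} [Ring B] [Algebra k B] [AddCommGroup W] [Module k W]
    (σ : B →ₐ[k] Module.End k W) (t : B ⊗[k] k) :
    (TensorProduct.rid k W).toLinearMap ∘ₗ box σ (Algebra.lsmul k k k) t =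
      σ (Algebra.TensorProduct.rid k k B t) ∘ₗ (TensorProduct.rid k W).toLinearMap := by
  induction t with
  | zero => simp
  | add x y hx hy => simp only [map_add, LinearMap.comp_add, LinearMap.add_comp, hx, hy]
  | tmul a b => ext; simp

noncomputable def leftUnitor (V : HMod k H) : tensor (triv k H) V ≅ V :=
  mkIso (V := tensor (triv k H) V) (TensorProduct.lid k V) (by
    intro h
    change (TensorProduct.lid k V).toLinearMap ∘ₗ
      box ((Algebra.lsmul k k k).comp ε) V.ρ (Δ h) = _
    have h1 := box_comp_map (Algebra.lsmul k k k) V.ρ ε (AlgHom.id k H) (Δ h)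
    rw [AlgHom.comp_id] at h1
    rw [← h1, lid_box, counit_left]
    rfl)

noncomputable def rightUnitor (V : HMod k H) : tensor V (triv k H) ≅ V :=
  mkIso (V := tensor V (triv k H)) (TensorProduct.rid k V) (by
    intro h
    change (TensorProduct.rid k V).toLinearMap ∘ₗ
      box V.ρ ((Algebra.lsmul k k k).comp ε) (Δ h) = _
    have h1 := box_comp_map V.ρ (Algebra.lsmul k k k) (AlgHom.id k H) ε (Δ h)
    rw [AlgHom.comp_id] at h1
    rw [← h1, rid_box, counit_right]
    rfl)

noncomputable instance : MonoidalCategoryStruct (HMod k H) where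
  tensorObj := tensor
  whiskerLeft V _ _ f := tensorMap (𝟙 V) f
  whiskerRight f W := tensorMap f (𝟙 W)
  tensorHom := tensorMap
  tensorUnit := triv k H
  associator := associator
  leftUnitor := leftUnitor
  rightUnitor := rightUnitor

theorem associator_hom_lin (U V W : HMod k H) : (associator U V W).hom.lin =
    box U.ρ (box V.ρ W.ρ) (Φ : (H ⊗[k] (H ⊗[k] H))ˣ) ∘ₗ
      (TensorProduct.assoc k U V W).toLinearMap := rfl

theorem pentagon_lin (U V W X : HMod k H) :
    tensorMap (associator U V W).hom (𝟙 X) ≫ (associator U (tensor V W) X).hom ≫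
        tensorMap (𝟙 U) (associator V W X).hom =
      (associator (tensor U V) W X).hom ≫ (associator U V (tensor W X)).hom := by
  apply hom_ext
  change TensorProduct.map LinearMap.id
        (box V.ρ (box W.ρ X.ρ) (Φ : (H ⊗[k] (H ⊗[k] H))ˣ) ∘ₗ
          (TensorProduct.assoc k V W X).toLinearMap) ∘ₗ
      ((box U.ρ (box ((box V.ρ W.ρ).comp Δ) X.ρ) (Φ : (H ⊗[k] (H ⊗[k] H))ˣ) ∘ₗ
        (TensorProduct.assoc k U (V ⊗[k] W) X).toLinearMap) ∘ₗ
      TensorProduct.map (box U.ρ (box V.ρ W.ρ) (Φ : (H ⊗[k] (H ⊗[k] H))ˣ) ∘ₗ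
          (TensorProduct.assoc k U V W).toLinearMap) LinearMap.id) =
    (box U.ρ (box V.ρ ((box W.ρ X.ρ).comp Δ)) (Φ : (H ⊗[k] (H ⊗[k] H))ˣ) ∘ₗ
        (TensorProduct.assoc k U V (W ⊗[k] X)).toLinearMap) ∘ₗ
      (box ((box U.ρ V.ρ).comp Δ) (box W.ρ X.ρ) (Φ : (H ⊗[k] (H ⊗[k] H))ˣ) ∘ₗ
        (TensorProduct.assoc k (U ⊗[k] V) W X).toLinearMap)
  set b4 := box U.ρ (box V.ρ (box W.ρ X.ρ)) with hb4
  have e1 : TensorProduct.map LinearMap.id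
        (box V.ρ (box W.ρ X.ρ) (Φ : (H ⊗[k] (H ⊗[k] H))ˣ) ∘ₗ
          (TensorProduct.assoc k V W X).toLinearMap) =
      b4 ((1 : H) ⊗ₜ[k] ((Φ : (H ⊗[k] (H ⊗[k] H))ˣ) : H ⊗[k] (H ⊗[k] H))) ∘ₗ
        TensorProduct.map LinearMap.id (TensorProduct.assoc k V W X).toLinearMap := by
    rw [hb4, box_tmul, map_one, ← TensorProduct.map_comp]
    rfl
  have e2 : TensorProduct.map (LinearMap.id (M := U)) (TensorProduct.assoc k V W X).toLinearMap ∘ₗ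
      box U.ρ (box ((box V.ρ W.ρ).comp Δ) X.ρ) (Φ : (H ⊗[k] (H ⊗[k] H))ˣ) =
      b4 (Algebra.TensorProduct.map (AlgHom.id k H)
        ((Algebra.TensorProduct.assoc k k k H H H).toAlgHom.comp
          (Algebra.TensorProduct.map Δ (AlgHom.id k H)))
          ((Φ : (H ⊗[k] (H ⊗[k] H))ˣ) : H ⊗[k] (H ⊗[k] H))) ∘ₗ
        TensorProduct.map LinearMap.id (TensorProduct.assoc k V W X).toLinearMap := by
    rw [hb4, box_comp_map, AlgHom.comp_id]
    refine box_natural _ _ _ _ _ _ (fun _ => rfl) (fun b => ?_) _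
    have h1 := box_comp_map (box V.ρ W.ρ) X.ρ Δ (AlgHom.id k H) b
    rw [AlgHom.comp_id] at h1
    rw [← h1, box_assoc]
    rfl
  have e3 : TensorProduct.map (LinearMap.id (M := U)) (TensorProduct.assoc k V W X).toLinearMap ∘ₗ
      (TensorProduct.assoc k U (V ⊗[k] W) X).toLinearMap ∘ₗ
      TensorProduct.map (box U.ρ (box V.ρ W.ρ) (Φ : (H ⊗[k] (H ⊗[k] H))ˣ)) LinearMap.id =
      b4 (Algebra.TensorProduct.map (AlgHom.id k H)
        (Algebra.TensorProduct.assoc k k k H H H).toAlgHom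
        (Algebra.TensorProduct.assoc k k k H (H ⊗[k] H) H
          (((Φ : (H ⊗[k] (H ⊗[k] H))ˣ) : H ⊗[k] (H ⊗[k] H)) ⊗ₜ[k] (1 : H)))) ∘ₗ
        TensorProduct.map LinearMap.id (TensorProduct.assoc k V W X).toLinearMap ∘ₗ
          (TensorProduct.assoc k U (V ⊗[k] W) X).toLinearMap := by
    have h1 : TensorProduct.map (box U.ρ (box V.ρ W.ρ) (Φ : (H ⊗[k] (H ⊗[k] H))ˣ))
        (LinearMap.id (M := X)) = box (box U.ρ (box V.ρ W.ρ)) X.ρ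
          (((Φ : (H ⊗[k] (H ⊗[k] H))ˣ) : H ⊗[k] (H ⊗[k] H)) ⊗ₜ[k] (1 : H)) := by
      rw [box_tmul, map_one]; rfl
    rw [h1, box_assoc, hb4, box_comp_map, AlgHom.comp_id, ← LinearMap.comp_assoc,
      ← LinearMap.comp_assoc]
    congr 1
    refine box_natural _ _ _ _ _ _ (fun _ => rfl) (fun b => ?_) _
    rw [box_assoc]
    rfl
  have e4 : box U.ρ (box V.ρ ((box W.ρ X.ρ).comp Δ)) (Φ : (H ⊗[k] (H ⊗[k] H))ˣ) =
      b4 (Algebra.TensorProduct.map (AlgHom.id k H) (Algebra.TensorProduct.map (AlgHom.id k H) Δ)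
        ((Φ : (H ⊗[k] (H ⊗[k] H))ˣ) : H ⊗[k] (H ⊗[k] H))) := by
    rw [hb4, box_comp_map, AlgHom.comp_id]
    congr 2
    refine AlgHom.ext fun x => ?_
    have h1 := box_comp_map V.ρ (box W.ρ X.ρ) (AlgHom.id k H) Δ x
    rw [AlgHom.comp_id] at h1
    exact h1.symm
  have e5 : (TensorProduct.assoc k U V (W ⊗[k] X)).toLinearMap ∘ₗ
      box ((box U.ρ V.ρ).comp Δ) (box W.ρ X.ρ) (Φ : (H ⊗[k] (H ⊗[k] H))ˣ) =
      b4 (Algebra.TensorProduct.assoc k k k H H (H ⊗[k] H)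
        (Algebra.TensorProduct.map Δ (AlgHom.id k (H ⊗[k] H))
          ((Φ : (H ⊗[k] (H ⊗[k] H))ˣ) : H ⊗[k] (H ⊗[k] H)))) ∘ₗ
        (TensorProduct.assoc k U V (W ⊗[k] X)).toLinearMap := by
    have h1 := box_comp_map (box U.ρ V.ρ) (box W.ρ X.ρ) Δ (AlgHom.id k (H ⊗[k] H))
      ((Φ : (H ⊗[k] (H ⊗[k] H))ˣ) : H ⊗[k] (H ⊗[k] H))
    rw [AlgHom.comp_id] at h1
    rw [← h1, box_assoc]
  have e6 : TensorProduct.map (LinearMap.id (M := U)) (TensorProduct.assoc k V W X).toLinearMap ∘ₗ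
      (TensorProduct.assoc k U (V ⊗[k] W) X).toLinearMap ∘ₗ
      TensorProduct.map (TensorProduct.assoc k U V W).toLinearMap LinearMap.id =
      (TensorProduct.assoc k U V (W ⊗[k] X)).toLinearMap ∘ₗ
        (TensorProduct.assoc k (U ⊗[k] V) W X).toLinearMap := by
    ext u v w x; rfl
  have e7 : TensorProduct.map (box U.ρ (box V.ρ W.ρ) (Φ : (H ⊗[k] (H ⊗[k] H))ˣ) ∘ₗ
      (TensorProduct.assoc k U V W).toLinearMap) (LinearMap.id (M := X)) =
      TensorProduct.map (box U.ρ (box V.ρ W.ρ) (Φ : (H ⊗[k] (H ⊗[k] H))ˣ)) LinearMap.id ∘ₗ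
        TensorProduct.map (TensorProduct.assoc k U V W).toLinearMap LinearMap.id := by
    rw [← TensorProduct.map_comp]; rfl
  rw [e1, e4, e7]
  refine LinearMap.ext fun t => ?_
  have E2 := fun z => LinearMap.congr_fun e2 z
  have E3 := fun z => LinearMap.congr_fun e3 z
  have E5 := fun z => LinearMap.congr_fun e5 z
  have E6 := fun z => LinearMap.congr_fun e6 z
  have hp := LinearMap.congr_fun (congrArg b4 (QuasiBialgebra.pentagon (k := k) (H := H)))
    ((TensorProduct.assoc k U V (W ⊗[k] X)) ((TensorProduct.assoc k (U ⊗[k] V) W X) t))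
  simp only [map_mul, LinearMap.comp_apply, Module.End.mul_apply, LinearEquiv.coe_coe]
    at E2 E3 E5 E6 hp ⊢
  rw [E2, E3, E6, E5, hp]

theorem triangle_aux (V W : HMod k H) (t : (V ⊗[k] k) ⊗[k] W) :
    TensorProduct.map (LinearMap.id (M := V)) (TensorProduct.lid k W).toLinearMap
      (box V.ρ (box ((Algebra.lsmul k k k).comp (ε : H →ₐ[k] k)) W.ρ)
        ((Φ : (H ⊗[k] (H ⊗[k] H))ˣ) : H ⊗[k] (H ⊗[k] H))
        (TensorProduct.assoc k V k W t)) =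
      TensorProduct.map (TensorProduct.rid k V).toLinearMap LinearMap.id t := by
  have h1 : TensorProduct.map (LinearMap.id (M := V)) (TensorProduct.lid k W).toLinearMap ∘ₗ
    box V.ρ (box ((Algebra.lsmul k k k).comp (ε : H →ₐ[k] k)) W.ρ)
        ((Φ : (H ⊗[k] (H ⊗[k] H))ˣ) : H ⊗[k] (H ⊗[k] H)) =
    box V.ρ W.ρ (Algebra.TensorProduct.map (AlgHom.id k H)
      ((Algebra.TensorProduct.lid k H).toAlgHom.comp
        (Algebra.TensorProduct.map ε (AlgHom.id k H)))
        ((Φ : (H ⊗[k] (H ⊗[k] H))ˣ) : H ⊗[k] (H ⊗[k] H))) ∘ₗ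
      TensorProduct.map (LinearMap.id (M := V)) (TensorProduct.lid k W).toLinearMap := by
    rw [box_comp_map, AlgHom.comp_id]
    refine box_natural _ _ _ _ _ _ (fun _ => rfl) (fun b => ?_) _
    have h2 := box_comp_map (Algebra.lsmul k k k) W.ρ ε (AlgHom.id k H) b
    rw [AlgHom.comp_id] at h2
    rw [← h2, lid_box]
    rfl
  have h3 : TensorProduct.map (LinearMap.id (M := V)) (TensorProduct.lid k W).toLinearMap ∘ₗ
      (TensorProduct.assoc k V k W).toLinearMap =
      TensorProduct.map (TensorProduct.rid k V).toLinearMap LinearMap.id := by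
    ext v w
    simp
  have h4 := LinearMap.congr_fun h1 (TensorProduct.assoc k V k W t)
  rw [counit_mid, map_one] at h4
  exact h4.trans (LinearMap.congr_fun h3 t)

theorem triangle_lin (V W : HMod k H) :
    (associator V (triv k H) W).hom ≫ tensorMap (𝟙 V) (leftUnitor W).hom =
      tensorMap (rightUnitor V).hom (𝟙 W) :=
  hom_ext (LinearMap.ext fun t => triangle_aux V W t)

noncomputable instance : MonoidalCategory (HMod k H) where
  tensorHom_def f g := by
    apply hom_ext
    exact (TensorProduct.map_comp LinearMap.id g.lin f.lin LinearMap.id)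
  id_tensorHom_id V W := hom_ext TensorProduct.map_id
  tensorHom_comp_tensorHom f g f' g' := hom_ext (TensorProduct.map_comp _ _ _ _).symm
  whiskerLeft_id V W := hom_ext TensorProduct.map_id
  id_whiskerRight V W := hom_ext TensorProduct.map_id
  associator_naturality {U V W U' V' W'} f g h := by
    apply hom_ext
    change (box U'.ρ (box V'.ρ W'.ρ) (Φ : (H ⊗[k] (H ⊗[k] H))ˣ) ∘ₗ
        (TensorProduct.assoc k U' V' W').toLinearMap) ∘ₗ
        TensorProduct.map (TensorProduct.map f.lin g.lin) h.lin =
      TensorProduct.map f.lin (TensorProduct.map g.lin h.lin) ∘ₗ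
        (box U.ρ (box V.ρ W.ρ) (Φ : (H ⊗[k] (H ⊗[k] H))ˣ) ∘ₗ
        (TensorProduct.assoc k U V W).toLinearMap)
    rw [← LinearMap.comp_assoc, box_natural _ _ U'.ρ (box V'.ρ W'.ρ) f.lin _ f.comm
      (box_natural _ _ _ _ _ _ g.comm h.comm), LinearMap.comp_assoc, LinearMap.comp_assoc]
    congr 1
    ext u v w
    rfl
  leftUnitor_naturality {V W} f := by
    apply hom_ext
    change (TensorProduct.lid k W).toLinearMap ∘ₗ TensorProduct.map LinearMap.id f.lin =
      f.lin ∘ₗ (TensorProduct.lid k V).toLinearMap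
    ext; simp
  rightUnitor_naturality {V W} f := by
    apply hom_ext
    change (TensorProduct.rid k W).toLinearMap ∘ₗ TensorProduct.map f.lin LinearMap.id =
      f.lin ∘ₗ (TensorProduct.rid k V).toLinearMap
    ext; simp
  pentagon := pentagon_lin
  triangle := triangle_lin

end Monoidal
end HMod
end QuasiHopf

namespace QuasiHopf
open QuasiBialgebra QuasiHopfAlgebra

section Elements

variable {k H : Type*} [Field k] [Ring H] [Algebra k H]

/-- `a ⊗ b ⊗ c ↦ c ⊗ b ⊗ a` -/
noncomputable def rev : H ⊗[k] (H ⊗[k] H) ≃ₐ[k] H ⊗[k] (H ⊗[k] H) :=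
  ((Algebra.TensorProduct.comm k H (H ⊗[k] H)).trans
    (Algebra.TensorProduct.congr (Algebra.TensorProduct.comm k H H) AlgEquiv.refl)).trans
    (Algebra.TensorProduct.assoc k k k H H H)

@[simp]
theorem rev_tmul (a b c : H) : rev (k := k) (a ⊗ₜ (b ⊗ₜ c)) = c ⊗ₜ (b ⊗ₜ a) := rfl

/-- `a ⊗ b ⊗ c ⊗ d ↦ d ⊗ c ⊗ b ⊗ a` -/
noncomputable def rev4 : H ⊗[k] (H ⊗[k] (H ⊗[k] H)) ≃ₐ[k] H ⊗[k] (H ⊗[k] (H ⊗[k] H)) :=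
  ((Algebra.TensorProduct.comm k H (H ⊗[k] (H ⊗[k] H))).trans
    (Algebra.TensorProduct.congr rev AlgEquiv.refl)).trans
    ((Algebra.TensorProduct.assoc k k k H (H ⊗[k] H) H).trans
      (Algebra.TensorProduct.congr AlgEquiv.refl (Algebra.TensorProduct.assoc k k k H H H)))

@[simp]
theorem rev4_tmul (a b c d : H) :
    rev4 (k := k) (a ⊗ₜ (b ⊗ₜ (c ⊗ₜ d))) = d ⊗ₜ (c ⊗ₜ (b ⊗ₜ a)) := rfl

theorem induction3 {p : H ⊗[k] (H ⊗[k] H) → Prop} (x : H ⊗[k] (H ⊗[k] H))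
    (h : ∀ a b c : H, p (a ⊗ₜ (b ⊗ₜ c))) (hadd : ∀ x y, p x → p y → p (x + y)) (h0 : p 0) :
    p x := by
  induction x with
  | zero => exact h0
  | add x y hx hy => exact hadd x y hx hy
  | tmul a y =>
    induction y with
    | zero => rw [tmul_zero]; exact h0
    | add x y hx hy => rw [tmul_add]; exact hadd _ _ hx hy
    | tmul b c => exact h a b c

theorem rev4_c (x : H ⊗[k] (H ⊗[k] H)) :
    rev4 ((1 : H) ⊗ₜ[k] x) = Algebra.TensorProduct.map (AlgHom.id k H)
        (Algebra.TensorProduct.assoc k k k H H H).toAlgHom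
        (Algebra.TensorProduct.assoc k k k H (H ⊗[k] H) H (rev x ⊗ₜ[k] (1 : H))) := by
  induction x using induction3 with
  | h0 => simp
  | hadd x y hx hy => simp only [map_add, tmul_add, add_tmul, hx, hy]
  | h a b c =>
    rfl

theorem rev4_d (x : H ⊗[k] (H ⊗[k] H)) :
    rev4 (Algebra.TensorProduct.map (AlgHom.id k H)
        (Algebra.TensorProduct.assoc k k k H H H).toAlgHom
        (Algebra.TensorProduct.assoc k k k H (H ⊗[k] H) H (x ⊗ₜ[k] (1 : H)))) =
      (1 : H) ⊗ₜ[k] rev x := by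
  induction x using induction3 with
  | h0 => simp
  | hadd x y hx hy => simp only [map_add, tmul_add, add_tmul, hx, hy]
  | h a b c =>
    rfl

variable [QuasiBialgebra k H]

/-- The opposite comultiplication `h ↦ h² ⊗ h¹`. -/
noncomputable def Δop : H →ₐ[k] H ⊗[k] H :=
  (Algebra.TensorProduct.comm k H H).toAlgHom.comp Δ

theorem rev4_a (x : H ⊗[k] (H ⊗[k] H)) :
    rev4 (Algebra.TensorProduct.assoc k k k H H (H ⊗[k] H)
      (Algebra.TensorProduct.map Δ (AlgHom.id k (H ⊗[k] H)) x)) =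
    Algebra.TensorProduct.map (AlgHom.id k H) (Algebra.TensorProduct.map (AlgHom.id k H) Δop)
      (rev x) := by
  induction x using induction3 with
  | h0 => simp
  | hadd x y hx hy => simp only [map_add, hx, hy]
  | h a b c =>
    simp only [Algebra.TensorProduct.map_tmul, AlgHom.coe_id, id, rev_tmul, Δop, AlgHom.comp_apply]
    generalize (Δ a : H ⊗[k] H) = s
    induction s with
    | zero => simp
    | add x y hx hy => simp only [add_tmul, tmul_add, map_add, hx, hy]
    | tmul a b => rfl

theorem rev4_b (x : H ⊗[k] (H ⊗[k] H)) :
    rev4 (Algebra.TensorProduct.map (AlgHom.id k H)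
      (Algebra.TensorProduct.map (AlgHom.id k H) Δ) x) =
    Algebra.TensorProduct.assoc k k k H H (H ⊗[k] H)
      (Algebra.TensorProduct.map Δop (AlgHom.id k (H ⊗[k] H)) (rev x)) := by
  induction x using induction3 with
  | h0 => simp
  | hadd x y hx hy => simp only [map_add, hx, hy]
  | h a b c =>
    simp only [Algebra.TensorProduct.map_tmul, AlgHom.coe_id, id, rev_tmul, Δop, AlgHom.comp_apply]
    generalize (Δ c : H ⊗[k] H) = s
    induction s with
    | zero => simp
    | add x y hx hy => simp only [add_tmul, tmul_add, map_add, hx, hy]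
    | tmul a b => rfl

theorem rev4_e (x : H ⊗[k] (H ⊗[k] H)) :
    rev4 (Algebra.TensorProduct.map (AlgHom.id k H)
        ((Algebra.TensorProduct.assoc k k k H H H).toAlgHom.comp
          (Algebra.TensorProduct.map Δ (AlgHom.id k H))) x) =
      Algebra.TensorProduct.map (AlgHom.id k H)
        ((Algebra.TensorProduct.assoc k k k H H H).toAlgHom.comp
          (Algebra.TensorProduct.map Δop (AlgHom.id k H))) (rev x) := by
  induction x using induction3 with
  | h0 => simp
  | hadd x y hx hy => simp only [map_add, hx, hy]
  | h a b c =>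
    simp only [Algebra.TensorProduct.map_tmul, AlgHom.coe_id, id, rev_tmul, Δop, AlgHom.comp_apply]
    generalize (Δ b : H ⊗[k] H) = s
    induction s with
    | zero => simp
    | add x y hx hy => simp only [add_tmul, tmul_add, map_add, hx, hy]
    | tmul a b => rfl

theorem rev_coassoc_a (t : H ⊗[k] H) :
    rev (Algebra.TensorProduct.assoc k k k H H H
      (Algebra.TensorProduct.map Δ (AlgHom.id k H) t)) =
    Algebra.TensorProduct.map (AlgHom.id k H) Δop (Algebra.TensorProduct.comm k H H t) := by
  induction t with
  | zero => simp
  | add x y hx hy => simp only [map_add, hx, hy]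
  | tmul a b =>
    simp only [Algebra.TensorProduct.map_tmul, AlgHom.coe_id, id, Δop, AlgHom.comp_apply,
      Algebra.TensorProduct.comm_tmul]
    generalize (Δ a : H ⊗[k] H) = s
    induction s with
    | zero => simp
    | add x y hx hy => simp only [add_tmul, tmul_add, map_add, hx, hy]
    | tmul a b => rfl

theorem rev_coassoc_b (t : H ⊗[k] H) :
    rev (Algebra.TensorProduct.map (AlgHom.id k H) Δ t) =
    Algebra.TensorProduct.assoc k k k H H H
      (Algebra.TensorProduct.map Δop (AlgHom.id k H) (Algebra.TensorProduct.comm k H H t)) := by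
  induction t with
  | zero => simp
  | add x y hx hy => simp only [map_add, hx, hy]
  | tmul a b =>
    simp only [Algebra.TensorProduct.map_tmul, AlgHom.coe_id, id, Δop, AlgHom.comp_apply,
      Algebra.TensorProduct.comm_tmul]
    generalize (Δ b : H ⊗[k] H) = s
    induction s with
    | zero => simp
    | add x y hx hy => simp only [add_tmul, tmul_add, map_add, hx, hy]
    | tmul a b => rfl

theorem map_Φ_mul {T : Type*} [Semiring T] [Algebra k T] (f : H ⊗[k] (H ⊗[k] H) →ₐ[k] T) :
    f ((Φ : (H ⊗[k] (H ⊗[k] H))ˣ) : H ⊗[k] (H ⊗[k] H)) *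
      f ((Φ⁻¹ : (H ⊗[k] (H ⊗[k] H))ˣ) : H ⊗[k] (H ⊗[k] H)) = 1 := by
  rw [← map_mul, Units.mul_inv, map_one]

theorem map_Φ_inv_mul {T : Type*} [Semiring T] [Algebra k T] (f : H ⊗[k] (H ⊗[k] H) →ₐ[k] T) :
    f ((Φ⁻¹ : (H ⊗[k] (H ⊗[k] H))ˣ) : H ⊗[k] (H ⊗[k] H)) *
      f ((Φ : (H ⊗[k] (H ⊗[k] H))ˣ) : H ⊗[k] (H ⊗[k] H)) = 1 := by
  rw [← map_mul, Units.inv_mul, map_one]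

theorem inv_pentagon {M : Type*} [Monoid M] {a b c d e a' b' c' d' e' : M}
    (h : a * b = c * d * e) (ha : a * a' = 1) (hb : b * b' = 1) (hc : c' * c = 1)
    (hd : d' * d = 1) (he : e' * e = 1) : b' * a' = e' * d' * c' := by
  refine (left_inv_eq_right_inv (a := a * b) ?_ ?_).symm
  · rw [h]
    calc e' * d' * c' * (c * d * e) = e' * (d' * (c' * c) * d) * e := by simp only [mul_assoc]
      _ = 1 := by rw [hc, mul_one, hd, mul_one, he]
  · calc a * b * (b' * a') = a * (b * b') * a' := by simp only [mul_assoc]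
      _ = 1 := by rw [hb, mul_one, ha]

/-- The coopposite quasi-bialgebra `(H, Δ^op, ε, (Φ⁻¹)³²¹)`. -/
@[reducible]
noncomputable def copQuasiBialgebra : QuasiBialgebra k H where
  Δ := Δop
  ε := ε
  Φ := ⟨rev ((Φ⁻¹ : (H ⊗[k] (H ⊗[k] H))ˣ) : H ⊗[k] (H ⊗[k] H)),
    rev ((Φ : (H ⊗[k] (H ⊗[k] H))ˣ) : H ⊗[k] (H ⊗[k] H)),
    by rw [← map_mul, Units.inv_mul, map_one], by rw [← map_mul, Units.mul_inv, map_one]⟩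
  coassoc a := by
    have h := congrArg rev (coassoc (k := k) a)
    rw [map_mul, map_mul, rev_coassoc_a, rev_coassoc_b] at h
    change Algebra.TensorProduct.map (AlgHom.id k H) Δop
      (Algebra.TensorProduct.comm k H H (Δ a)) =
      rev ((Φ⁻¹ : (H ⊗[k] (H ⊗[k] H))ˣ) : H ⊗[k] (H ⊗[k] H)) * Algebra.TensorProduct.assoc k k k H H H
      (Algebra.TensorProduct.map Δop (AlgHom.id k H) (Algebra.TensorProduct.comm k H H (Δ a))) *
      rev ((Φ : (H ⊗[k] (H ⊗[k] H))ˣ) : H ⊗[k] (H ⊗[k] H))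
    rw [h, ← mul_assoc, ← mul_assoc, ← map_mul, Units.inv_mul, map_one, one_mul,
      mul_assoc, ← map_mul, Units.inv_mul, map_one, mul_one]
  pentagon := by
    have h := QuasiBialgebra.pentagon (k := k) (H := H)
    set A := Algebra.TensorProduct.map (AlgHom.id k H) (Algebra.TensorProduct.map (AlgHom.id k H)
      (Δ : H →ₐ[k] H ⊗[k] H)) with hA
    set B := (Algebra.TensorProduct.assoc k k k H H (H ⊗[k] H)).toAlgHom.comp
        (Algebra.TensorProduct.map (Δ : H →ₐ[k] H ⊗[k] H) (AlgHom.id k (H ⊗[k] H))) with hB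
    set D := Algebra.TensorProduct.map (AlgHom.id k H)
        ((Algebra.TensorProduct.assoc k k k H H H).toAlgHom.comp
          (Algebra.TensorProduct.map (Δ : H →ₐ[k] H ⊗[k] H) (AlgHom.id k H))) with hD
    let C : H ⊗[k] (H ⊗[k] H) →ₐ[k] H ⊗[k] (H ⊗[k] (H ⊗[k] H)) :=
      Algebra.TensorProduct.includeRight
    let E : H ⊗[k] (H ⊗[k] H) →ₐ[k] H ⊗[k] (H ⊗[k] (H ⊗[k] H)) :=
      (Algebra.TensorProduct.map (AlgHom.id k H)
        (Algebra.TensorProduct.assoc k k k H H H).toAlgHom).comp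
        ((Algebra.TensorProduct.assoc k k k H (H ⊗[k] H) H).toAlgHom.comp
          Algebra.TensorProduct.includeLeft)
    have h1 : A ((Φ : (H ⊗[k] (H ⊗[k] H))ˣ) : H ⊗[k] (H ⊗[k] H)) * B ((Φ : (H ⊗[k] (H ⊗[k] H))ˣ) : H ⊗[k] (H ⊗[k] H)) =
      C ((Φ : (H ⊗[k] (H ⊗[k] H))ˣ) : H ⊗[k] (H ⊗[k] H)) * D ((Φ : (H ⊗[k] (H ⊗[k] H))ˣ) : H ⊗[k] (H ⊗[k] H)) * E ((Φ : (H ⊗[k] (H ⊗[k] H))ˣ) : H ⊗[k] (H ⊗[k] H)) := h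
    have hE := map_Φ_inv_mul E
    have h2 := inv_pentagon h1
      (map_Φ_mul A) (map_Φ_mul B) (map_Φ_inv_mul C) (map_Φ_inv_mul D) hE
    have h3 := congrArg rev4 h2
    simp only [map_mul] at h3
    exact (congrArg₂ (· * ·) (rev4_a _) (rev4_b _)).symm.trans (h3.trans
      (congrArg₂ (· * ·) (congrArg₂ (· * ·) (rev4_d _) (rev4_e _)) (rev4_c _)))
  counit_left a := by
    refine Eq.trans ?_ (counit_right (k := k) a)
    change Algebra.TensorProduct.lid k H (Algebra.TensorProduct.map ε (AlgHom.id k H)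
      (Algebra.TensorProduct.comm k H H (Δ a))) = _
    generalize (Δ a : H ⊗[k] H) = s
    induction s with
    | zero => simp
    | add x y hx hy => simp only [map_add, hx, hy]
    | tmul a b => simp
  counit_right a := by
    refine Eq.trans ?_ (counit_left (k := k) a)
    change Algebra.TensorProduct.rid k k H (Algebra.TensorProduct.map (AlgHom.id k H) ε
      (Algebra.TensorProduct.comm k H H (Δ a))) = _
    generalize (Δ a : H ⊗[k] H) = s
    induction s with
    | zero => simp
    | add x y hx hy => simp only [map_add, hx, hy]
    | tmul a b => simp
  counit_mid := by
    let m : H ⊗[k] (H ⊗[k] H) →ₐ[k] H ⊗[k] H := Algebra.TensorProduct.map (AlgHom.id k H)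
      ((Algebra.TensorProduct.lid k H).toAlgHom.comp
        (Algebra.TensorProduct.map ε (AlgHom.id k H)))
    have h0 : m ((Φ : (H ⊗[k] (H ⊗[k] H))ˣ) : H ⊗[k] (H ⊗[k] H)) = 1 := counit_mid
    have h1 : m ((Φ⁻¹ : (H ⊗[k] (H ⊗[k] H))ˣ) : H ⊗[k] (H ⊗[k] H)) = 1 := by
      have h := map_Φ_mul m
      rwa [h0, one_mul] at h
    have h2 : ∀ x, m (rev x) = Algebra.TensorProduct.comm k H H (m x) := by
      intro x
      induction x using induction3 with
      | h0 => simp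
      | hadd x y hx hy => simp only [map_add, hx, hy]
      | h a b c => simp [m]
    exact (h2 _).trans (by rw [h1, map_one])

end Elements
end QuasiHopf

namespace QuasiHopf
open QuasiBialgebra QuasiHopfAlgebra

section Antipode

variable {k H : Type*} [Field k] [Ring H] [Algebra k H]

section
variable [QuasiBialgebra k H]

/-- `h ↦ ε(h) 1 ⊗ 1` -/
noncomputable def εε : H →ₐ[k] H ⊗[k] H := (Algebra.ofId k (H ⊗[k] H)).comp ε

theorem εε_apply (h : H) : εε (k := k) h = (ε h : k) • (1 : H ⊗[k] H) := by
  rw [εε, AlgHom.comp_apply, Algebra.ofId_apply, Algebra.algebraMap_eq_smul_one]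

theorem counit_mid' : Algebra.TensorProduct.map (AlgHom.id k H)
    ((Algebra.TensorProduct.assoc k k k H H H).toAlgHom.comp
      (Algebra.TensorProduct.map εε (AlgHom.id k H)))
      ((Φ : (H ⊗[k] (H ⊗[k] H))ˣ) : H ⊗[k] (H ⊗[k] H)) = 1 := by
  have h : ∀ x : H ⊗[k] (H ⊗[k] H), Algebra.TensorProduct.map (AlgHom.id k H)
      ((Algebra.TensorProduct.assoc k k k H H H).toAlgHom.comp
        (Algebra.TensorProduct.map εε (AlgHom.id k H))) x =
      Algebra.TensorProduct.map (AlgHom.id k H)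
        (Algebra.TensorProduct.includeRight.comp Algebra.TensorProduct.includeRight)
        (Algebra.TensorProduct.map (AlgHom.id k H)
          ((Algebra.TensorProduct.lid k H).toAlgHom.comp
            (Algebra.TensorProduct.map ε (AlgHom.id k H))) x) := by
    intro x
    induction x using induction3 with
    | h0 => simp
    | hadd x y hx hy => simp only [map_add, hx, hy]
    | h a b c =>
      simp [εε_apply, Algebra.TensorProduct.one_def, ← smul_tmul']
  rw [h, counit_mid, map_one]

/-- `a ⊗ b ⊗ c ⊗ d ↦ a ⊗ b ⊗ ε(c) 1 ⊗ d` -/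
noncomputable def ε3 : H ⊗[k] (H ⊗[k] (H ⊗[k] H)) →ₐ[k] H ⊗[k] (H ⊗[k] (H ⊗[k] H)) :=
  Algebra.TensorProduct.map (AlgHom.id k H) (Algebra.TensorProduct.map (AlgHom.id k H)
    (Algebra.TensorProduct.map ((Algebra.ofId k H).comp ε) (AlgHom.id k H)))

theorem ε3_tmul (a b c d : H) : ε3 (k := k) (a ⊗ₜ (b ⊗ₜ (c ⊗ₜ d))) =
    a ⊗ₜ (b ⊗ₜ (((ε c : k) • (1 : H)) ⊗ₜ d)) := by
  simp [ε3, Algebra.ofId_apply, Algebra.algebraMap_eq_smul_one]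

/-- `a ⊗ b ⊗ c ↦ a ⊗ b ⊗ 1 ⊗ c` -/
noncomputable def ι3 : H ⊗[k] (H ⊗[k] H) →ₐ[k] H ⊗[k] (H ⊗[k] (H ⊗[k] H)) :=
  Algebra.TensorProduct.map (AlgHom.id k H) (Algebra.TensorProduct.map (AlgHom.id k H)
    Algebra.TensorProduct.includeRight)

theorem sum_counit_left (s : H ⊗[k] H) :
    Algebra.TensorProduct.map ((Algebra.ofId k H).comp ε) (AlgHom.id k H) s =
      (1 : H) ⊗ₜ[k] Algebra.TensorProduct.lid k H
        (Algebra.TensorProduct.map ε (AlgHom.id k H) s) := by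
  induction s with
  | zero => simp
  | add x y hx hy => simp only [map_add, hx, hy, tmul_add]
  | tmul a b =>
    simp [Algebra.ofId_apply, Algebra.algebraMap_eq_smul_one, smul_tmul']

theorem sum_counit_right (s : H ⊗[k] H) :
    Algebra.TensorProduct.map (AlgHom.id k H) ((Algebra.ofId k H).comp ε) s =
      (Algebra.TensorProduct.rid k k H
        (Algebra.TensorProduct.map (AlgHom.id k H) ε s)) ⊗ₜ[k] (1 : H) := by
  induction s with
  | zero => simp
  | add x y hx hy => simp only [map_add, hx, hy, add_tmul]
  | tmul a b =>
    simp [Algebra.ofId_apply, Algebra.algebraMap_eq_smul_one, smul_tmul']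

theorem ε3_a (x : H ⊗[k] (H ⊗[k] H)) : ε3 (Algebra.TensorProduct.map (AlgHom.id k H)
    (Algebra.TensorProduct.map (AlgHom.id k H) Δ) x) = ι3 x := by
  induction x using induction3 with
  | h0 => simp
  | hadd x y hx hy => simp only [map_add, hx, hy]
  | h a b c =>
    simp only [Algebra.TensorProduct.map_tmul, AlgHom.coe_id, id, ε3, ι3, sum_counit_left,
      counit_left, Algebra.TensorProduct.includeRight_apply]

theorem ε3_b (x : H ⊗[k] (H ⊗[k] H)) :
    ε3 (Algebra.TensorProduct.assoc k k k H H (H ⊗[k] H)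
      (Algebra.TensorProduct.map Δ (AlgHom.id k (H ⊗[k] H)) x)) =
    Algebra.TensorProduct.assoc k k k H H (H ⊗[k] H)
      (Algebra.TensorProduct.map Δ (Algebra.TensorProduct.includeRight.comp
        ((Algebra.TensorProduct.lid k H).toAlgHom.comp
          (Algebra.TensorProduct.map ε (AlgHom.id k H)))) x) := by
  induction x using induction3 with
  | h0 => simp
  | hadd x y hx hy => simp only [map_add, hx, hy]
  | h a b c =>
    simp only [Algebra.TensorProduct.map_tmul, AlgHom.coe_id, id]
    generalize (Δ a : H ⊗[k] H) = s
    induction s with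
    | zero => simp
    | add x y hx hy => simp only [add_tmul, map_add, hx, hy]
    | tmul a b =>
      simp [ε3_tmul, smul_tmul']

theorem ε3_c (x : H ⊗[k] (H ⊗[k] H)) : ε3 ((1 : H) ⊗ₜ[k] x) =
    (1 : H) ⊗ₜ[k] Algebra.TensorProduct.map (AlgHom.id k H)
      (Algebra.TensorProduct.includeRight.comp
        ((Algebra.TensorProduct.lid k H).toAlgHom.comp
          (Algebra.TensorProduct.map ε (AlgHom.id k H)))) x := by
  induction x using induction3 with
  | h0 => simp
  | hadd x y hx hy => simp only [map_add, tmul_add, hx, hy]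
  | h a b c => simp [ε3_tmul, smul_tmul']

theorem ε3_d (x : H ⊗[k] (H ⊗[k] H)) : ε3 (Algebra.TensorProduct.map (AlgHom.id k H)
      ((Algebra.TensorProduct.assoc k k k H H H).toAlgHom.comp
        (Algebra.TensorProduct.map Δ (AlgHom.id k H))) x) = ι3 x := by
  induction x using induction3 with
  | h0 => simp
  | hadd x y hx hy => simp only [map_add, hx, hy]
  | h a b c =>
    have h : ∀ s : H ⊗[k] H, ε3 (a ⊗ₜ[k] (Algebra.TensorProduct.assoc k k k H H H (s ⊗ₜ[k] c))) =
        a ⊗ₜ[k] (Algebra.TensorProduct.assoc k k k H H H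
          (Algebra.TensorProduct.map (AlgHom.id k H) ((Algebra.ofId k H).comp ε) s ⊗ₜ[k] c)) := by
      intro s
      induction s with
      | zero => simp
      | add x y hx hy => simp only [add_tmul, tmul_add, map_add, hx, hy]
      | tmul a b => simp [ε3]
    refine (h (Δ b)).trans ?_
    rw [sum_counit_right, counit_right]
    rfl

theorem ε3_e (x : H ⊗[k] (H ⊗[k] H)) : ε3 (Algebra.TensorProduct.map (AlgHom.id k H)
      (Algebra.TensorProduct.assoc k k k H H H).toAlgHom
      (Algebra.TensorProduct.assoc k k k H (H ⊗[k] H) H (x ⊗ₜ[k] (1 : H)))) =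
    Algebra.TensorProduct.map (AlgHom.id k H) (Algebra.TensorProduct.map (AlgHom.id k H) εε) x := by
  induction x using induction3 with
  | h0 => simp
  | hadd x y hx hy => simp only [map_add, add_tmul, hx, hy]
  | h a b c =>
    simp [ε3_tmul, εε_apply, Algebra.TensorProduct.one_def, smul_tmul']

theorem eq_one_of_cancel {M : Type*} [Monoid M] {a b c : M} (h : b * a = 1) (h' : a = a * c) :
    c = 1 := by
  have h2 := congrArg (b * ·) h'
  simp only [← mul_assoc, h, one_mul] at h2
  exact h2.symm

/-- `(id ⊗ id ⊗ ε)(Φ) = 1` -/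
theorem counit_last : Algebra.TensorProduct.map (AlgHom.id k H)
    (Algebra.TensorProduct.map (AlgHom.id k H) εε)
      ((Φ : (H ⊗[k] (H ⊗[k] H))ˣ) : H ⊗[k] (H ⊗[k] H)) = 1 := by
  have h := congrArg ε3 (QuasiBialgebra.pentagon (k := k) (H := H))
  have e1 : Algebra.TensorProduct.map (AlgHom.id k H)
      (Algebra.TensorProduct.includeRight.comp
        ((Algebra.TensorProduct.lid k H).toAlgHom.comp
          (Algebra.TensorProduct.map ε (AlgHom.id k H))))
      ((Φ : (H ⊗[k] (H ⊗[k] H))ˣ) : H ⊗[k] (H ⊗[k] H)) = (1 : H ⊗[k] (H ⊗[k] H)) := by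
    have := congrArg (Algebra.TensorProduct.map (AlgHom.id k H)
      (Algebra.TensorProduct.includeRight (R := k) (A := H) (B := H)))
      (counit_mid (k := k) (H := H))
    rw [map_one, ← AlgHom.comp_apply, ← Algebra.TensorProduct.map_comp, AlgHom.id_comp] at this
    exact this
  have e2 : Algebra.TensorProduct.map (Δ : H →ₐ[k] H ⊗[k] H)
      (Algebra.TensorProduct.includeRight.comp
        ((Algebra.TensorProduct.lid k H).toAlgHom.comp
          (Algebra.TensorProduct.map ε (AlgHom.id k H))))
      ((Φ : (H ⊗[k] (H ⊗[k] H))ˣ) : H ⊗[k] (H ⊗[k] H)) = (1 : (H ⊗[k] H) ⊗[k] (H ⊗[k] H)) := by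
    have := congrArg (Algebra.TensorProduct.map (Δ : H →ₐ[k] H ⊗[k] H)
      (Algebra.TensorProduct.includeRight (R := k) (A := H) (B := H)))
      (counit_mid (k := k) (H := H))
    rw [map_one, ← AlgHom.comp_apply, ← Algebra.TensorProduct.map_comp, AlgHom.comp_id] at this
    exact this
  rw [map_mul, map_mul, map_mul, ε3_a, ε3_b, ε3_c, ε3_d, ε3_e, e1, e2, map_one, ← Algebra.TensorProduct.one_def] at h
  have h1 : ι3 ((Φ : (H ⊗[k] (H ⊗[k] H))ˣ) : H ⊗[k] (H ⊗[k] H)) = _ :=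
    (mul_one _).symm.trans (h.trans (congrArg (· * _)
      (one_mul (M := H ⊗[k] (H ⊗[k] (H ⊗[k] H))) (ι3 _))))
  exact eq_one_of_cancel (map_Φ_inv_mul (k := k) (H := H) ι3) h1

theorem inv_of_eq_one {T : Type*} [Semiring T] [Algebra k T] {f : H ⊗[k] (H ⊗[k] H) →ₐ[k] T}
    (h : f ((Φ : (H ⊗[k] (H ⊗[k] H))ˣ) : H ⊗[k] (H ⊗[k] H)) = 1) :
    f ((Φ⁻¹ : (H ⊗[k] (H ⊗[k] H))ˣ) : H ⊗[k] (H ⊗[k] H)) = 1 := by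
  have h' := map_Φ_mul f
  rwa [h, one_mul] at h'

end

end Antipode
end QuasiHopf

namespace QuasiHopf
open QuasiBialgebra QuasiHopfAlgebra

section Antipode2

variable {k H : Type*} [Field k] [Ring H] [Algebra k H]

theorem induction4 {p : H ⊗[k] (H ⊗[k] (H ⊗[k] H)) → Prop} (x : H ⊗[k] (H ⊗[k] (H ⊗[k] H)))
    (h : ∀ a b c d : H, p (a ⊗ₜ (b ⊗ₜ (c ⊗ₜ d)))) (hadd : ∀ x y, p x → p y → p (x + y))
    (h0 : p 0) : p x := by
  induction x with
  | zero => exact h0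
  | add x y hx hy => exact hadd x y hx hy
  | tmul a y =>
    induction y using induction3 with
    | h0 => rw [tmul_zero]; exact h0
    | hadd x y hx hy => rw [tmul_add]; exact hadd _ _ hx hy
    | h b c d => exact h a b c d

variable [QuasiHopfAlgebra k H]

theorem S_symm_mul (a b : H) :
    (S : H ≃ₗ[k] H).symm (a * b) = (S : H ≃ₗ[k] H).symm b * (S : H ≃ₗ[k] H).symm a := by
  rw [LinearEquiv.symm_apply_eq, S_mul, LinearEquiv.apply_symm_apply,
    LinearEquiv.apply_symm_apply]

theorem S_one : (S : H ≃ₗ[k] H) 1 = 1 := by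
  have h := S_mul (k := k) (H := H) ((S : H ≃ₗ[k] H).symm 1) 1
  rw [mul_one, LinearEquiv.apply_symm_apply, mul_one] at h
  exact h.symm

theorem S_symm_one : (S : H ≃ₗ[k] H).symm 1 = 1 := by
  rw [LinearEquiv.symm_apply_eq, S_one]

theorem cop_S_α (h : H) : sandwich (S : H ≃ₗ[k] H).symm.toLinearMap LinearMap.id
    ((S : H ≃ₗ[k] H).symm (α k)) (Δop h) = (ε h : k) • (S : H ≃ₗ[k] H).symm (α k) := by
  have e : ∀ s : H ⊗[k] H, sandwich (S : H ≃ₗ[k] H).symm.toLinearMap LinearMap.id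
      ((S : H ≃ₗ[k] H).symm (α k)) (Algebra.TensorProduct.comm k H H s) =
      (S : H ≃ₗ[k] H).symm (sandwich (S : H ≃ₗ[k] H).toLinearMap LinearMap.id (α k) s) := by
    intro s
    induction s with
    | zero => simp
    | add x y hx hy => simp only [map_add, hx, hy]
    | tmul a b => simp [S_symm_mul, mul_assoc]
  have h1 := e (Δ h)
  rw [S_α, map_smul] at h1
  exact h1

theorem cop_β_S (h : H) : sandwich LinearMap.id (S : H ≃ₗ[k] H).symm.toLinearMap
    ((S : H ≃ₗ[k] H).symm (β k)) (Δop h) = (ε h : k) • (S : H ≃ₗ[k] H).symm (β k) := by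
  have e : ∀ s : H ⊗[k] H, sandwich LinearMap.id (S : H ≃ₗ[k] H).symm.toLinearMap
      ((S : H ≃ₗ[k] H).symm (β k)) (Algebra.TensorProduct.comm k H H s) =
      (S : H ≃ₗ[k] H).symm (sandwich LinearMap.id (S : H ≃ₗ[k] H).toLinearMap (β k) s) := by
    intro s
    induction s with
    | zero => simp
    | add x y hx hy => simp only [map_add, hx, hy]
    | tmul a b => simp [S_symm_mul, mul_assoc]
  have h1 := e (Δ h)
  rw [β_S, map_smul] at h1
  exact h1

theorem cop_Φ_β_α : sandwich LinearMap.id LinearMap.id ((S : H ≃ₗ[k] H).symm (β k))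
    ((sandwich (S : H ≃ₗ[k] H).symm.toLinearMap LinearMap.id ((S : H ≃ₗ[k] H).symm (α k))).lTensor H
      (rev ((Φ⁻¹ : (H ⊗[k] (H ⊗[k] H))ˣ) : H ⊗[k] (H ⊗[k] H)))) = 1 := by
  have e : ∀ x : H ⊗[k] (H ⊗[k] H), sandwich LinearMap.id LinearMap.id
      ((S : H ≃ₗ[k] H).symm (β k)) ((sandwich (S : H ≃ₗ[k] H).symm.toLinearMap LinearMap.id
        ((S : H ≃ₗ[k] H).symm (α k))).lTensor H (rev x)) =
      (S : H ≃ₗ[k] H).symm (sandwich (S : H ≃ₗ[k] H).toLinearMap LinearMap.id (α k)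
        ((sandwich LinearMap.id (S : H ≃ₗ[k] H).toLinearMap (β k)).lTensor H x)) := by
    intro x
    induction x using induction3 with
    | h0 => simp
    | hadd x y hx hy => simp only [map_add, hx, hy]
    | h a b c => simp [S_symm_mul, mul_assoc]
  refine (e _).trans ?_
  rw [Φ_α_β, S_symm_one]

theorem cop_Φ_α_β : sandwich (S : H ≃ₗ[k] H).symm.toLinearMap LinearMap.id ((S : H ≃ₗ[k] H).symm (α k))
    ((sandwich LinearMap.id (S : H ≃ₗ[k] H).symm.toLinearMap ((S : H ≃ₗ[k] H).symm (β k))).lTensor H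
      (rev ((Φ : (H ⊗[k] (H ⊗[k] H))ˣ) : H ⊗[k] (H ⊗[k] H)))) = 1 := by
  have e : ∀ x : H ⊗[k] (H ⊗[k] H), sandwich (S : H ≃ₗ[k] H).symm.toLinearMap LinearMap.id
      ((S : H ≃ₗ[k] H).symm (α k)) ((sandwich LinearMap.id (S : H ≃ₗ[k] H).symm.toLinearMap
        ((S : H ≃ₗ[k] H).symm (β k))).lTensor H (rev x)) =
      (S : H ≃ₗ[k] H).symm (sandwich LinearMap.id LinearMap.id (β k)
        ((sandwich (S : H ≃ₗ[k] H).toLinearMap LinearMap.id (α k)).lTensor H x)) := by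
    intro x
    induction x using induction3 with
    | h0 => simp
    | hadd x y hx hy => simp only [map_add, hx, hy]
    | h a b c => simp [S_symm_mul, mul_assoc]
  refine (e _).trans ?_
  rw [Φ_β_α, S_symm_one]

/-- The coopposite quasi-Hopf algebra, with antipode `S⁻¹`, `S⁻¹(α)` and `S⁻¹(β)`. -/
@[reducible]
noncomputable def copQuasiHopf : QuasiHopfAlgebra k H where
  __ := copQuasiBialgebra (k := k) (H := H)
  S := S.symm
  α := (S : H ≃ₗ[k] H).symm (α k)
  β := (S : H ≃ₗ[k] H).symm (β k)
  S_mul := S_symm_mul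
  S_α := cop_S_α
  β_S := cop_β_S
  Φ_β_α := cop_Φ_β_α
  Φ_α_β := cop_Φ_α_β

variable (k H) in
/-- `a ⊗ b ⊗ c ↦ a ⊗ S(b) α c` -/
noncomputable def Lq : H ⊗[k] (H ⊗[k] H) →ₗ[k] H ⊗[k] H :=
  (sandwich (S : H ≃ₗ[k] H).toLinearMap LinearMap.id (α k)).lTensor H

variable (k H) in
/-- `a ⊗ b ⊗ c ↦ a ⊗ b β S(c)` -/
noncomputable def Lp : H ⊗[k] (H ⊗[k] H) →ₗ[k] H ⊗[k] H :=
  (sandwich LinearMap.id (S : H ≃ₗ[k] H).toLinearMap (β k)).lTensor H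

theorem Lq_tmul (a b c : H) :
    Lq k H (a ⊗ₜ (b ⊗ₜ c)) = a ⊗ₜ (S (k := k) b * α k * c) := rfl

theorem Lp_tmul (a b c : H) :
    Lp k H (a ⊗ₜ (b ⊗ₜ c)) = a ⊗ₜ (b * β k * S (k := k) c) := rfl

variable (k H) in
/-- The element `X ⊗ S(Y) α Z` of `H ⊗ H`. -/
noncomputable def qElt : H ⊗[k] H := Lq k H (Φ : (H ⊗[k] (H ⊗[k] H))ˣ)

variable (k H) in
/-- The element `P ⊗ Q β S(R)` of `H ⊗ H`. -/
noncomputable def pElt : H ⊗[k] H := Lp k H (Φ⁻¹ : (H ⊗[k] (H ⊗[k] H))ˣ)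

theorem sandwich_S_α_aux (a b : H) (s : H ⊗[k] H) :
    sandwich (S : H ≃ₗ[k] H).toLinearMap LinearMap.id (α k) (s * a ⊗ₜ b) =
      S (k := k) a * sandwich (S : H ≃ₗ[k] H).toLinearMap LinearMap.id (α k) s * b := by
  induction s with
  | zero => simp
  | add x y hx hy => simp only [map_add, add_mul, mul_add, hx, hy]
  | tmul c d => simp [S_mul, mul_assoc]

theorem sandwich_β_S_aux (a b : H) (s : H ⊗[k] H) :
    sandwich LinearMap.id (S : H ≃ₗ[k] H).toLinearMap (β k) (a ⊗ₜ b * s) =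
      a * sandwich LinearMap.id (S : H ≃ₗ[k] H).toLinearMap (β k) s * S (k := k) b := by
  induction s with
  | zero => simp
  | add x y hx hy => simp only [map_add, add_mul, mul_add, hx, hy]
  | tmul c d => simp [S_mul, mul_assoc]

theorem Lq_Δ_mul (t : H ⊗[k] H) (y : H ⊗[k] (H ⊗[k] H)) :
    Lq k H (Algebra.TensorProduct.map (AlgHom.id k H) Δ t * y) =
      (Algebra.TensorProduct.rid k k H (Algebra.TensorProduct.map (AlgHom.id k H) ε t)) ⊗ₜ 1 *
        Lq k H y := by
  induction t with
  | zero => simp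
  | add x y hx hy => simp only [map_add, add_mul, add_tmul, hx, hy]
  | tmul a b =>
    induction y using induction3 with
    | h0 => simp
    | hadd x y hx hy => simp only [map_add, mul_add, hx, hy]
    | h c d e =>
      simp only [Algebra.TensorProduct.map_tmul, Algebra.TensorProduct.tmul_mul_tmul, Lq,
        LinearMap.lTensor_tmul, sandwich_S_α_aux, S_α]
      simp [smul_tmul']

theorem Lp_mul_Δ (t : H ⊗[k] H) (y : H ⊗[k] (H ⊗[k] H)) :
    Lp k H (y * Algebra.TensorProduct.map (AlgHom.id k H) Δ t) =
      Lp k H y * (Algebra.TensorProduct.rid k k H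
        (Algebra.TensorProduct.map (AlgHom.id k H) ε t)) ⊗ₜ 1 := by
  induction t with
  | zero => simp
  | add x y hx hy => simp only [map_add, mul_add, add_tmul, hx, hy]
  | tmul a b =>
    induction y using induction3 with
    | h0 => simp
    | hadd x y hx hy => simp only [map_add, add_mul, hx, hy]
    | h c d e =>
      simp only [Algebra.TensorProduct.map_tmul, Algebra.TensorProduct.tmul_mul_tmul, Lp,
        LinearMap.lTensor_tmul, sandwich_β_S_aux, β_S]
      simp [smul_tmul']

theorem q_Δ (h : H) : Lq k H ((Φ : (H ⊗[k] (H ⊗[k] H))ˣ) *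
    Algebra.TensorProduct.assoc k k k H H H
      (Algebra.TensorProduct.map Δ (AlgHom.id k H) (Δ h))) = h ⊗ₜ 1 * qElt k H := by
  have e := congrArg (fun x => x * ((Φ : (H ⊗[k] (H ⊗[k] H))ˣ) : H ⊗[k] (H ⊗[k] H)))
    (coassoc (k := k) h)
  simp only [mul_assoc, Units.inv_mul, mul_one] at e
  rw [← e, Lq_Δ_mul, counit_right]
  rfl

theorem p_Δ (h : H) : Lp k H (Algebra.TensorProduct.assoc k k k H H H
      (Algebra.TensorProduct.map Δ (AlgHom.id k H) (Δ h)) * (Φ⁻¹ : (H ⊗[k] (H ⊗[k] H))ˣ)) =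
    pElt k H * h ⊗ₜ 1 := by
  have e := congrArg (fun x => ((Φ⁻¹ : (H ⊗[k] (H ⊗[k] H))ˣ) : H ⊗[k] (H ⊗[k] H)) * x) (coassoc (k := k) h)
  simp only [← mul_assoc, Units.inv_mul, one_mul] at e
  rw [← e, Lp_mul_Δ, counit_right]
  rfl

/-- `a ⊗ b ⊗ c ⊗ d ↦ a ⊗ b β S(c) α d` -/
noncomputable def K1 : H ⊗[k] (H ⊗[k] (H ⊗[k] H)) →ₗ[k] H ⊗[k] H :=
  (sandwich LinearMap.id LinearMap.id (β k) ∘ₗ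
    (sandwich (S : H ≃ₗ[k] H).toLinearMap LinearMap.id (α k)).lTensor H).lTensor H

/-- `a ⊗ b ⊗ c ⊗ d ↦ a ⊗ S(b) α c β S(d)` -/
noncomputable def K2 : H ⊗[k] (H ⊗[k] (H ⊗[k] H)) →ₗ[k] H ⊗[k] H :=
  (sandwich (S : H ≃ₗ[k] H).toLinearMap LinearMap.id (α k) ∘ₗ
    (sandwich LinearMap.id (S : H ≃ₗ[k] H).toLinearMap (β k)).lTensor H).lTensor H

/-- `y ↦ 1 ⊗ y` -/
noncomputable def incR :=
  Algebra.TensorProduct.includeRight (R := k) (A := H) (B := H ⊗[k] (H ⊗[k] H))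

/-- `a ⊗ (b ⊗ c) ⊗ d ↦ a ⊗ b ⊗ c ⊗ d` -/
noncomputable def assocR :=
  Algebra.TensorProduct.map (AlgHom.id k H) (Algebra.TensorProduct.assoc k k k H H H).toAlgHom

theorem K1_a (x : H ⊗[k] (H ⊗[k] H)) (w : H ⊗[k] (H ⊗[k] (H ⊗[k] H))) :
    K1 (Algebra.TensorProduct.map (AlgHom.id k H)
      (Algebra.TensorProduct.map (AlgHom.id k H) Δ) x * w) =
    K1 (Algebra.TensorProduct.map (AlgHom.id k H)
      (Algebra.TensorProduct.map (AlgHom.id k H) εε) x * w) := by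
  induction x using induction3 with
  | h0 => simp
  | hadd x y hx hy => simp only [map_add, add_mul, hx, hy]
  | h a b c =>
    induction w using induction4 with
    | h0 => simp
    | hadd x y hx hy => simp only [map_add, mul_add, hx, hy]
    | h d e f g =>
      simp only [Algebra.TensorProduct.map_tmul, Algebra.TensorProduct.tmul_mul_tmul, K1,
        LinearMap.lTensor_tmul, LinearMap.comp_apply, sandwich_S_α_aux, S_α, εε_apply, map_smul,
        Algebra.TensorProduct.one_def, sandwich_tmul]
      simp [S_one]

theorem K1_b (x : H ⊗[k] (H ⊗[k] H)) (y : H ⊗[k] (H ⊗[k] H)) :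
    K1 (incR y * Algebra.TensorProduct.map (AlgHom.id k H)
        ((Algebra.TensorProduct.assoc k k k H H H).toAlgHom.comp
          (Algebra.TensorProduct.map Δ (AlgHom.id k H))) x) =
    K1 (incR y * Algebra.TensorProduct.map (AlgHom.id k H)
        ((Algebra.TensorProduct.assoc k k k H H H).toAlgHom.comp
          (Algebra.TensorProduct.map εε (AlgHom.id k H))) x) := by
  induction x using induction3 with
  | h0 => simp
  | hadd x y hx hy => simp only [map_add, mul_add, hx, hy]
  | h a b c =>
    induction y using induction3 with
    | h0 => simp
    | hadd x y hx hy => simp only [map_add, add_mul, hx, hy]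
    | h d e f =>
      have key : ∀ s : H ⊗[k] H, K1 (incR (d ⊗ₜ[k] (e ⊗ₜ[k] f)) *
          assocR (a ⊗ₜ[k] (s ⊗ₜ[k] c))) =
          a ⊗ₜ[k] (d * sandwich LinearMap.id (S : H ≃ₗ[k] H).toLinearMap (β k) s *
            S (k := k) e * α k * f * c) := by
        intro s
        induction s with
        | zero => simp
        | add x y hx hy => simp only [add_tmul, tmul_add, map_add, mul_add, add_mul, hx, hy]
        | tmul g i => simp [K1, incR, assocR, S_mul, mul_assoc]
      refine (key (Δ b)).trans (Eq.trans ?_ (key (εε b)).symm)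
      simp [β_S, εε_apply, Algebra.TensorProduct.one_def, S_one]

theorem K1_c (x y : H ⊗[k] (H ⊗[k] H)) :
    K1 (Algebra.TensorProduct.assoc k k k H H (H ⊗[k] H)
        (Algebra.TensorProduct.map Δ (AlgHom.id k (H ⊗[k] H)) x) *
      Algebra.TensorProduct.map (AlgHom.id k H)
        (Algebra.TensorProduct.assoc k k k H H H).toAlgHom
        (Algebra.TensorProduct.assoc k k k H (H ⊗[k] H) H (y ⊗ₜ[k] (1 : H)))) =
    LinearMap.mul' k (H ⊗[k] H) (TensorProduct.map (LinearMap.mulRight k (Lp k H y) ∘ₗ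
      (Δ : H →ₐ[k] H ⊗[k] H).toLinearMap) (TensorProduct.mk k H H 1) (Lq k H x)) := by
  induction x using induction3 with
  | h0 => simp
  | hadd x y hx hy => simp only [map_add, add_mul, hx, hy]
  | h a b c =>
    simp only [Lq_tmul, TensorProduct.map_tmul, LinearMap.mul'_apply, LinearMap.comp_apply,
      AlgHom.toLinearMap_apply, Algebra.TensorProduct.map_tmul, AlgHom.coe_id, id,
      LinearMap.mulRight_apply, mk_apply]
    generalize (Δ a : H ⊗[k] H) = s
    induction y using induction3 with
    | h0 => simp
    | hadd x y hx hy => simp only [map_add, add_tmul, mul_add, add_mul, hx, hy]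
    | h d e f =>
      induction s with
      | zero => simp
      | add x y hx hy => simp only [map_add, add_tmul, add_mul, hx, hy]
      | tmul g i => simp [K1, Lp_tmul, S_mul, mul_assoc]

theorem K2_a (x : H ⊗[k] (H ⊗[k] H)) (w : _) :
    K2 (w * Algebra.TensorProduct.map (AlgHom.id k H)
      (Algebra.TensorProduct.map (AlgHom.id k H) Δ) x) =
    K2 (w * Algebra.TensorProduct.map (AlgHom.id k H)
      (Algebra.TensorProduct.map (AlgHom.id k H) εε) x) := by
  induction x using induction3 with
  | h0 => simp
  | hadd x y hx hy => simp only [map_add, mul_add, hx, hy]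
  | h a b c =>
    induction w using induction4 with
    | h0 => simp
    | hadd x y hx hy => simp only [map_add, add_mul, hx, hy]
    | h d e f g =>
      simp only [Algebra.TensorProduct.map_tmul, Algebra.TensorProduct.tmul_mul_tmul, K2,
        LinearMap.lTensor_tmul, LinearMap.comp_apply, sandwich_β_S_aux, β_S, εε_apply, map_smul,
        Algebra.TensorProduct.one_def, sandwich_tmul]
      simp [S_one]

theorem K2_b (x : H ⊗[k] (H ⊗[k] H)) (y : H ⊗[k] (H ⊗[k] H)) :
    K2 (Algebra.TensorProduct.map (AlgHom.id k H)
        ((Algebra.TensorProduct.assoc k k k H H H).toAlgHom.comp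
          (Algebra.TensorProduct.map Δ (AlgHom.id k H))) x * incR y) =
    K2 (Algebra.TensorProduct.map (AlgHom.id k H)
        ((Algebra.TensorProduct.assoc k k k H H H).toAlgHom.comp
          (Algebra.TensorProduct.map εε (AlgHom.id k H))) x * incR y) := by
  induction x using induction3 with
  | h0 => simp
  | hadd x y hx hy => simp only [map_add, add_mul, hx, hy]
  | h a b c =>
    induction y using induction3 with
    | h0 => simp
    | hadd x y hx hy => simp only [map_add, mul_add, hx, hy]
    | h d e f =>
      have key : ∀ s : H ⊗[k] H, K2 (assocR (a ⊗ₜ[k] (s ⊗ₜ[k] c)) * incR (d ⊗ₜ[k] (e ⊗ₜ[k] f))) =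
          a ⊗ₜ[k] (S (k := k) d * sandwich (S : H ≃ₗ[k] H).toLinearMap LinearMap.id (α k) s *
            e * β k * S (k := k) (c * f)) := by
        intro s
        induction s with
        | zero => simp
        | add x y hx hy => simp only [add_tmul, tmul_add, map_add, mul_add, add_mul, hx, hy]
        | tmul g i => simp [K2, incR, assocR, S_mul, mul_assoc]
      refine (key (Δ b)).trans (Eq.trans ?_ (key (εε b)).symm)
      simp [S_α, εε_apply, Algebra.TensorProduct.one_def, S_one]

theorem K2_c (x y : H ⊗[k] (H ⊗[k] H)) :
    K2 (Algebra.TensorProduct.map (AlgHom.id k H)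
        (Algebra.TensorProduct.assoc k k k H H H).toAlgHom
        (Algebra.TensorProduct.assoc k k k H (H ⊗[k] H) H (x ⊗ₜ[k] (1 : H))) *
      Algebra.TensorProduct.assoc k k k H H (H ⊗[k] H)
        (Algebra.TensorProduct.map Δ (AlgHom.id k (H ⊗[k] H)) y)) =
    Lq k H (x * Algebra.TensorProduct.assoc k k k H H H
      (Algebra.TensorProduct.map Δ (AlgHom.id k H) (Lp k H y))) := by
  induction y using induction3 with
  | h0 => simp
  | hadd x y hx hy => simp only [map_add, mul_add, hx, hy]
  | h a b c =>
    simp only [Lp_tmul, Algebra.TensorProduct.map_tmul, AlgHom.coe_id, id]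
    generalize (Δ a : H ⊗[k] H) = s
    induction x using induction3 with
    | h0 => simp
    | hadd x y hx hy => simp only [map_add, add_tmul, add_mul, hx, hy]
    | h d e f =>
      induction s with
      | zero => simp
      | add x y hx hy => simp only [map_add, add_tmul, mul_add, hx, hy]
      | tmul g i => simp [K2, Lq_tmul, S_mul, mul_assoc]

theorem mul_pentagon {M : Type*} [Monoid M] {a b c d e a' e' : M}
    (h : a * b = c * d * e) (ha : a' * a = 1) (he : e * e' = 1) :
    b * e' = a' * (c * d) := by
  calc b * e' = a' * a * b * e' := by rw [ha, one_mul]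
    _ = a' * (a * b) * e' := by simp only [mul_assoc]
    _ = a' * (c * d) * (e * e') := by rw [h]; simp only [mul_assoc]
    _ = _ := by rw [he, mul_one]

theorem mul_pentagon' {M : Type*} [Monoid M] {a b c d e b' c' d' : M}
    (h : a * b = c * d * e) (hb : b * b' = 1) (hc : c' * c = 1) (hd : d' * d = 1) :
    e * b' = d' * c' * a := by
  calc e * b' = d' * d * e * b' := by rw [hd, one_mul]
    _ = d' * (c' * c) * d * e * b' := by rw [hc, mul_one]
    _ = d' * c' * (c * d * e) * b' := by simp only [mul_assoc]
    _ = d' * c' * a * (b * b') := by rw [← h]; simp only [mul_assoc]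
    _ = _ := by rw [hb, mul_one]

end Antipode2
end QuasiHopf

namespace QuasiHopf
open QuasiBialgebra QuasiHopfAlgebra

section Antipode3

variable {k H : Type*} [Field k] [Ring H] [Algebra k H] [QuasiHopfAlgebra k H]

theorem K1_incR (x : H ⊗[k] (H ⊗[k] H)) : K1 (incR x) =
    (1 : H) ⊗ₜ[k] sandwich LinearMap.id LinearMap.id (β k)
      ((sandwich (S : H ≃ₗ[k] H).toLinearMap LinearMap.id (α k)).lTensor H x) := rfl

theorem K2_incR (x : H ⊗[k] (H ⊗[k] H)) : K2 (incR x) =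
    (1 : H) ⊗ₜ[k] sandwich (S : H ≃ₗ[k] H).toLinearMap LinearMap.id (α k)
      ((sandwich LinearMap.id (S : H ≃ₗ[k] H).toLinearMap (β k)).lTensor H x) := rfl

/-- `Σ Δ(q₁) p (1 ⊗ q₂) = 1` -/
theorem q_p : LinearMap.mul' k (H ⊗[k] H) (TensorProduct.map
    (LinearMap.mulRight k (pElt k H) ∘ₗ (Δ : H →ₐ[k] H ⊗[k] H).toLinearMap)
    (TensorProduct.mk k H H 1) (qElt k H)) = 1 := by
  rw [qElt, pElt, ← K1_c]
  refine (congrArg (K1 (k := k) (H := H)) (mul_pentagon (QuasiBialgebra.pentagon (k := k) (H := H))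
    (map_Φ_inv_mul (k := k) (H := H) _) (map_Φ_mul (k := k) (H := H) (assocR.comp
      ((Algebra.TensorProduct.assoc k k k H (H ⊗[k] H) H).toAlgHom.comp
        Algebra.TensorProduct.includeLeft))))).trans ?_
  rw [K1_a, inv_of_eq_one (counit_last (k := k) (H := H))]
  refine (congrArg (K1 (k := k) (H := H)) (one_mul _)).trans ?_
  refine (K1_b _ _).trans ?_
  rw [counit_mid']
  refine (congrArg (K1 (k := k) (H := H)) (mul_one _)).trans ?_
  rw [K1_incR, Φ_β_α]
  rfl

/-- `Σ q₁ p₁¹ ⊗ S(p₁²) q₂ p₂ = 1` -/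
theorem p_q : Lq k H ((Φ : (H ⊗[k] (H ⊗[k] H))ˣ) * Algebra.TensorProduct.assoc k k k H H H
      (Algebra.TensorProduct.map Δ (AlgHom.id k H) (pElt k H))) = 1 := by
  rw [pElt, ← K2_c]
  have hp := QuasiBialgebra.pentagon (k := k) (H := H)
  have hB := map_Φ_mul (k := k) (H := H)
    ((Algebra.TensorProduct.assoc k k k H H (H ⊗[k] H)).toAlgHom.comp
      (Algebra.TensorProduct.map (Δ : H →ₐ[k] H ⊗[k] H) (AlgHom.id k (H ⊗[k] H))))
  have hC := map_Φ_inv_mul (k := k) (H := H) incR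
  have hD := map_Φ_inv_mul (k := k) (H := H) (Algebra.TensorProduct.map (AlgHom.id k H)
        ((Algebra.TensorProduct.assoc k k k H H H).toAlgHom.comp
          (Algebra.TensorProduct.map (Δ : H →ₐ[k] H ⊗[k] H) (AlgHom.id k H))))
  have hm := mul_pentagon' hp hB hC hD
  refine (congrArg (K2 (k := k) (H := H)) hm).trans ?_
  refine (K2_a _ _).trans ?_
  rw [counit_last]
  refine (congrArg (K2 (k := k) (H := H)) (mul_one _)).trans ?_
  refine (K2_b _ _).trans ?_
  rw [inv_of_eq_one (counit_mid' (k := k) (H := H))]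
  refine (congrArg (K2 (k := k) (H := H)) (one_mul _)).trans ?_
  rw [K2_incR, Φ_α_β]
  rfl

end Antipode3

end QuasiHopf

namespace QuasiHopf
open QuasiBialgebra QuasiHopfAlgebra
namespace HMod

section HomModule

variable {k H : Type u} [Field k] [Ring H] [Algebra k H]

/-- `a ⊗ b` acts on `φ : V → M` by `v ↦ a φ(b v)`. -/
noncomputable def conj (V M : HMod k H) : H ⊗[k] H →ₗ[k] Module.End k (V →ₗ[k] M) :=
  TensorProduct.lift ((LinearMap.llcomp k (V →ₗ[k] M) (V →ₗ[k] M) (V →ₗ[k] M)).compl₁₂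
    (LinearMap.llcomp k V M M ∘ₗ M.ρ.toLinearMap)
    ((LinearMap.llcomp k V V M).flip ∘ₗ V.ρ.toLinearMap))

@[simp]
theorem conj_tmul (V M : HMod k H) (a b : H) (φ : V →ₗ[k] M) :
    conj V M (a ⊗ₜ b) φ = M.ρ a ∘ₗ φ ∘ₗ V.ρ b := rfl

/-- An `H`-linear map out of `V` and an `H`-linear map out of `M` are compatible with `conj`. -/
theorem conj_post {V M M' : HMod k H} (t : M ⟶ M') (x : H ⊗[k] H) (φ : V →ₗ[k] M) :
    t.lin ∘ₗ conj V M x φ = conj V M' x (t.lin ∘ₗ φ) := by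
  induction x with
  | zero => simp
  | add x y hx hy => simp only [map_add, LinearMap.add_apply, LinearMap.comp_add, hx, hy]
  | tmul a b => rw [conj_tmul, conj_tmul, ← LinearMap.comp_assoc, t.comm]; rfl

variable [QuasiHopfAlgebra k H]

/-- The homomorphism `a ⊗ b ↦ (φ ↦ a φ(S(b) -))`. -/
noncomputable def conjS (V M : HMod k H) : H ⊗[k] H →ₐ[k] Module.End k (V →ₗ[k] M) :=
  Algebra.TensorProduct.lift
    (AlgHom.ofLinearMap (LinearMap.llcomp k V M M ∘ₗ M.ρ.toLinearMap)
      (by ext; simp) (by intro x y; ext; simp))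
    (AlgHom.ofLinearMap ((LinearMap.llcomp k V V M).flip ∘ₗ V.ρ.toLinearMap ∘ₗ
        (S : H ≃ₗ[k] H).toLinearMap)
      (by ext; simp [S_one]) (by intro x y; ext; simp [S_mul]))
    (fun _ _ => LinearMap.ext fun _ => rfl)

@[simp]
theorem conjS_tmul (V M : HMod k H) (a b : H) (φ : V →ₗ[k] M) :
    conjS V M (a ⊗ₜ b) φ = M.ρ a ∘ₗ φ ∘ₗ V.ρ (S (k := k) b) := rfl

theorem conjS_post {V M M' : HMod k H} (t : M ⟶ M') (x : H ⊗[k] H) (φ : V →ₗ[k] M) :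
    t.lin ∘ₗ conjS V M x φ = conjS V M' x (t.lin ∘ₗ φ) := by
  induction x with
  | zero => simp
  | add x y hx hy => simp only [map_add, LinearMap.add_apply, LinearMap.comp_add, hx, hy]
  | tmul a b => rw [conjS_tmul, conjS_tmul, ← LinearMap.comp_assoc, t.comm]; rfl

/-- The left internal hom `Hom^l(V, M) = Hom_k(V, M)` with `h · φ = h¹ φ(S(h²) -)`. -/
noncomputable def homL (V M : HMod k H) : HMod k H where
  carrier := V →ₗ[k] M
  ρ := (conjS V M).comp Δ

theorem homL_ρ (V M : HMod k H) (h : H) (φ : V →ₗ[k] M) :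
    (homL V M).ρ h φ = conjS V M (Δ h) φ := rfl

theorem conj_Lq (V M : HMod k H) (y : H ⊗[k] (H ⊗[k] H)) (s : H ⊗[k] H) (c : H)
    (φ : V →ₗ[k] M) (v : V) :
    conj V M (Lq k H y) (conjS V M s φ) (V.ρ c v) =
      conj V M (Lq k H (y * Algebra.TensorProduct.assoc k k k H H H (s ⊗ₜ c))) φ v := by
  induction s with
  | zero => simp
  | add s t hs ht => simp only [add_tmul, mul_add, map_add, LinearMap.add_apply, hs, ht]
  | tmul a b =>
    induction y using induction3 with
    | h0 => simp
    | hadd x y hx hy => simp only [add_mul, map_add, LinearMap.add_apply, hx, hy]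
    | h d e g => simp [Lq_tmul, S_mul]

/-- `φ ⊗ v ↦ X φ(S(Y) α Z v)`, written for `φ = g n`. -/
noncomputable def ηL {N V M : HMod k H} (g : N →ₗ[k] (V →ₗ[k] M)) : N ⊗[k] V →ₗ[k] M :=
  TensorProduct.lift (conj V M (qElt k H) ∘ₗ g)

@[simp]
theorem ηL_tmul {N V M : HMod k H} (g : N →ₗ[k] (V →ₗ[k] M)) (n : N) (v : V) :
    ηL g (n ⊗ₜ v) = conj V M (qElt k H) (g n) v := rfl

/-- `f ↦ (n ↦ (v ↦ f(P n ⊗ Q β S(R) v)))` -/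
noncomputable def ζL {N V M : HMod k H} (f : N ⊗[k] V →ₗ[k] M) : N →ₗ[k] (V →ₗ[k] M) :=
  TensorProduct.curry (f ∘ₗ box N.ρ V.ρ (pElt k H))

@[simp]
theorem ζL_apply {N V M : HMod k H} (f : N ⊗[k] V →ₗ[k] M) (n : N) (v : V) :
    ζL f n v = f (box N.ρ V.ρ (pElt k H) (n ⊗ₜ v)) := rfl

theorem ηL_box {N V M : HMod k H} (g : N →ₗ[k] (V →ₗ[k] M))
    (hg : ∀ h, g ∘ₗ N.ρ h = (homL V M).ρ h ∘ₗ g) (t : H ⊗[k] H) (n : N) (v : V) :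
    ηL g (box N.ρ V.ρ t (n ⊗ₜ v)) =
      conj V M (Lq k H ((Φ : (H ⊗[k] (H ⊗[k] H))ˣ) * Algebra.TensorProduct.assoc k k k H H H
        (Algebra.TensorProduct.map Δ (AlgHom.id k H) t))) (g n) v := by
  induction t with
  | zero => simp
  | add s t hs ht => simp only [mul_add, map_add, LinearMap.add_apply, hs, ht]
  | tmul a b =>
    have h1 : g (N.ρ a n) = conjS V M (Δ a) (g n) := LinearMap.congr_fun (hg a) n
    rw [box_tmul, TensorProduct.map_tmul, ηL_tmul, h1, qElt, conj_Lq]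
    rfl

theorem ηL_comm {N V M : HMod k H} (g : N →ₗ[k] (V →ₗ[k] M))
    (hg : ∀ h, g ∘ₗ N.ρ h = (homL V M).ρ h ∘ₗ g) (h : H) :
    ηL g ∘ₗ box N.ρ V.ρ (Δ h) = M.ρ h ∘ₗ ηL g := by
  refine TensorProduct.ext' fun n v => ?_
  rw [LinearMap.comp_apply, ηL_box g hg, q_Δ, LinearMap.comp_apply, ηL_tmul]
  generalize qElt k H = q
  induction q with
  | zero => simp
  | add s t hs ht => simp only [mul_add, map_add, LinearMap.add_apply, hs, ht]
  | tmul a b => simp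

theorem Lp_assoc (s : H ⊗[k] H) (c : H) (y : H ⊗[k] (H ⊗[k] H)) :
    Lp k H (Algebra.TensorProduct.assoc k k k H H H (s ⊗ₜ c) * y) =
      s * Lp k H y * (1 : H) ⊗ₜ S (k := k) c := by
  induction s with
  | zero => simp
  | add s t hs ht => simp only [add_tmul, add_mul, map_add, hs, ht]
  | tmul a b =>
    induction y using induction3 with
    | h0 => simp
    | hadd x y hx hy => simp only [mul_add, add_mul, map_add, hx, hy]
    | h d e g => simp [Lp_tmul, S_mul, mul_assoc]

theorem ζL_comm {N V M : HMod k H} (f : N ⊗[k] V →ₗ[k] M)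
    (hf : ∀ h, f ∘ₗ box N.ρ V.ρ (Δ h) = M.ρ h ∘ₗ f) (h : H) :
    ζL f ∘ₗ N.ρ h = (homL V M).ρ h ∘ₗ ζL f := by
  have key : ∀ (t : H ⊗[k] H) (n : N) (v : V), conjS V M t (ζL f n) v =
      f (box N.ρ V.ρ (Lp k H (Algebra.TensorProduct.assoc k k k H H H
        (Algebra.TensorProduct.map Δ (AlgHom.id k H) t) * (Φ⁻¹ : (H ⊗[k] (H ⊗[k] H))ˣ)))
        (n ⊗ₜ v)) := by
    intro t n v
    induction t with
    | zero => simp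
    | add s t hs ht => simp only [add_mul, map_add, LinearMap.add_apply, hs, ht]
    | tmul a b =>
      rw [Algebra.TensorProduct.map_tmul, Lp_assoc, map_mul, map_mul, conjS_tmul]
      have h1 := LinearMap.congr_fun (hf a) (box N.ρ V.ρ (pElt k H) (n ⊗ₜ V.ρ (S (k := k) b) v))
      refine (h1.symm.trans ?_)
      simp [pElt]
  refine LinearMap.ext fun n => LinearMap.ext fun v => ?_
  refine Eq.trans ?_ (key (Δ h) n v).symm
  rw [p_Δ, map_mul]
  simp

theorem ηL_ζL {N V M : HMod k H} (f : N ⊗[k] V →ₗ[k] M)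
    (hf : ∀ h, f ∘ₗ box N.ρ V.ρ (Δ h) = M.ρ h ∘ₗ f) : ηL (ζL f) = f := by
  have key : ∀ (q : H ⊗[k] H) (n : N) (v : V), conj V M q (ζL f n) v =
      f (box N.ρ V.ρ (LinearMap.mul' k (H ⊗[k] H) (TensorProduct.map
        (LinearMap.mulRight k (pElt k H) ∘ₗ (Δ : H →ₐ[k] H ⊗[k] H).toLinearMap)
        (TensorProduct.mk k H H 1) q)) (n ⊗ₜ v)) := by
    intro q n v
    induction q with
    | zero => simp
    | add s t hs ht => simp only [map_add, LinearMap.add_apply, hs, ht]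
    | tmul a b =>
      have h1 := LinearMap.congr_fun (hf a) (box N.ρ V.ρ (pElt k H) (n ⊗ₜ V.ρ b v))
      refine (h1.symm.trans ?_)
      simp [mul_assoc]
  refine TensorProduct.ext' fun n v => ?_
  rw [ηL_tmul, key, q_p, map_one]
  rfl

theorem ζL_ηL {N V M : HMod k H} (g : N →ₗ[k] (V →ₗ[k] M))
    (hg : ∀ h, g ∘ₗ N.ρ h = (homL V M).ρ h ∘ₗ g) : ζL (ηL g) = g := by
  refine LinearMap.ext fun n => LinearMap.ext fun v => ?_
  rw [ζL_apply, ηL_box g hg, p_q, Algebra.TensorProduct.one_def, conj_tmul, map_one, map_one]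
  rfl

end HomModule
end HMod
end QuasiHopf

namespace QuasiHopf
open QuasiBialgebra QuasiHopfAlgebra
namespace HMod

section InternalHom

variable {k H : Type u} [Field k] [Ring H] [Algebra k H]

theorem box_comm (V N : HMod k H) (t : H ⊗[k] H) :
    (TensorProduct.comm k N V).toLinearMap ∘ₗ box N.ρ V.ρ (Algebra.TensorProduct.comm k H H t) =
      box V.ρ N.ρ t ∘ₗ (TensorProduct.comm k N V).toLinearMap := by
  induction t with
  | zero => simp
  | add s t hs ht => simp only [map_add, LinearMap.comp_add, LinearMap.add_comp, hs, ht]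
  | tmul a b => ext; rfl

variable [QuasiHopfAlgebra k H]

/-- The right internal hom `Hom^r(V, M) = Hom_k(V, M)` with `h · φ = h² φ(S⁻¹(h¹) -)`: the left
internal hom of the coopposite quasi-Hopf algebra. -/
noncomputable def homR (V M : HMod k H) : HMod k H := @homL k H _ _ _ copQuasiHopf V M

/-- `φ ↦ t ∘ φ` -/
noncomputable def homLMap (V : HMod k H) {M M' : HMod k H} (t : M ⟶ M') :
    homL V M ⟶ homL V M' where
  lin := LinearMap.llcomp k V M M' t.lin
  comm h := LinearMap.ext fun φ => conjS_post t (Δ h) φ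

/-- `φ ↦ t ∘ φ` -/
noncomputable def homRMap (V : HMod k H) {M M' : HMod k H} (t : M ⟶ M') :
    homR V M ⟶ homR V M' := @homLMap k H _ _ _ copQuasiHopf V M M' t

/-- `Hom^l(V, -)` -/
noncomputable def homLFunctor (V : HMod k H) : HMod k H ⥤ HMod k H where
  obj := homL V
  map := homLMap V

/-- `Hom^r(V, -)` -/
noncomputable def homRFunctor (V : HMod k H) : HMod k H ⥤ HMod k H where
  obj := homR V
  map := homRMap V

/-- The bijection `Hom_H(N ⊗ V, M) ≃ Hom_H(N, Hom^l(V, M))`,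
`f ↦ (n ↦ (v ↦ f(P n ⊗ Q β S(R) v)))`, with inverse `g ↦ (n ⊗ v ↦ X g(n)(S(Y) α Z v))`. -/
noncomputable def homEquivL (N V M : HMod k H) : (tensor N V ⟶ M) ≃ (N ⟶ homL V M) where
  toFun f := ⟨ζL (N := N) (V := V) f.lin, ζL_comm (N := N) (V := V) f.lin f.comm⟩
  invFun g := ⟨ηL (N := N) (V := V) (M := M) g.lin, ηL_comm (N := N) (V := V) (M := M) g.lin g.comm⟩
  left_inv f := hom_ext (ηL_ζL (N := N) (V := V) f.lin f.comm)
  right_inv g := hom_ext (ζL_ηL (N := N) (V := V) (M := M) g.lin g.comm)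

theorem flip_comm {N V M : HMod k H} (f : V ⊗[k] N →ₗ[k] M)
    (hf : ∀ h, f ∘ₗ box V.ρ N.ρ (Δ h) = M.ρ h ∘ₗ f) (h : H) :
    (f ∘ₗ (TensorProduct.comm k N V).toLinearMap) ∘ₗ box N.ρ V.ρ (Δop h) =
      M.ρ h ∘ₗ (f ∘ₗ (TensorProduct.comm k N V).toLinearMap) := by
  rw [← LinearMap.comp_assoc, ← hf, LinearMap.comp_assoc, LinearMap.comp_assoc, ← box_comm]
  rfl

theorem flip_comm' {N V M : HMod k H} (g : N ⊗[k] V →ₗ[k] M)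
    (hg : ∀ h, g ∘ₗ box N.ρ V.ρ (Δop h) = M.ρ h ∘ₗ g) (h : H) :
    (g ∘ₗ (TensorProduct.comm k V N).toLinearMap) ∘ₗ box V.ρ N.ρ (Δ h) =
      M.ρ h ∘ₗ (g ∘ₗ (TensorProduct.comm k V N).toLinearMap) := by
  have e : Δ h = Algebra.TensorProduct.comm k H H (Δop (k := k) h) := by
    change _ = Algebra.TensorProduct.comm k H H (Algebra.TensorProduct.comm k H H (Δ h))
    generalize (Δ h : H ⊗[k] H) = s
    induction s with
    | zero => simp
    | add x y hx hy => simp only [map_add, ← hx, ← hy]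
    | tmul a b => rfl
  rw [← LinearMap.comp_assoc, ← hg, LinearMap.comp_assoc, LinearMap.comp_assoc, ← box_comm, ← e]

/-- `f ↦ (n ⊗ v ↦ f(v ⊗ n))`, between `H`-linear maps for `Δ` and `H`-linear maps for `Δ^op`. -/
noncomputable def flipEquiv (N V M : HMod k H) :
    (tensor V N ⟶ M) ≃ (@tensor k H _ _ _ copQuasiBialgebra N V ⟶ M) where
  toFun f := ⟨LinearMap.comp (M₂ := V ⊗[k] N) f.lin (TensorProduct.comm k N V).toLinearMap,
    flip_comm (N := N) (V := V) f.lin f.comm⟩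
  invFun g := ⟨LinearMap.comp (M₂ := N ⊗[k] V) g.lin (TensorProduct.comm k V N).toLinearMap,
    flip_comm' (N := N) (V := V) g.lin g.comm⟩
  left_inv _ := hom_ext (TensorProduct.ext' fun _ _ => rfl)
  right_inv _ := hom_ext (TensorProduct.ext' fun _ _ => rfl)

/-- The bijection `Hom_H(V ⊗ N, M) ≃ Hom_H(N, Hom^r(V, M))`,
`f ↦ (n ↦ (v ↦ f(Y S⁻¹(β) S⁻¹(X) v ⊗ Z n)))`, with inverse
`g ↦ (v ⊗ n ↦ R g(n)(S⁻¹(Q) S⁻¹(α) P v))`. -/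
noncomputable def homEquivR (N V M : HMod k H) : (tensor V N ⟶ M) ≃ (N ⟶ homR V M) :=
  (flipEquiv N V M).trans (@homEquivL k H _ _ _ copQuasiHopf N V M)

/-- `Hom^l(V, -)` is right adjoint to `- ⊗ V`. -/
noncomputable def adjL (V : HMod k H) : tensorRight V ⊣ homLFunctor V :=
  Adjunction.mkOfHomEquiv
    { homEquiv := fun N M => homEquivL N V M
      homEquiv_naturality_left_symm := fun _ _ => hom_ext (TensorProduct.ext' fun _ _ => rfl)
      homEquiv_naturality_right := fun _ _ => rfl }

/-- `Hom^r(V, -)` is right adjoint to `V ⊗ -`. -/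
noncomputable def adjR (V : HMod k H) : tensorLeft V ⊣ homRFunctor V :=
  Adjunction.mkOfHomEquiv
    { homEquiv := fun N M => homEquivR N V M
      homEquiv_naturality_left_symm := fun _ _ => hom_ext (TensorProduct.ext' fun _ _ => rfl)
      homEquiv_naturality_right := fun _ _ => rfl }

noncomputable instance : BiclosedCategory (HMod k H) where
  closed V := ⟨homRFunctor V, adjR V⟩
  homL := homLFunctor
  adjL := adjL

end InternalHom
end HMod
end QuasiHopf

namespace QuasiHopf
open QuasiBialgebra QuasiHopfAlgebra

section Twist

variable {k H : Type*} [Field k] [Ring H] [Algebra k H]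

/-- `a ⊗ b ⊗ c ⊗ d ↦ (b ⊗ c) ⊗ (a ⊗ d)` -/
noncomputable def shuffle₁ :
    H ⊗[k] (H ⊗[k] (H ⊗[k] H)) →ₗ[k] (H ⊗[k] H) ⊗[k] (H ⊗[k] H) :=
  (TensorProduct.assoc k H H (H ⊗[k] H)).symm.toLinearMap ∘ₗ
    (TensorProduct.leftComm k H H H).toLinearMap.lTensor H ∘ₗ
      (TensorProduct.leftComm k H H (H ⊗[k] H)).toLinearMap

theorem shuffle₁_tmul (a b c d : H) :
    shuffle₁ (k := k) (a ⊗ₜ (b ⊗ₜ (c ⊗ₜ d))) = (b ⊗ₜ c) ⊗ₜ (a ⊗ₜ d) := rfl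

/-- `a ⊗ b ⊗ c ⊗ d ↦ (a ⊗ d) ⊗ (b ⊗ c)` -/
noncomputable def shuffle₂ :
    H ⊗[k] (H ⊗[k] (H ⊗[k] H)) →ₗ[k] (H ⊗[k] H) ⊗[k] (H ⊗[k] H) :=
  (TensorProduct.assoc k H H (H ⊗[k] H)).symm.toLinearMap ∘ₗ
    ((TensorProduct.comm k (H ⊗[k] H) H).toLinearMap ∘ₗ
      (TensorProduct.assoc k H H H).symm.toLinearMap).lTensor H

theorem shuffle₂_tmul (a b c d : H) :
    shuffle₂ (k := k) (a ⊗ₜ (b ⊗ₜ (c ⊗ₜ d))) = (a ⊗ₜ d) ⊗ₜ (b ⊗ₜ c) := rfl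

/-- Every element of `H ⊗ H` is a finite sum `Σ a i ⊗ b i`. -/
theorem exists_sum₂ (t : H ⊗[k] H) :
    ∃ (n : ℕ) (a b : Fin n → H), t = ∑ i, a i ⊗ₜ[k] b i := by
  induction t with
  | zero => exact ⟨0, Fin.elim0, Fin.elim0, by simp⟩
  | tmul a b => exact ⟨1, fun _ => a, fun _ => b, by simp⟩
  | add x y hx hy =>
    obtain ⟨m, a, b, rfl⟩ := hx
    obtain ⟨n, c, d, rfl⟩ := hy
    exact ⟨m + n, Fin.append a c, Fin.append b d, by simp [Fin.sum_univ_add]⟩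

/-- Every element of `H ⊗ H ⊗ H` is a finite sum `Σ a i ⊗ b i ⊗ c i`. -/
theorem exists_sum₃ (t : H ⊗[k] (H ⊗[k] H)) :
    ∃ (n : ℕ) (a b c : Fin n → H), t = ∑ i, a i ⊗ₜ[k] (b i ⊗ₜ[k] c i) := by
  induction t using induction3 with
  | h0 => exact ⟨0, Fin.elim0, Fin.elim0, Fin.elim0, by simp⟩
  | h a b c => exact ⟨1, fun _ => a, fun _ => b, fun _ => c, by simp⟩
  | hadd x y hx hy =>
    obtain ⟨m, a, b, c, rfl⟩ := hx
    obtain ⟨n, d, e, f, rfl⟩ := hy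
    exact ⟨m + n, Fin.append a d, Fin.append b e, Fin.append c f, by simp [Fin.sum_univ_add]⟩

variable [QuasiHopfAlgebra k H]

/-- The linear map `S ⊗ S`. -/
noncomputable def SS : H ⊗[k] H →ₗ[k] H ⊗[k] H :=
  TensorProduct.map (S : H ≃ₗ[k] H).toLinearMap (S : H ≃ₗ[k] H).toLinearMap

variable (k H) in
/-- `γ = Σ S(a²) α a³ ⊗ S(a¹) α a⁴`, where `Σ a¹ ⊗ a² ⊗ a³ ⊗ a⁴ = (Φ ⊗ 1) (Δ ⊗ id ⊗ id)(Φ⁻¹)`. -/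
noncomputable def γElt : H ⊗[k] H :=
  TensorProduct.map (sandwich (S : H ≃ₗ[k] H).toLinearMap LinearMap.id (α k))
    (sandwich (S : H ≃ₗ[k] H).toLinearMap LinearMap.id (α k))
    (shuffle₁ (Algebra.TensorProduct.map (AlgHom.id k H)
        (Algebra.TensorProduct.assoc k k k H H H).toAlgHom
        (Algebra.TensorProduct.assoc k k k H (H ⊗[k] H) H
          (((Φ : (H ⊗[k] (H ⊗[k] H))ˣ) : H ⊗[k] (H ⊗[k] H)) ⊗ₜ[k] (1 : H))) *
      Algebra.TensorProduct.assoc k k k H H (H ⊗[k] H)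
        (Algebra.TensorProduct.map Δ (AlgHom.id k (H ⊗[k] H))
          ((Φ⁻¹ : (H ⊗[k] (H ⊗[k] H))ˣ) : H ⊗[k] (H ⊗[k] H)))))

variable (k H) in
/-- `δ = Σ b¹ β S(b⁴) ⊗ b² β S(b³)`, where `Σ b¹ ⊗ b² ⊗ b³ ⊗ b⁴ = (Δ ⊗ id ⊗ id)(Φ) (Φ⁻¹ ⊗ 1)`. -/
noncomputable def δElt : H ⊗[k] H :=
  TensorProduct.map (sandwich LinearMap.id (S : H ≃ₗ[k] H).toLinearMap (β k))
    (sandwich LinearMap.id (S : H ≃ₗ[k] H).toLinearMap (β k))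
    (shuffle₂ (Algebra.TensorProduct.assoc k k k H H (H ⊗[k] H)
        (Algebra.TensorProduct.map Δ (AlgHom.id k (H ⊗[k] H))
          ((Φ : (H ⊗[k] (H ⊗[k] H))ˣ) : H ⊗[k] (H ⊗[k] H))) *
      Algebra.TensorProduct.map (AlgHom.id k H)
        (Algebra.TensorProduct.assoc k k k H H H).toAlgHom
        (Algebra.TensorProduct.assoc k k k H (H ⊗[k] H) H
          (((Φ⁻¹ : (H ⊗[k] (H ⊗[k] H))ˣ) : H ⊗[k] (H ⊗[k] H)) ⊗ₜ[k] (1 : H)))))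

variable (k H) in
/-- Drinfeld's twist `F = Σ (S ⊗ S)(Δ^op(P)) γ Δ(Q β S(R))`, where `Φ⁻¹ = Σ P ⊗ Q ⊗ R`. -/
noncomputable def twist : H ⊗[k] H :=
  LinearMap.mul' k (H ⊗[k] H) (TensorProduct.map
    (LinearMap.mulRight k (γElt k H) ∘ₗ SS ∘ₗ (Δop : H →ₐ[k] H ⊗[k] H).toLinearMap)
    (Δ : H →ₐ[k] H ⊗[k] H).toLinearMap (pElt k H))

variable (k H) in
/-- The inverse of Drinfeld's twist, `Σ Δ(S(P) α Q) δ (S ⊗ S)(Δ^op(R))`. -/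
noncomputable def twistInv : H ⊗[k] H :=
  LinearMap.mul' k (H ⊗[k] H) (TensorProduct.map
    (LinearMap.mulRight k (δElt k H) ∘ₗ (Δ : H →ₐ[k] H ⊗[k] H).toLinearMap ∘ₗ
      sandwich (S : H ≃ₗ[k] H).toLinearMap LinearMap.id (α k))
    (SS ∘ₗ (Δop : H →ₐ[k] H ⊗[k] H).toLinearMap)
    ((TensorProduct.assoc k H H H).symm
      ((Φ⁻¹ : (H ⊗[k] (H ⊗[k] H))ˣ) : H ⊗[k] (H ⊗[k] H))))

variable (k H) in
/-- `G = (S⁻¹ ⊗ S⁻¹)(σ(F⁻¹))`, where `σ` is the flip of `H ⊗ H`. -/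
noncomputable def twistG : H ⊗[k] H :=
  TensorProduct.map (S : H ≃ₗ[k] H).symm.toLinearMap (S : H ≃ₗ[k] H).symm.toLinearMap
    (TensorProduct.comm k H H (twistInv k H))

end Twist

section AYD

variable (k H : Type u) [Field k] [Ring H] [Algebra k H] [QuasiHopfAlgebra k H]

/-- A left-right anti-Yetter-Drinfeld contramodule of type I. Sums over `Δ h` and `Φ` are written
out over arbitrary expressions of these elements as sums of elementary tensors. -/
structure AYDContramodule where
  /-- the underlying left `H`-module `M` -/
  obj : HMod k H
  /-- `μ : Hom_k(H, M) → M` -/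
  μ : (H →ₗ[k] obj) →ₗ[k] obj
  /-- `Σ h² μ(x ↦ f(x S⁻¹(h¹))) = Σ μ(x ↦ h¹ f(S(h²) x))`. -/
  ayd : ∀ (h : H) (n : ℕ) (h₁ h₂ : Fin n → H), Δ h = ∑ i, h₁ i ⊗ₜ[k] h₂ i →
    ∀ f : H →ₗ[k] obj,
      ∑ i, obj.ρ (h₂ i) (μ (f ∘ₗ LinearMap.mulRight k ((S : H ≃ₗ[k] H).symm (h₁ i)))) =
        ∑ i, μ (obj.ρ (h₁ i) ∘ₗ f ∘ₗ LinearMap.mulLeft k ((S : H ≃ₗ[k] H) (h₂ i)))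
  /-- Contraassociativity: for `f : H → Hom_k(H, M)`, with `f̃(a ⊗ b) = f(a)(b)` and two
  independent copies `Φ = Σ X ⊗ Y ⊗ Z = Σ X' ⊗ Y' ⊗ Z'`,
  `Σ μ(h ↦ Y μ(x ↦ f(S(Z) h)(x S⁻¹(X)))) =
    Σ Z' μ(h ↦ X f̃((S(Z) ⊗ S(Y)) F Δ(h) G (S⁻¹(Y') ⊗ S⁻¹(X'))))`. -/
  contraassoc : ∀ (n : ℕ) (X Y Z : Fin n → H),
    ((Φ : (H ⊗[k] (H ⊗[k] H))ˣ) : H ⊗[k] (H ⊗[k] H)) = ∑ i, X i ⊗ₜ[k] (Y i ⊗ₜ[k] Z i) →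
    ∀ f : H →ₗ[k] (H →ₗ[k] obj),
      ∑ i, μ (obj.ρ (Y i) ∘ₗ μ ∘ₗ
          LinearMap.lcomp k obj (LinearMap.mulRight k ((S : H ≃ₗ[k] H).symm (X i))) ∘ₗ
            f ∘ₗ LinearMap.mulLeft k ((S : H ≃ₗ[k] H) (Z i))) =
        ∑ j, ∑ i, obj.ρ (Z j) (μ (obj.ρ (X i) ∘ₗ TensorProduct.lift f ∘ₗ
          LinearMap.mulLeft k (((S : H ≃ₗ[k] H) (Z i) ⊗ₜ[k] (S : H ≃ₗ[k] H) (Y i)) * twist k H) ∘ₗ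
          LinearMap.mulRight k (twistG k H *
            ((S : H ≃ₗ[k] H).symm (Y j) ⊗ₜ[k] (S : H ≃ₗ[k] H).symm (X j))) ∘ₗ
          (Δ : H →ₐ[k] H ⊗[k] H).toLinearMap))
  /-- `μ(x ↦ ε(x) m) = m`. -/
  unit : ∀ m : obj, μ ((ε : H →ₐ[k] k).toLinearMap.smulRight m) = m

namespace AYDContramodule

variable {k H}

/-- A morphism of type I contramodules: an `H`-linear map `t` with `t(μ(f)) = μ'(t ∘ f)`. -/
@[ext]
structure Hom (A B : AYDContramodule k H) where
  hom : A.obj ⟶ B.obj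
  comm : ∀ f : H →ₗ[k] A.obj, hom.lin (A.μ f) = B.μ (hom.lin ∘ₗ f)

instance : Category (AYDContramodule k H) where
  Hom := Hom
  id A := ⟨𝟙 _, fun _ => rfl⟩
  comp s t := ⟨s.hom ≫ t.hom, fun f => by
    rw [HMod.comp_lin, LinearMap.comp_apply, s.comm, t.comm]; rfl⟩

variable (k H) in
/-- The forgetful functor `(M, μ) ↦ M`. -/
def forget : AYDContramodule k H ⥤ HMod k H where
  obj A := A.obj
  map t := Hom.hom t

end AYDContramodule

/-- The `k`-linear map `x ↦ x v` from `H` to an `H`-module `V`. -/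
def HMod.orbit {k H : Type u} [Field k] [Ring H] [Algebra k H] (V : HMod k H) (v : V) :
    H →ₗ[k] V := V.ρ.toLinearMap.flip v

end AYD
end QuasiHopf

namespace QuasiHopf
open QuasiBialgebra QuasiHopfAlgebra
namespace HMod

section Formulas

variable {k H : Type u} [Field k] [Ring H] [Algebra k H] [QuasiHopfAlgebra k H]

/-- The action on `Hom^l(V, M)`: `h · φ = Σ h¹ φ(S(h²) -)`. -/
theorem homL_ρ_sum (V M : HMod k H) (h : H) (n : ℕ) (a b : Fin n → H)
    (e : Δ h = ∑ i, a i ⊗ₜ[k] b i) (φ : V →ₗ[k] M) :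
    (homL V M).ρ h φ = ∑ i, M.ρ (a i) ∘ₗ φ ∘ₗ V.ρ ((S : H ≃ₗ[k] H) (b i)) := by
  refine (congrArg (fun t => conjS V M t φ) e).trans ?_
  simp

/-- The action on `Hom^r(V, M)`: `h · φ = Σ h² φ(S⁻¹(h¹) -)`. -/
theorem homR_ρ_sum (V M : HMod k H) (h : H) (n : ℕ) (a b : Fin n → H)
    (e : Δ h = ∑ i, a i ⊗ₜ[k] b i) (φ : V →ₗ[k] M) :
    (homR V M).ρ h φ = ∑ i, M.ρ (b i) ∘ₗ φ ∘ₗ V.ρ ((S : H ≃ₗ[k] H).symm (a i)) := by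
  refine (congrArg (fun t => @conjS k H _ _ _ copQuasiHopf V M
    (Algebra.TensorProduct.comm k H H t) φ) e).trans ?_
  simp only [map_sum, LinearMap.sum_apply]
  rfl

/-- The adjunction map `f ↦ (n ↦ (v ↦ Σ f(P n ⊗ Q β S(R) v)))`. -/
theorem homEquivL_sum (N V M : HMod k H) (m : ℕ) (P Q R : Fin m → H)
    (e : ((Φ⁻¹ : (H ⊗[k] (H ⊗[k] H))ˣ) : H ⊗[k] (H ⊗[k] H)) =
      ∑ i, P i ⊗ₜ[k] (Q i ⊗ₜ[k] R i)) (f : N ⊗ V ⟶ M) (n : N) (v : V) :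
    (show V →ₗ[k] M from (homEquivL N V M f).lin n) v =
      ∑ i, f.lin (N.ρ (P i) n ⊗ₜ[k] V.ρ (Q i * β k * (S : H ≃ₗ[k] H) (R i)) v) := by
  refine (congrArg (fun t => f.lin (box N.ρ V.ρ (Lp k H t) (n ⊗ₜ[k] v))) e).trans ?_
  simp only [map_sum, LinearMap.sum_apply, Lp_tmul]
  refine (map_sum f.lin _ _).trans ?_
  rfl

/-- The adjunction map `f ↦ (n ↦ (v ↦ Σ f(Y S⁻¹(β) S⁻¹(X) v ⊗ Z n)))`. -/
theorem homEquivR_sum (N V M : HMod k H) (m : ℕ) (X Y Z : Fin m → H)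
    (e : ((Φ : (H ⊗[k] (H ⊗[k] H))ˣ) : H ⊗[k] (H ⊗[k] H)) =
      ∑ i, X i ⊗ₜ[k] (Y i ⊗ₜ[k] Z i)) (f : V ⊗ N ⟶ M) (n : N) (v : V) :
    (show V →ₗ[k] M from (homEquivR N V M f).lin n) v =
      ∑ i, f.lin (V.ρ (Y i * (S : H ≃ₗ[k] H).symm (β k) * (S : H ≃ₗ[k] H).symm (X i)) v ⊗ₜ[k]
        N.ρ (Z i) n) := by
  refine (congrArg (fun t => f.lin (TensorProduct.comm k N V
    (box N.ρ V.ρ (@Lp k H _ _ _ copQuasiHopf (rev t)) (n ⊗ₜ[k] v)))) e).trans ?_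
  simp only [map_sum, LinearMap.sum_apply]
  refine (map_sum f.lin _ _).trans ?_
  rfl

end Formulas
end HMod

/-- The component `τ_V` of a half braiding on `M`, as a `k`-linear map from `Hom_k(V, M)`, the
underlying space of `V ◁ M`, to `Hom_k(V, M)`, the underlying space of `M ▷ V`. -/
noncomputable def halfBraidingMap {k H : Type u} [Field k] [Ring H] [Algebra k H]
    [QuasiHopfAlgebra k H] {M : HMod k H} (b : Contragradient.WeakHalfBraiding M) (V : HMod k H) :
    (V →ₗ[k] M) →ₗ[k] (V →ₗ[k] M) := (b.τ V).lin

end QuasiHopf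

/-! The correspondence is a Yoneda argument. Naturality of a family `τ_V : Hom(V, M) → Hom(V, M)`
along the module map `H → V`, `x ↦ x v`, gives `τ_V(φ)(v) = τ_H(x ↦ φ(x v))(1)` (`τ_eq_mu`). So `τ`
is determined by the single functional `μ = τ_H(-)(1)`, and conversely every `μ` defines a natural
family `τ_V(φ)(v) = μ(x ↦ φ(x v))`. Under this dictionary `H`-linearity of `τ` is the aYD condition
and the unit axiom is the unit condition. The two sides of the hexagon, evaluated at `n ∈ Hom(V,
Hom(W, M))`, `v` and `w`, are the two sides of contraassociativity for `f_a(b) = n(a v)(b w)`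
(`hexagon_left`, `hexagon_right`); the choice `V = W = H`, `v = w = 1` recovers an arbitrary `f`.

What has to be computed are the structure isomorphisms of the bimodule category, which are given
only as mates under the adjunctions. With `Φ = X ⊗ Y ⊗ Z` and `Φ⁻¹ = P ⊗ Q ⊗ R`, the unit of the
left adjunction inserts `p = P ⊗ Q β S(R)` and its counit evaluates through `q = X ⊗ S(Y) α Z`, so
each mate is an expression in `p`, `q`, `Φ` and `Δ` acting on a linear map. The results are: `V ◁ (W
◁ M) ≅ (V ⊗ W) ◁ M` sends `n` to `X n((S(Z) ⊗ S(Y)) F -)` (`assocL_lin`); `V ◁ (M ▷ W) ≅ (V ◁ M) ▷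
W` is `Y n(S(Z) v)(S⁻¹(X) w)` (`assocM_lin`); `M ▷ (V ⊗ W) ≅ (M ▷ V) ▷ W` is `Z φ(G (S⁻¹(Y) ⊗
S⁻¹(X)) -)` (`assocR_lin`); both unit isomorphisms are `φ ↦ ε(α) φ(1)`, with `ε(α) ≠ 0`.

The simplifications come from contracting rearranged forms of the pentagon by `a ⊗ b ↦ S(a) α b` or
`a ⊗ b ↦ a β S(b)`: a coproduct caught by a contraction turns into a counit, and one factor of the
pentagon disappears. With `m = S(P) α Q ⊗ R` and the operators `wOp`, `vOp` this gives the compact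
forms `F = wOp(vOp(m))` (`twist_eq`) and `F⁻¹ = vOp(wOp(p))` (`twistInv_eq`), which are what the
mates produce. Here `F⁻¹` is the explicit element of the definition; the relation `F F⁻¹ = 1` never
enters.

The right-hand structures are the left-hand ones of the coopposite quasi-Hopf algebra. For
`assocR_lin` one needs in addition that `F⁻¹` of the coopposite is `(S⁻¹ ⊗ S⁻¹)(F⁻¹)`
(`cop_twistInv`), which rests on `F⁻¹ (S ⊗ S)(Δ^op(h)) = Δ(S(h)) F⁻¹` and `Δ(β) F⁻¹ = δ`. The
isomorphism `assocM` mixes both sides, and the left and right units cancel there by `n_m`. -/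

namespace QuasiHopf
open QuasiBialgebra QuasiHopfAlgebra

/-! ### Contractions by `α` and `β`, and the elements `m`, `n`, `p`, `q` -/

section Contractions

/-- The linear map `a ⊗ b ↦ f a * x * g b` with values in an algebra `A`. -/
noncomputable def twoSided {k H A : Type*} [Field k] [Ring H] [Algebra k H] [Ring A] [Algebra k A]
    (f g : H →ₗ[k] A) (x : A) : H ⊗[k] H →ₗ[k] A :=
  LinearMap.mul' k A ∘ₗ TensorProduct.map (LinearMap.mulRight k x ∘ₗ f) g

@[simp]
theorem twoSided_tmul {k H A : Type*} [Field k] [Ring H] [Algebra k H] [Ring A] [Algebra k A]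
    (f g : H →ₗ[k] A) (x : A) (a b : H) : twoSided f g x (a ⊗ₜ b) = f a * x * g b := rfl

variable {k H : Type u} [Field k] [Ring H] [Algebra k H]

/-- `a ↦ a ⊗ 1` -/
noncomputable def inL : H →ₗ[k] H ⊗[k] H :=
  (Algebra.TensorProduct.includeLeft : H →ₐ[k] H ⊗[k] H).toLinearMap

/-- `a ↦ 1 ⊗ a` -/
noncomputable def inR : H →ₗ[k] H ⊗[k] H :=
  (Algebra.TensorProduct.includeRight : H →ₐ[k] H ⊗[k] H).toLinearMap

@[simp] theorem inL_apply (a : H) : inL (k := k) a = a ⊗ₜ[k] (1 : H) := rfl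
@[simp] theorem inR_apply (a : H) : inR (k := k) a = (1 : H) ⊗ₜ[k] a := rfl

/-- `s ⊗ c` as an element of `H ⊗ (H ⊗ H)` -/
noncomputable def app : H ⊗[k] H →ₗ[k] H →ₗ[k] H ⊗[k] (H ⊗[k] H) :=
  (TensorProduct.mk k (H ⊗[k] H) H).compr₂ (TensorProduct.assoc k H H H).toLinearMap

@[simp] theorem app_tmul (a b c : H) : app (k := k) (a ⊗ₜ b) c = a ⊗ₜ (b ⊗ₜ c) := rfl

theorem app_mul_app (s t : H ⊗[k] H) (c d : H) :
    app s c * app t d = app (k := k) (s * t) (c * d) := by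
  induction s with
  | zero => simp
  | add x y hx hy => simp only [add_mul, map_add, LinearMap.add_apply, hx, hy]
  | tmul a b =>
    induction t with
    | zero => simp
    | add x y hx hy => simp only [mul_add, map_add, LinearMap.add_apply, hx, hy]
    | tmul e f => simp


variable [QuasiHopfAlgebra k H]

local notation "Φₑ" => ((Φ : (H ⊗[k] (H ⊗[k] H))ˣ) : H ⊗[k] (H ⊗[k] H))
local notation "Ψₑ" => ((Φ⁻¹ : (H ⊗[k] (H ⊗[k] H))ˣ) : H ⊗[k] (H ⊗[k] H))

/-- `(Δ ⊗ id)(t)` as an element of `H ⊗ (H ⊗ H)`. -/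
noncomputable def Δid : H ⊗[k] H →ₐ[k] H ⊗[k] (H ⊗[k] H) :=
  (Algebra.TensorProduct.assoc k k k H H H).toAlgHom.comp
    (Algebra.TensorProduct.map Δ (AlgHom.id k H))

/-- `(id ⊗ Δ)(t)` -/
noncomputable def idΔ : H ⊗[k] H →ₐ[k] H ⊗[k] (H ⊗[k] H) :=
  Algebra.TensorProduct.map (AlgHom.id k H) Δ

theorem Δid_tmul (a b : H) : Δid (k := k) (a ⊗ₜ b) = app (Δ a) b := rfl
theorem idΔ_tmul (a b : H) : idΔ (k := k) (a ⊗ₜ b) = a ⊗ₜ (Δ b) := rfl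

theorem idΔ_Δ (h : H) : idΔ (k := k) (Δ h) = Φₑ * Δid (Δ h) * Ψₑ := coassoc h

theorem idΔ_Δ_mul (h : H) : idΔ (k := k) (Δ h) * Φₑ = Φₑ * Δid (Δ h) := by
  rw [idΔ_Δ, mul_assoc, Units.inv_mul, mul_one]

theorem mul_idΔ_Δ (h : H) : Ψₑ * idΔ (k := k) (Δ h) = Δid (Δ h) * Ψₑ := by
  rw [idΔ_Δ, ← mul_assoc, ← mul_assoc, Units.inv_mul, one_mul]

/-- `a ⊗ b ⊗ x ↦ S(a) α b ⊗ x` -/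
noncomputable def Lm {X : Type*} [AddCommGroup X] [Module k X] :
    H ⊗[k] (H ⊗[k] X) →ₗ[k] H ⊗[k] X :=
  (sandwich (S : H ≃ₗ[k] H).toLinearMap LinearMap.id (α k)).rTensor X ∘ₗ
    (TensorProduct.assoc k H H X).symm.toLinearMap

@[simp] theorem Lm_tmul {X : Type*} [AddCommGroup X] [Module k X] (a b : H) (x : X) :
    Lm (k := k) (a ⊗ₜ (b ⊗ₜ x)) = (S (k := k) a * α k * b) ⊗ₜ x := rfl

/-- `a ⊗ b ⊗ x ↦ a β S(b) ⊗ x` -/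
noncomputable def Ln {X : Type*} [AddCommGroup X] [Module k X] :
    H ⊗[k] (H ⊗[k] X) →ₗ[k] H ⊗[k] X :=
  (sandwich LinearMap.id (S : H ≃ₗ[k] H).toLinearMap (β k)).rTensor X ∘ₗ
    (TensorProduct.assoc k H H X).symm.toLinearMap

@[simp] theorem Ln_tmul {X : Type*} [AddCommGroup X] [Module k X] (a b : H) (x : X) :
    Ln (k := k) (a ⊗ₜ (b ⊗ₜ x)) = (a * β k * S (k := k) b) ⊗ₜ x := rfl

variable (k H) in
/-- The element `S(P) α Q ⊗ R`. -/
noncomputable def mElt : H ⊗[k] H := Lm Ψₑ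

variable (k H) in
/-- The element `X β S(Y) ⊗ Z`. -/
noncomputable def nElt : H ⊗[k] H := Ln Φₑ

/-- `a ⊗ b ↦ (S(a) ⊗ 1) m Δ(b)` -/
noncomputable def wOp : H ⊗[k] H →ₗ[k] H ⊗[k] H :=
  twoSided (inL ∘ₗ (S : H ≃ₗ[k] H).toLinearMap) (Δ : H →ₐ[k] H ⊗[k] H).toLinearMap (mElt k H)

/-- `a ⊗ b ↦ Δ(a) p (1 ⊗ S(b))` -/
noncomputable def vOp : H ⊗[k] H →ₗ[k] H ⊗[k] H :=
  twoSided (Δ : H →ₐ[k] H ⊗[k] H).toLinearMap (inR ∘ₗ (S : H ≃ₗ[k] H).toLinearMap) (pElt k H)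

/-- `a ⊗ b ↦ (1 ⊗ S(b)) q (a ⊗ 1)` -/
noncomputable def qOp : H ⊗[k] H →ₗ[k] H ⊗[k] H :=
  twoSided (inR ∘ₗ (S : H ≃ₗ[k] H).toLinearMap) inL (qElt k H) ∘ₗ
    (TensorProduct.comm k H H).toLinearMap

theorem wOp_tmul (a b : H) : wOp (k := k) (a ⊗ₜ b) = (S (k := k) a) ⊗ₜ 1 * mElt k H * Δ b := rfl
theorem vOp_tmul (a b : H) : vOp (k := k) (a ⊗ₜ b) = Δ a * pElt k H * 1 ⊗ₜ (S (k := k) b) := rfl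
theorem qOp_tmul (a b : H) :
    qOp (k := k) (a ⊗ₜ b) = 1 ⊗ₜ (S (k := k) b) * qElt k H * a ⊗ₜ 1 := rfl

/-- Equivariance of `wOp`, `vOp` and `qOp` under elementary tensors. These rules, together with the
absorption of coproducts in `vOp_mul_Δ` and `wOp_Δ_mul`, drive the later manipulations of the twist.
-/
theorem wOp_mul (t : H ⊗[k] H) (c d : H) :
    wOp (k := k) (t * c ⊗ₜ d) = (S (k := k) c) ⊗ₜ 1 * wOp t * Δ d := by
  induction t with
  | zero => simp
  | add x y hx hy => simp only [add_mul, mul_add, map_add, hx, hy]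
  | tmul a b =>
    rw [Algebra.TensorProduct.tmul_mul_tmul, wOp_tmul, wOp_tmul, S_mul, map_mul]
    simp only [← mul_assoc, Algebra.TensorProduct.tmul_mul_tmul, one_mul]

theorem mul_vOp (t : H ⊗[k] H) (c d : H) :
    vOp (k := k) (c ⊗ₜ d * t) = Δ c * vOp t * 1 ⊗ₜ (S (k := k) d) := by
  induction t with
  | zero => simp
  | add x y hx hy => simp only [add_mul, mul_add, map_add, hx, hy]
  | tmul a b =>
    rw [Algebra.TensorProduct.tmul_mul_tmul, vOp_tmul, vOp_tmul, S_mul, map_mul]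
    simp only [mul_assoc, Algebra.TensorProduct.tmul_mul_tmul, one_mul]

theorem qOp_mul (t : H ⊗[k] H) (c d : H) :
    qOp (k := k) (t * c ⊗ₜ d) = 1 ⊗ₜ (S (k := k) d) * qOp t * c ⊗ₜ 1 := by
  induction t with
  | zero => simp
  | add x y hx hy => simp only [add_mul, mul_add, map_add, hx, hy]
  | tmul a b =>
    rw [Algebra.TensorProduct.tmul_mul_tmul, qOp_tmul, qOp_tmul, S_mul]
    simp only [mul_assoc, Algebra.TensorProduct.tmul_mul_tmul, one_mul]
    simp only [← mul_assoc, Algebra.TensorProduct.tmul_mul_tmul, one_mul]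

/-- Quasi-coassociativity `(Δ ⊗ id)Δ(z) Φ⁻¹ = Φ⁻¹ (id ⊗ Δ)Δ(z)` contracted by `β` in the last two
legs, where `(id ⊗ Δ)` collapses to a counit. -/
theorem vOp_Δ (z : H) : vOp (k := k) (Δ z) = pElt k H * z ⊗ₜ 1 := by
  have key : ∀ t : H ⊗[k] H, Lp k H (Algebra.TensorProduct.assoc k k k H H H
      (Algebra.TensorProduct.map Δ (AlgHom.id k H) t) * Ψₑ) = vOp t := by
    intro t
    induction t with
    | zero => simp
    | add x y hx hy => simp only [add_mul, map_add, hx, hy]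
    | tmul a b => rw [Algebra.TensorProduct.map_tmul, HMod.Lp_assoc]; rfl
  rw [← key, p_Δ]

theorem vOp_mul_Δ (t : H ⊗[k] H) (z : H) :
    vOp (k := k) (t * Δ z) = vOp t * z ⊗ₜ 1 := by
  induction t with
  | zero => simp
  | add x y hx hy => simp only [add_mul, map_add, hx, hy]
  | tmul a b =>
    rw [mul_vOp, vOp_Δ, vOp_tmul]
    simp only [mul_assoc, Algebra.TensorProduct.tmul_mul_tmul, one_mul, mul_one]

/-- `Lm ((Δ h ⊗ c) y) = ε(h) (1 ⊗ c) Lm y` -/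
theorem Lm_Δ_mul {X : Type*} [Ring X] [Algebra k X] (h : H) (c : X)
    (y : H ⊗[k] (H ⊗[k] X)) :
    Lm (k := k) (Algebra.TensorProduct.assoc k k k H H X (Δ h ⊗ₜ c) * y) =
      (ε h : k) • ((1 : H) ⊗ₜ[k] c * Lm y) := by
  induction y with
  | zero => simp
  | add x y hx hy => simp only [mul_add, map_add, hx, hy, smul_add]
  | tmul a y =>
    induction y with
    | zero => simp
    | add x y hx hy => simp only [mul_add, map_add, tmul_add, hx, hy, smul_add]
    | tmul b x =>
      have key : ∀ s : H ⊗[k] H,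
          Lm (k := k) (Algebra.TensorProduct.assoc k k k H H X (s ⊗ₜ c) * a ⊗ₜ (b ⊗ₜ x)) =
          (S (k := k) a * sandwich (S : H ≃ₗ[k] H).toLinearMap LinearMap.id (α k) s * b) ⊗ₜ[k]
            (c * x) := by
        intro s
        induction s with
        | zero => simp
        | add s t hs ht => simp only [add_mul, mul_add, map_add, add_tmul, hs, ht]
        | tmul d e => simp [S_mul, mul_assoc]
      rw [key, S_α, Lm_tmul, Algebra.TensorProduct.tmul_mul_tmul, one_mul, mul_smul_comm,
        smul_mul_assoc, smul_tmul']

/-- `Ln (y (Δ h ⊗ c)) = ε(h) Ln y (1 ⊗ c)` -/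
theorem Ln_mul_Δ {X : Type*} [Ring X] [Algebra k X] (h : H) (c : X)
    (y : H ⊗[k] (H ⊗[k] X)) :
    Ln (k := k) (y * Algebra.TensorProduct.assoc k k k H H X (Δ h ⊗ₜ c)) =
      (ε h : k) • (Ln y * (1 : H) ⊗ₜ[k] c) := by
  induction y with
  | zero => simp
  | add x y hx hy => simp only [add_mul, map_add, hx, hy, smul_add]
  | tmul a y =>
    induction y with
    | zero => simp
    | add x y hx hy => simp only [add_mul, map_add, tmul_add, hx, hy, smul_add]
    | tmul b x =>
      have key : ∀ s : H ⊗[k] H,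
          Ln (k := k) (a ⊗ₜ (b ⊗ₜ x) * Algebra.TensorProduct.assoc k k k H H X (s ⊗ₜ c)) =
          (a * sandwich LinearMap.id (S : H ≃ₗ[k] H).toLinearMap (β k) s * S (k := k) b) ⊗ₜ[k]
            (x * c) := by
        intro s
        induction s with
        | zero => simp
        | add s t hs ht => simp only [add_mul, mul_add, map_add, add_tmul, hs, ht]
        | tmul d e => simp [S_mul, mul_assoc]
      rw [key, β_S, Ln_tmul, Algebra.TensorProduct.tmul_mul_tmul, mul_one, mul_smul_comm,
        smul_mul_assoc, smul_tmul']

/-- The same relation `Φ⁻¹ (id ⊗ Δ)Δ(z) = (Δ ⊗ id)Δ(z) Φ⁻¹`, now contracted by `α` in the first two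
legs: there `(Δ ⊗ id)` on the right-hand side collapses to a counit. -/
theorem wOp_Δ (z : H) : wOp (k := k) (Δ z) = 1 ⊗ₜ z * mElt k H := by
  have h1 : ∀ t : H ⊗[k] H, Lm (Ψₑ * idΔ (k := k) t) = wOp t := by
    have key : ∀ (t : H ⊗[k] H) (y : H ⊗[k] (H ⊗[k] H)) (a : H),
        Lm (k := k) (y * a ⊗ₜ t) = (S (k := k) a) ⊗ₜ 1 * Lm y * t := by
      intro t y a
      induction y using induction3 with
      | h0 => simp
      | hadd x y hx hy => simp only [add_mul, mul_add, map_add, hx, hy]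
      | h b c d =>
        induction t with
        | zero => simp
        | add s t hs ht => simp only [mul_add, map_add, tmul_add, hs, ht]
        | tmul e f => simp [S_mul, mul_assoc]
    intro t
    induction t with
    | zero => simp
    | add x y hx hy => simp only [mul_add, map_add, hx, hy]
    | tmul a b => rw [idΔ_tmul, key, wOp_tmul, mElt]
  have h2 : ∀ (t : H ⊗[k] H) (y : H ⊗[k] (H ⊗[k] H)), Lm (Δid (k := k) t * y) =
      1 ⊗ₜ (Algebra.TensorProduct.lid k H (Algebra.TensorProduct.map ε (AlgHom.id k H) t)) *
        Lm y := by
    intro t y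
    induction t with
    | zero => simp
    | add s t hs ht => simp only [add_mul, map_add, tmul_add, hs, ht]
    | tmul a b =>
      refine (Lm_Δ_mul a b y).trans ?_
      simp [tmul_smul]
  rw [← h1, mul_idΔ_Δ, h2, counit_left, mElt]

theorem wOp_Δ_mul (z : H) (t : H ⊗[k] H) : wOp (k := k) (Δ z * t) = 1 ⊗ₜ z * wOp t := by
  induction t with
  | zero => simp
  | add x y hx hy => simp only [mul_add, map_add, hx, hy]
  | tmul a b =>
    rw [wOp_mul, wOp_Δ, wOp_tmul]
    simp only [← mul_assoc, Algebra.TensorProduct.tmul_mul_tmul, one_mul, mul_one]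

end Contractions
end QuasiHopf

set_option maxSynthPendingDepth 3

namespace QuasiHopf
open QuasiBialgebra QuasiHopfAlgebra

/-! ### The pentagon and its contractions -/

section PentagonIdentities

variable {k H : Type u} [Field k] [Ring H] [Algebra k H]

section
variable [QuasiBialgebra k H]

local notation "Φₑ" => ((Φ : (H ⊗[k] (H ⊗[k] H))ˣ) : H ⊗[k] (H ⊗[k] H))
local notation "Ψₑ" => ((Φ⁻¹ : (H ⊗[k] (H ⊗[k] H))ˣ) : H ⊗[k] (H ⊗[k] H))

/-- `Δ ⊗ id ⊗ id` -/
noncomputable def Δ₁ : H ⊗[k] (H ⊗[k] H) →ₐ[k] H ⊗[k] (H ⊗[k] (H ⊗[k] H)) :=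
  (Algebra.TensorProduct.assoc k k k H H (H ⊗[k] H)).toAlgHom.comp
    (Algebra.TensorProduct.map Δ (AlgHom.id k (H ⊗[k] H)))

/-- `id ⊗ Δ ⊗ id` -/
noncomputable def Δ₂ : H ⊗[k] (H ⊗[k] H) →ₐ[k] H ⊗[k] (H ⊗[k] (H ⊗[k] H)) :=
  Algebra.TensorProduct.map (AlgHom.id k H)
    ((Algebra.TensorProduct.assoc k k k H H H).toAlgHom.comp
      (Algebra.TensorProduct.map Δ (AlgHom.id k H)))

/-- `id ⊗ id ⊗ Δ` -/
noncomputable def Δ₃ : H ⊗[k] (H ⊗[k] H) →ₐ[k] H ⊗[k] (H ⊗[k] (H ⊗[k] H)) :=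
  Algebra.TensorProduct.map (AlgHom.id k H) (Algebra.TensorProduct.map (AlgHom.id k H) Δ)

variable (k H) in
/-- `x ↦ 1 ⊗ x` -/
noncomputable def ιr : H ⊗[k] (H ⊗[k] H) →ₐ[k] H ⊗[k] (H ⊗[k] (H ⊗[k] H)) :=
  Algebra.TensorProduct.includeRight

variable (k H) in
/-- `x ↦ x ⊗ 1` -/
noncomputable def ιl : H ⊗[k] (H ⊗[k] H) →ₐ[k] H ⊗[k] (H ⊗[k] (H ⊗[k] H)) :=
  (Algebra.TensorProduct.map (AlgHom.id k H)
    (Algebra.TensorProduct.assoc k k k H H H).toAlgHom).comp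
    ((Algebra.TensorProduct.assoc k k k H (H ⊗[k] H) H).toAlgHom.comp
      Algebra.TensorProduct.includeLeft)

theorem Δ₁_tmul (a : H) (x : H ⊗[k] H) : Δ₁ (k := k) (a ⊗ₜ x) =
    Algebra.TensorProduct.assoc k k k H H (H ⊗[k] H) (Δ a ⊗ₜ x) := rfl
theorem Δ₂_tmul (a b c : H) : Δ₂ (k := k) (a ⊗ₜ (b ⊗ₜ c)) =
    a ⊗ₜ (Algebra.TensorProduct.assoc k k k H H H (Δ b ⊗ₜ c)) := rfl
theorem Δ₃_tmul (a b c : H) : Δ₃ (k := k) (a ⊗ₜ (b ⊗ₜ c)) = a ⊗ₜ (b ⊗ₜ (Δ c)) := rfl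
theorem ιr_apply (x : H ⊗[k] (H ⊗[k] H)) : ιr k H x = (1 : H) ⊗ₜ x := rfl
@[simp] theorem ιl_tmul (a b c : H) : ιl k H (a ⊗ₜ (b ⊗ₜ c)) = a ⊗ₜ (b ⊗ₜ (c ⊗ₜ 1)) := rfl

theorem pentagon_eq : Δ₃ Φₑ * Δ₁ Φₑ = ιr k H Φₑ * Δ₂ Φₑ * ιl k H Φₑ :=
  QuasiBialgebra.pentagon

/-- Stated in an abstract monoid, so that factors of the pentagon can be moved across without
touching tensor products. -/
theorem pentagon_aux {M : Type*} [Monoid M] {d₃ d₁ r d₂ l d₁' d₃' r' d₂' l' : M}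
    (h : d₃ * d₁ = r * d₂ * l) (h₁ : d₁ * d₁' = 1) (h₃ : d₃ * d₃' = 1) (h₃' : d₃' * d₃ = 1)
    (hr : r' * r = 1) (h₂ : d₂' * d₂ = 1) (h₂' : d₂ * d₂' = 1) (hl : l * l' = 1) :
    l * d₁' * d₃' = d₂' * r' ∧ l * d₁' = d₂' * (r' * d₃) ∧ d₃' * r = d₁ * (l' * d₂') ∧
      r' * d₃ * d₁ = d₂ * l := by
  have e₁ : r' * d₃ * d₁ = d₂ * l := by
    rw [mul_assoc, h, ← mul_assoc, ← mul_assoc, hr, one_mul]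
  have e₂ : l * d₁' = d₂' * (r' * d₃) := by
    calc l * d₁' = d₂' * d₂ * l * d₁' := by rw [h₂, one_mul]
      _ = d₂' * (d₂ * l) * d₁' := by simp only [mul_assoc]
      _ = d₂' * (r' * d₃) * (d₁ * d₁') := by rw [← e₁]; simp only [mul_assoc]
      _ = _ := by rw [h₁, mul_one]
  refine ⟨?_, e₂, ?_, e₁⟩
  · rw [e₂, ← mul_assoc, mul_assoc (d₂' * r'), h₃, mul_one]
  · calc d₃' * r = d₃' * (r * d₂ * (l * l') * d₂') := by
          rw [hl, mul_one, mul_assoc, h₂', mul_one]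
      _ = d₃' * (r * d₂ * l * (l' * d₂')) := by simp only [mul_assoc]
      _ = d₃' * d₃ * (d₁ * (l' * d₂')) := by rw [← h]; simp only [mul_assoc]
      _ = _ := by rw [h₃', one_mul]

/-- Four arrangements of the pentagon, each placing a factor `Δ_i(Φ^{±1})` at an end where a
contraction by `α` or `β` replaces its coproduct by `ε`. They feed, in this order, `Φ_mul_Δid_p`,
`Lm_ιl_Δ₁`, `idΔ_m_mul_Φ` and `n_m`; the third also serves `cop_δElt`. -/
theorem pentagon_forms :
    ιl k H Φₑ * Δ₁ Ψₑ * Δ₃ Ψₑ = Δ₂ Ψₑ * ιr k H Ψₑ ∧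
    ιl k H Φₑ * Δ₁ Ψₑ = Δ₂ Ψₑ * (ιr k H Ψₑ * Δ₃ Φₑ) ∧
    Δ₃ Ψₑ * ιr k H Φₑ = Δ₁ Φₑ * (ιl k H Ψₑ * Δ₂ Ψₑ) ∧
    ιr k H Ψₑ * Δ₃ Φₑ * Δ₁ Φₑ = Δ₂ Φₑ * ιl k H Φₑ :=
  pentagon_aux pentagon_eq (map_Φ_mul _) (map_Φ_mul _) (map_Φ_inv_mul _) (map_Φ_inv_mul _)
    (map_Φ_inv_mul _) (map_Φ_mul _) (map_Φ_mul _)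

/-- `(ε ⊗ id ⊗ id)(Φ) = 1` -/
theorem counit_first : Algebra.TensorProduct.lid k (H ⊗[k] H)
    (Algebra.TensorProduct.map ε (AlgHom.id k (H ⊗[k] H)) Φₑ) = 1 := by
  let f : H ⊗[k] (H ⊗[k] H) →ₐ[k] H ⊗[k] (H ⊗[k] (H ⊗[k] H)) :=
    Algebra.TensorProduct.map (AlgHom.id k H) (Algebra.TensorProduct.map (AlgHom.id k H) εε)
  -- `rev Φ` is the inverse of the coopposite associator, so the counit property in the last leg
  -- over there is the counit property in the first leg here.
  have h : f (rev Φₑ) = 1 := @inv_of_eq_one k H _ _ _ copQuasiBialgebra _ _ _ f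
    (@counit_last k H _ _ _ copQuasiBialgebra)
  -- `f` leaves two unit legs behind; multiplying the last three legs removes them, and the flip
  -- undoes `rev`.
  let g : H ⊗[k] (H ⊗[k] (H ⊗[k] H)) →ₗ[k] H ⊗[k] H :=
    (TensorProduct.comm k H H).toLinearMap ∘ₗ
      (LinearMap.mul' k H ∘ₗ (LinearMap.mul' k H).lTensor H).lTensor H
  have e : ∀ x : H ⊗[k] (H ⊗[k] H), g (f (rev x)) = Algebra.TensorProduct.lid k (H ⊗[k] H)
      (Algebra.TensorProduct.map ε (AlgHom.id k (H ⊗[k] H)) x) := by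
    intro x
    induction x using induction3 with
    | h0 => simp
    | hadd x y hx hy => simp only [map_add, hx, hy]
    | h a b c =>
      simp [f, g, εε_apply, Algebra.TensorProduct.one_def, smul_tmul', tmul_smul]
  rw [← e, h]
  simp [g, Algebra.TensorProduct.one_def]

end

section
variable [QuasiHopfAlgebra k H]

local notation "Φₑ" => ((Φ : (H ⊗[k] (H ⊗[k] H))ˣ) : H ⊗[k] (H ⊗[k] H))
local notation "Ψₑ" => ((Φ⁻¹ : (H ⊗[k] (H ⊗[k] H))ˣ) : H ⊗[k] (H ⊗[k] H))

/-- `Φ (Δ ⊗ id)(p) = P ⊗ Δ(Q) p (1 ⊗ S(R))` -/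
theorem Φ_mul_Δid_p : Φₑ * Δid (pElt k H) = vOp.lTensor H Ψₑ := by
  have h₁ : ∀ x y : H ⊗[k] (H ⊗[k] H),
      (Lp k H).lTensor H (ιl k H x * Δ₁ y) = x * Δid (Lp k H y) := by
    intro x y
    induction y using induction3 with
    | h0 => simp
    | hadd y z hy hz => simp only [map_add, mul_add, hy, hz]
    | h a b c =>
      rw [Δ₁_tmul, Lp_tmul, Δid_tmul]
      generalize (Δ a : H ⊗[k] H) = s
      induction s with
      | zero => simp
      | add s t hs ht =>
        simp only [add_tmul, map_add, mul_add, LinearMap.add_apply, hs, ht]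
      | tmul d e =>
        induction x using induction3 with
        | h0 => simp
        | hadd y z hy hz => simp only [map_add, add_mul, hy, hz]
        | h i j l => simp [Lp_tmul, mul_assoc]
  -- A coproduct on the far right of the last two legs sits directly around `β`, so it may be
  -- replaced by the counit; the factor `(id ⊗ id ⊗ Δ)(Φ⁻¹)` then becomes `1`.
  have h₂ : ∀ (x : H ⊗[k] (H ⊗[k] H)) (y : H ⊗[k] (H ⊗[k] (H ⊗[k] H))),
      (Lp k H).lTensor H (y * Δ₃ x) = (Lp k H).lTensor H (y * Algebra.TensorProduct.map
        (AlgHom.id k H) (Algebra.TensorProduct.map (AlgHom.id k H) εε) x) := by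
    intro x y
    induction x using induction3 with
    | h0 => simp
    | hadd y z hy hz => simp only [map_add, mul_add, hy, hz]
    | h a b c =>
      induction y using induction4 with
      | h0 => simp
      | hadd y z hy hz => simp only [map_add, add_mul, hy, hz]
      | h d e i j =>
        simp only [Δ₃_tmul, Algebra.TensorProduct.map_tmul, Algebra.TensorProduct.tmul_mul_tmul,
          Lp, LinearMap.lTensor_tmul, sandwich_β_S_aux, β_S, εε_apply, AlgHom.coe_id, id,
          Algebra.TensorProduct.one_def, map_smul, sandwich_tmul, mul_smul_comm]
        simp [S_one]
  have h₃ : ∀ x : H ⊗[k] (H ⊗[k] H),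
      (Lp k H).lTensor H (Δ₂ x * ιr k H Ψₑ) = vOp.lTensor H x := by
    intro x
    induction x using induction3 with
    | h0 => simp
    | hadd y z hy hz => simp only [map_add, add_mul, hy, hz]
    | h a b c =>
      rw [Δ₂_tmul, ιr_apply, Algebra.TensorProduct.tmul_mul_tmul, LinearMap.lTensor_tmul,
        HMod.Lp_assoc, mul_one]
      rfl
  have h := congrArg ((Lp k H).lTensor H) (pentagon_forms (k := k) (H := H)).1
  rw [h₂, inv_of_eq_one counit_last, h₃] at h
  rw [← h, pElt, ← h₁]
  exact congrArg _ (mul_one _).symm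

/-- `a ⊗ b ↦ (1 ⊗ S(a²)) q (a¹ ⊗ b)` -/
noncomputable def qΔOp : H ⊗[k] H →ₗ[k] H ⊗[k] H :=
  LinearMap.mul' k (H ⊗[k] H) ∘ₗ
    TensorProduct.map (qOp ∘ₗ (Δ : H →ₐ[k] H ⊗[k] H).toLinearMap) inR

theorem qΔOp_tmul (a b : H) : qΔOp (k := k) (a ⊗ₜ b) = qOp (Δ a) * 1 ⊗ₜ b := rfl

/-- In `(Φ ⊗ 1)(Δ ⊗ id ⊗ id)(Φ⁻¹) = (id ⊗ Δ ⊗ id)(Φ⁻¹)(1 ⊗ Φ⁻¹)(id ⊗ id ⊗ Δ)(Φ)` the contraction by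
`α` in the middle legs sees the leading coproduct as a counit. What remains is `m` between an
antipode and a coproduct, which is `wOp`. The left-hand side is the fourfold tensor that defines
`γ`. -/
theorem Lm_ιl_Δ₁ : Lm.lTensor H (ιl k H Φₑ * Δ₁ Ψₑ) = wOp.lTensor H Φₑ := by
  have h₂ : ∀ (x : H ⊗[k] (H ⊗[k] H)) (y : H ⊗[k] (H ⊗[k] (H ⊗[k] H))),
      Lm.lTensor H (Δ₂ x * y) = Lm.lTensor H (Algebra.TensorProduct.map (AlgHom.id k H)
        ((Algebra.TensorProduct.assoc k k k H H H).toAlgHom.comp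
          (Algebra.TensorProduct.map εε (AlgHom.id k H))) x * y) := by
    intro x y
    induction x using induction3 with
    | h0 => simp
    | hadd y z hy hz => simp only [map_add, add_mul, hy, hz]
    | h a b c =>
      induction y with
      | zero => simp
      | add y z hy hz => simp only [map_add, mul_add, hy, hz]
      | tmul d y =>
        rw [Δ₂_tmul, Algebra.TensorProduct.tmul_mul_tmul, LinearMap.lTensor_tmul, Lm_Δ_mul]
        have : Algebra.TensorProduct.map (AlgHom.id k H)
            ((Algebra.TensorProduct.assoc k k k H H H).toAlgHom.comp
            (Algebra.TensorProduct.map εε (AlgHom.id k H))) (a ⊗ₜ[k] (b ⊗ₜ[k] c)) =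
            a ⊗ₜ[k] ((ε b : k) • ((1 : H) ⊗ₜ[k] ((1 : H) ⊗ₜ[k] c))) := by
          simp [εε_apply, Algebra.TensorProduct.one_def, smul_tmul']
        rw [this, Algebra.TensorProduct.tmul_mul_tmul, LinearMap.lTensor_tmul, smul_mul_assoc,
          map_smul]
        congr 2
        induction y using induction3 with
        | h0 => simp
        | hadd y z hy hz => simp only [map_add, mul_add, hy, hz]
        | h i j l => simp
  have h₃ : ∀ x : H ⊗[k] (H ⊗[k] H),
      Lm.lTensor H (ιr k H Ψₑ * Δ₃ x) = wOp.lTensor H x := by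
    have key : ∀ (y : H ⊗[k] (H ⊗[k] H)) (b : H) (s : H ⊗[k] H),
        Lm (y * b ⊗ₜ s) = (S (k := k) b) ⊗ₜ[k] 1 * Lm y * s := by
      intro y b s
      induction s with
      | zero => simp
      | add s t hs ht => simp only [tmul_add, mul_add, map_add, hs, ht]
      | tmul c d =>
        induction y using induction3 with
        | h0 => simp
        | hadd y z hy hz => simp only [map_add, add_mul, mul_add, hy, hz]
        | h i j l => simp [S_mul, mul_assoc]
    intro x
    induction x using induction3 with
    | h0 => simp
    | hadd y z hy hz => simp only [map_add, mul_add, hy, hz]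
    | h a b c =>
      rw [Δ₃_tmul, ιr_apply, Algebra.TensorProduct.tmul_mul_tmul, LinearMap.lTensor_tmul, key,
        one_mul]
      rfl
  have h := congrArg (Lm.lTensor H) (pentagon_forms (k := k) (H := H)).2.1
  rwa [h₂, inv_of_eq_one counit_mid', one_mul, h₃] at h

/-- `Σ q₁ P¹ ⊗ S(P²) q₂ Q ⊗ R = X ⊗ (S(Y) ⊗ 1) m Δ(Z)` -/
theorem qΔOp_Ψ : TensorProduct.assoc k H H H (qΔOp.rTensor H
    ((TensorProduct.assoc k H H H).symm Ψₑ)) = wOp.lTensor H Φₑ := by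
  -- The same contracted tensor read the other way: contracting `Φ` first produces `q`, surrounded
  -- by the legs of the coproduct.
  have h₁ : ∀ y : H ⊗[k] (H ⊗[k] H), Lm.lTensor H (ιl k H Φₑ * Δ₁ y) =
      TensorProduct.assoc k H H H (qΔOp.rTensor H ((TensorProduct.assoc k H H H).symm y)) := by
    have key : ∀ (x : H ⊗[k] (H ⊗[k] H)) (s : H ⊗[k] H) (b c : H),
        Lm.lTensor H (ιl k H x * Algebra.TensorProduct.assoc k k k H H (H ⊗[k] H)
          (s ⊗ₜ (b ⊗ₜ c))) =
        app ((twoSided (inR ∘ₗ (S : H ≃ₗ[k] H).toLinearMap) inL (Lq k H x) ∘ₗ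
          (TensorProduct.comm k H H).toLinearMap) s * 1 ⊗ₜ b) c := by
      intro x s b c
      induction s with
      | zero => simp
      | add s t hs ht => simp only [add_tmul, map_add, mul_add, add_mul, LinearMap.add_apply, hs, ht]
      | tmul d e =>
        induction x using induction3 with
        | h0 => simp
        | hadd y z hy hz =>
          simp only [map_add, add_mul, mul_add, hy, hz, LinearMap.comp_apply, LinearEquiv.coe_coe,
            TensorProduct.comm_tmul, twoSided_tmul, LinearMap.add_apply] at *
        | h i j l => simp [Lq_tmul, S_mul, mul_assoc]
    intro y
    induction y using induction3 with
    | h0 => simp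
    | hadd y z hy hz => simp only [map_add, mul_add, hy, hz]
    | h a b c => exact key Φₑ (Δ a) b c
  rw [← h₁, Lm_ιl_Δ₁]

/-- `Σ m₁ X ⊗ Δ(m₂) (Y ⊗ Z) = Σ (S(P) ⊗ 1) m Δ(Q) ⊗ R` -/
theorem idΔ_m_mul_Φ : idΔ (mElt k H) * Φₑ = TensorProduct.assoc k H H H (wOp.rTensor H
    ((TensorProduct.assoc k H H H).symm Ψₑ)) := by
  -- The contraction by `α` turns the leading factor `(Δ ⊗ id ⊗ id)(Φ)` into `(ε ⊗ id ⊗ id)(Φ) = 1`.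
  have h₁ : ∀ (x : H ⊗[k] (H ⊗[k] H)) (y : H ⊗[k] (H ⊗[k] (H ⊗[k] H))),
      Lm (Δ₁ x * y) = (1 : H) ⊗ₜ[k] Algebra.TensorProduct.lid k (H ⊗[k] H)
        (Algebra.TensorProduct.map ε (AlgHom.id k (H ⊗[k] H)) x) * Lm y := by
    intro x y
    induction x with
    | zero => simp
    | add x z hx hz => simp only [map_add, add_mul, tmul_add, hx, hz]
    | tmul a s =>
      rw [Δ₁_tmul, Lm_Δ_mul]
      simp [tmul_smul]
  have h₂ : ∀ x y : H ⊗[k] (H ⊗[k] H), Lm (Δ₃ x * ιr k H y) = idΔ (Lm x) * y := by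
    intro x y
    induction x using induction3 with
    | h0 => simp
    | hadd x z hx hz => simp only [map_add, add_mul, hx, hz]
    | h a b c =>
      rw [Δ₃_tmul, Lm_tmul, idΔ_tmul, ιr_apply]
      induction y with
      | zero => simp
      | add x z hx hz => simp only [map_add, mul_add, tmul_add, hx, hz]
      | tmul d s => simp [mul_assoc]
  have h₃ : ∀ y : H ⊗[k] (H ⊗[k] H), Lm (ιl k H Ψₑ * Δ₂ y) =
      TensorProduct.assoc k H H H (wOp.rTensor H ((TensorProduct.assoc k H H H).symm y)) := by
    have key : ∀ (x : H ⊗[k] (H ⊗[k] H)) (s : H ⊗[k] H) (a c : H),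
        Lm (ιl k H x * a ⊗ₜ (app s c)) = app ((S (k := k) a) ⊗ₜ[k] 1 * Lm x * s) c := by
      intro x s a c
      induction s with
      | zero => simp
      | add s t hs ht => simp only [tmul_add, map_add, mul_add, LinearMap.add_apply, hs, ht]
      | tmul d e =>
        induction x using induction3 with
        | h0 => simp
        | hadd y z hy hz => simp only [map_add, add_mul, mul_add, LinearMap.add_apply, hy, hz]
        | h i j l => simp [S_mul, mul_assoc]
    intro y
    induction y using induction3 with
    | h0 => simp
    | hadd y z hy hz => simp only [map_add, mul_add, hy, hz]
    | h a b c => exact key Ψₑ (Δ b) a c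
  have h := congrArg Lm (pentagon_forms (k := k) (H := H)).2.2.1
  rw [h₁, counit_first, h₂, ← Algebra.TensorProduct.one_def, one_mul, h₃] at h
  exact h

/-- `Σ n₁ m₁ n₂¹ ⊗ m₂ n₂² = 1` -/
theorem n_m : twoSided inL (Δ : H →ₐ[k] H ⊗[k] H).toLinearMap (mElt k H) (nElt k H) = 1 := by
  -- Composed with `Ln`, this is the double contraction `a ⊗ b ⊗ c ⊗ d ↦ a β S(b) α c ⊗ d`. It
  -- removes `(Δ ⊗ id ⊗ id)(Φ)` on the right through `β` and `(id ⊗ Δ ⊗ id)(Φ)` on the left through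
  -- `α`; the surviving `Φ ⊗ 1` contracts to `X β S(Y) α Z ⊗ 1 = 1`.
  let A : H ⊗[k] (H ⊗[k] H) →ₗ[k] H ⊗[k] H :=
    (sandwich LinearMap.id LinearMap.id (α k)).rTensor H ∘ₗ
      (TensorProduct.assoc k H H H).symm.toLinearMap
  have hA : ∀ a b c : H, A (a ⊗ₜ (b ⊗ₜ c)) = (a * α k * b) ⊗ₜ c := fun _ _ _ => rfl
  have h₁ : ∀ (x : H ⊗[k] (H ⊗[k] H)) (y : H ⊗[k] (H ⊗[k] (H ⊗[k] H))),
      Ln (y * Δ₁ x) = Ln y * (1 : H) ⊗ₜ[k] Algebra.TensorProduct.lid k (H ⊗[k] H)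
        (Algebra.TensorProduct.map ε (AlgHom.id k (H ⊗[k] H)) x) := by
    intro x y
    induction x with
    | zero => simp
    | add x z hx hz => simp only [map_add, mul_add, tmul_add, hx, hz]
    | tmul a s =>
      rw [Δ₁_tmul, Ln_mul_Δ]
      simp [tmul_smul]
  have h₂ : ∀ x y : H ⊗[k] (H ⊗[k] H), A (Ln (ιr k H y * Δ₃ x)) =
      twoSided inL (Δ : H →ₐ[k] H ⊗[k] H).toLinearMap (Lm y) (Ln x) := by
    intro x y
    induction x using induction3 with
    | h0 => simp
    | hadd x z hx hz => simp only [map_add, mul_add, hx, hz]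
    | h a b c =>
      rw [Δ₃_tmul, Ln_tmul, twoSided_tmul, ιr_apply, AlgHom.toLinearMap_apply]
      generalize (Δ c : H ⊗[k] H) = s
      induction s with
      | zero => simp
      | add x z hx hz => simp only [map_add, mul_add, tmul_add, hx, hz]
      | tmul d e =>
        induction y using induction3 with
        | h0 => simp
        | hadd x z hx hz => simp only [map_add, add_mul, mul_add, tmul_add, hx, hz]
        | h f g i => simp [hA, S_mul, mul_assoc]
  have h₃ : ∀ (x : H ⊗[k] (H ⊗[k] H)) (y : H ⊗[k] (H ⊗[k] (H ⊗[k] H))),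
      A (Ln (Δ₂ x * y)) = A (Ln (Algebra.TensorProduct.map (AlgHom.id k H)
        ((Algebra.TensorProduct.assoc k k k H H H).toAlgHom.comp
          (Algebra.TensorProduct.map εε (AlgHom.id k H))) x * y)) := by
    intro x y
    induction x using induction3 with
    | h0 => simp
    | hadd y z hy hz => simp only [map_add, add_mul, hy, hz]
    | h a b c =>
      induction y using induction4 with
      | h0 => simp
      | hadd y z hy hz => simp only [map_add, mul_add, hy, hz]
      | h d e f g =>
        have key : ∀ s : H ⊗[k] H, A (Ln (a ⊗ₜ (app s c) * d ⊗ₜ (e ⊗ₜ (f ⊗ₜ g)))) =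
            (a * d * β k * S (k := k) e *
              sandwich (S : H ≃ₗ[k] H).toLinearMap LinearMap.id (α k) s * f) ⊗ₜ (c * g) := by
          intro s
          induction s with
          | zero => simp
          | add s t hs ht =>
            simp only [map_add, LinearMap.add_apply, tmul_add, add_mul, mul_add, add_tmul, hs, ht]
          | tmul i j => simp [hA, S_mul, mul_assoc]
        refine (key (Δ b)).trans (Eq.trans ?_ (key (εε b)).symm)
        simp [S_α, εε_apply, Algebra.TensorProduct.one_def, S_one]
  have h₄ : ∀ x : H ⊗[k] (H ⊗[k] H), A (Ln (ιl k H x)) =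
      sandwich LinearMap.id LinearMap.id (β k)
        ((sandwich (S : H ≃ₗ[k] H).toLinearMap LinearMap.id (α k)).lTensor H x) ⊗ₜ 1 := by
    intro x
    induction x using induction3 with
    | h0 => simp
    | hadd y z hy hz => simp only [map_add, add_tmul, hy, hz]
    | h a b c => simp [hA, mul_assoc]
  have h := congrArg (fun y => A (Ln y)) (pentagon_forms (k := k) (H := H)).2.2.2
  rw [h₁, counit_first, ← Algebra.TensorProduct.one_def, mul_one, h₂, h₃, counit_mid', one_mul, h₄,
    Φ_β_α] at h
  exact h

/-- Identifies `qΔOp` with the contraction of `Φ (Δ ⊗ id)(t)`, so that facts about `Φ` apply to it.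
It is the element by which `a φ ⊗ b v` is evaluated when `t = a ⊗ b`. -/
theorem Lq_Φ_mul_Δid (t : H ⊗[k] H) : Lq k H (Φₑ * Δid t) = qΔOp t := by
  have key : ∀ (x : H ⊗[k] (H ⊗[k] H)) (s : H ⊗[k] H) (b : H),
      Lq k H (x * app s b) = (twoSided (inR ∘ₗ (S : H ≃ₗ[k] H).toLinearMap) inL (Lq k H x) ∘ₗ
        (TensorProduct.comm k H H).toLinearMap) s * 1 ⊗ₜ b := by
    intro x s b
    induction s with
    | zero => simp
    | add s t hs ht => simp only [map_add, mul_add, add_mul, LinearMap.add_apply, hs, ht]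
    | tmul d e =>
      induction x using induction3 with
      | h0 => simp
      | hadd y z hy hz =>
        simp only [map_add, add_mul, mul_add, hy, hz, LinearMap.comp_apply, LinearEquiv.coe_coe,
          TensorProduct.comm_tmul, twoSided_tmul] at *
      | h i j l => simp [Lq_tmul, S_mul, mul_assoc]
  induction t with
  | zero => simp
  | add s t hs ht => simp only [map_add, mul_add, hs, ht]
  | tmul a b => exact key Φₑ (Δ a) b

/-- Quasi-coassociativity moves `(Δ ⊗ id)Δ(b)` to the left of `Φ` as `(id ⊗ Δ)Δ(b)`, where the
contraction by `α` reduces it to `b ⊗ 1`. This expresses that evaluation is `H`-linear. -/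
theorem qΔOp_Δ_mul (b : H) (t : H ⊗[k] H) : qΔOp (k := k) (Δ b * t) = b ⊗ₜ 1 * qΔOp t := by
  rw [← Lq_Φ_mul_Δid, ← Lq_Φ_mul_Δid, map_mul Δid, ← mul_assoc, ← idΔ_Δ_mul, mul_assoc]
  refine (Lq_Δ_mul _ _).trans ?_
  rw [counit_right]

/-- The zigzag identity `q₁ p₁¹ ⊗ S(p₁²) q₂ p₂ = 1` of the left adjunction. -/
theorem qΔOp_p : qΔOp (pElt k H) = 1 := by
  rw [← Lq_Φ_mul_Δid]
  exact p_q

theorem qΔOp_mul (t : H ⊗[k] H) (c : H) :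
    qΔOp (k := k) (t * 1 ⊗ₜ c) = qΔOp t * 1 ⊗ₜ c := by
  induction t with
  | zero => simp
  | add s t hs ht => simp only [map_add, add_mul, hs, ht]
  | tmul a b => simp [qΔOp_tmul, mul_assoc]

end

end PentagonIdentities
end QuasiHopf

namespace QuasiHopf
open QuasiBialgebra QuasiHopfAlgebra

/-! ### Compact formulas for Drinfeld's twist and its inverse -/

section TwistFormulas

variable {k H : Type u} [Field k] [Ring H] [Algebra k H] [QuasiHopfAlgebra k H]

local notation "Φₑ" => ((Φ : (H ⊗[k] (H ⊗[k] H))ˣ) : H ⊗[k] (H ⊗[k] H))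
local notation "Ψₑ" => ((Φ⁻¹ : (H ⊗[k] (H ⊗[k] H))ˣ) : H ⊗[k] (H ⊗[k] H))

/-- `h ↦ (S ⊗ S)(Δ^op(h))` -/
noncomputable def SΔop : H →ₗ[k] H ⊗[k] H := SS ∘ₗ (Δop : H →ₐ[k] H ⊗[k] H).toLinearMap

theorem SS_comm_mul (s t : H ⊗[k] H) :
    SS (TensorProduct.comm k H H (s * t)) =
      SS (k := k) (TensorProduct.comm k H H t) * SS (TensorProduct.comm k H H s) := by
  induction s with
  | zero => simp
  | add x y hx hy => simp only [add_mul, mul_add, map_add, hx, hy]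
  | tmul a b =>
    induction t with
    | zero => simp
    | add x y hx hy => simp only [add_mul, mul_add, map_add, hx, hy]
    | tmul c d => simp [SS, S_mul]

theorem SΔop_eq (h : H) : SΔop (k := k) h = SS (TensorProduct.comm k H H (Δ h)) := rfl

theorem SΔop_mul (a b : H) : SΔop (k := k) (a * b) = SΔop b * SΔop a := by
  rw [SΔop_eq, SΔop_eq, SΔop_eq, map_mul, SS_comm_mul]

/-- `a ⊗ t ↦ (1 ⊗ S(a) α) t` -/
noncomputable def γOp : H ⊗[k] (H ⊗[k] H) →ₗ[k] H ⊗[k] H :=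
  LinearMap.mul' k (H ⊗[k] H) ∘ₗ (inR ∘ₗ LinearMap.mulRight k (α k) ∘ₗ
    (S : H ≃ₗ[k] H).toLinearMap).rTensor (H ⊗[k] H)

theorem γOp_tmul (a : H) (t : H ⊗[k] H) :
    γOp (k := k) (a ⊗ₜ t) = 1 ⊗ₜ (S (k := k) a * α k) * t := rfl

/-- In `S(a²) α a³ ⊗ S(a¹) α a⁴` the inner pair `a²`, `a³` is contracted by `Lm`, to which
`Lm_ιl_Δ₁` applies; `γOp` carries out the remaining contraction of `a¹` with `a⁴`. -/
theorem γElt_eq : γElt k H = γOp (wOp.lTensor H Φₑ) := by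
  have h : ∀ y : H ⊗[k] (H ⊗[k] (H ⊗[k] H)),
      TensorProduct.map (sandwich (S : H ≃ₗ[k] H).toLinearMap LinearMap.id (α k))
        (sandwich (S : H ≃ₗ[k] H).toLinearMap LinearMap.id (α k)) (shuffle₁ y) =
      γOp (Lm.lTensor H y) := by
    intro y
    induction y using induction4 with
    | h0 => simp
    | hadd y z hy hz => simp only [map_add, hy, hz]
    | h a b c d => simp [shuffle₁_tmul, γOp_tmul]
  rw [← Lm_ιl_Δ₁, ← h]
  rfl

theorem twist_eq_twoSided : twist k H =
    twoSided SΔop (Δ : H →ₐ[k] H ⊗[k] H).toLinearMap (γElt k H) (pElt k H) := rfl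

/-- `F = Σ (S(p₁) ⊗ m₁) m' Δ(p₂ S(m₂))` -/
theorem twist_eq : twist k H = twoSided inR ((Δ : H →ₐ[k] H ⊗[k] H).toLinearMap ∘ₗ
    (S : H ≃ₗ[k] H).toLinearMap) (wOp (pElt k H)) (mElt k H) := by
  -- The outer factors `(S ⊗ S)(Δ^op(t₁))` and `Δ(t₂)` of `F` can be absorbed into the argument:
  -- they amount to replacing `Φ` by `Φ (Δ ⊗ id)(t)`, which for `t = p` is known from `Φ_mul_Δid_p`.
  have h₁ : ∀ (x : H ⊗[k] (H ⊗[k] H)) (t : H ⊗[k] H),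
      twoSided SΔop (Δ : H →ₐ[k] H ⊗[k] H).toLinearMap (γOp (wOp.lTensor H x)) t =
      γOp (wOp.lTensor H (x * Δid t)) := by
    intro x t
    induction t with
    | zero => simp
    | add s t hs ht => simp only [map_add, mul_add, hs, ht]
    | tmul c d =>
      rw [twoSided_tmul, SΔop_eq, Δid_tmul]
      generalize (Δ c : H ⊗[k] H) = s
      induction s with
      | zero => simp
      | add s t hs ht => simp only [map_add, add_mul, mul_add, LinearMap.add_apply, hs, ht]
      | tmul i j =>
        induction x with
        | zero => simp
        | add x y hx hy => simp only [map_add, mul_add, add_mul, hx, hy]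
        | tmul a t =>
          simp only [app_tmul, Algebra.TensorProduct.tmul_mul_tmul, LinearMap.lTensor_tmul, wOp_mul,
            γOp_tmul, SS, TensorProduct.comm_tmul, TensorProduct.map_tmul, LinearEquiv.coe_coe,
            AlgHom.toLinearMap_apply, S_mul]
          simp only [← mul_assoc, Algebra.TensorProduct.tmul_mul_tmul, one_mul, mul_one]
  have h₂ : ∀ x : H ⊗[k] (H ⊗[k] H), γOp (wOp.lTensor H (vOp.lTensor H x)) =
      twoSided inR ((Δ : H →ₐ[k] H ⊗[k] H).toLinearMap ∘ₗ
        (S : H ≃ₗ[k] H).toLinearMap) (wOp (pElt k H)) (Lm x) := by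
    intro x
    induction x using induction3 with
    | h0 => simp
    | hadd y z hy hz => simp only [map_add, hy, hz]
    | h a b c =>
      rw [LinearMap.lTensor_tmul, LinearMap.lTensor_tmul, vOp_tmul, wOp_mul, wOp_Δ_mul, γOp_tmul,
        S_one, ← Algebra.TensorProduct.one_def, one_mul, Lm_tmul, twoSided_tmul]
      simp [← mul_assoc]
  rw [twist_eq_twoSided, γElt_eq, h₁, Φ_mul_Δid_p, h₂]
  rfl

/-- `a ⊗ b ⊗ c ↦ Δ(a) p (x S(c) ⊗ S(b))` -/
noncomputable def dOp (x : H) : H ⊗[k] (H ⊗[k] H) →ₗ[k] H ⊗[k] H :=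
  LinearMap.mul' k (H ⊗[k] H) ∘ₗ TensorProduct.map vOp
    (inL ∘ₗ LinearMap.mulLeft k x ∘ₗ (S : H ≃ₗ[k] H).toLinearMap) ∘ₗ
      (TensorProduct.assoc k H H H).symm.toLinearMap

theorem dOp_app (x : H) (s : H ⊗[k] H) (c : H) :
    dOp (k := k) x (app s c) = vOp s * (x * S (k := k) c) ⊗ₜ 1 := by
  induction s with
  | zero => simp
  | add s t hs ht => simp only [map_add, add_mul, LinearMap.add_apply, hs, ht]
  | tmul a b => rfl

theorem dOp_tmul (x a b c : H) :
    dOp (k := k) x (a ⊗ₜ (b ⊗ₜ c)) = vOp (a ⊗ₜ b) * (x * S (k := k) c) ⊗ₜ 1 := rfl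

/-- In `b¹ β S(b⁴) ⊗ b² β S(b³)` the factor `Φ⁻¹ ⊗ 1` contracts to `p`, and the coproduct of `X` and
the legs `Y`, `Z` of `Φ` surround it. -/
theorem δElt_eq : δElt k H = dOp (β k) Φₑ := by
  have h : ∀ x y : H ⊗[k] (H ⊗[k] H),
      TensorProduct.map (sandwich LinearMap.id (S : H ≃ₗ[k] H).toLinearMap (β k))
        (sandwich LinearMap.id (S : H ≃ₗ[k] H).toLinearMap (β k)) (shuffle₂ (Δ₁ x * ιl k H y)) =
      LinearMap.mul' k (H ⊗[k] H) (TensorProduct.map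
        (twoSided (Δ : H →ₐ[k] H ⊗[k] H).toLinearMap (inR ∘ₗ (S : H ≃ₗ[k] H).toLinearMap)
          (Lp k H y))
        (inL ∘ₗ LinearMap.mulLeft k (β k) ∘ₗ (S : H ≃ₗ[k] H).toLinearMap)
        ((TensorProduct.assoc k H H H).symm x)) := by
    intro x y
    induction x using induction3 with
    | h0 => simp
    | hadd y z hy hz => simp only [map_add, add_mul, hy, hz]
    | h a b c =>
      rw [Δ₁_tmul, TensorProduct.assoc_symm_tmul, TensorProduct.map_tmul, LinearMap.mul'_apply,
        twoSided_tmul, AlgHom.toLinearMap_apply]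
      generalize (Δ a : H ⊗[k] H) = s
      induction s with
      | zero => simp
      | add s t hs ht => simp only [map_add, add_mul, add_tmul, hs, ht]
      | tmul i j =>
        induction y using induction3 with
        | h0 => simp
        | hadd y z hy hz => simp only [map_add, add_mul, mul_add, hy, hz]
        | h d e f => simp [shuffle₂_tmul, Lp_tmul, S_mul, mul_assoc]
  exact h Φₑ Ψₑ

theorem twistInv_eq_twoSided : twistInv k H =
    twoSided (Δ : H →ₐ[k] H ⊗[k] H).toLinearMap SΔop (δElt k H) (mElt k H) := by
  have h : ∀ y : H ⊗[k] (H ⊗[k] H), LinearMap.mul' k (H ⊗[k] H) (TensorProduct.map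
    (LinearMap.mulRight k (δElt k H) ∘ₗ (Δ : H →ₐ[k] H ⊗[k] H).toLinearMap ∘ₗ
      sandwich (S : H ≃ₗ[k] H).toLinearMap LinearMap.id (α k))
    (SS ∘ₗ (Δop : H →ₐ[k] H ⊗[k] H).toLinearMap) ((TensorProduct.assoc k H H H).symm y)) =
    twoSided (Δ : H →ₐ[k] H ⊗[k] H).toLinearMap SΔop (δElt k H) (Lm y) := by
    intro y
    induction y using induction3 with
    | h0 => simp
    | hadd y z hy hz => simp only [map_add, hy, hz]
    | h a b c => rfl
  exact h Ψₑ

/-- `dOp` sends left multiplication by `c ⊗ d¹ ⊗ d²` to multiplication by `Δ(c)` on the left and by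
`S(d²) ⊗ S(d¹)` on the right. Statements about `δ` thus become statements about `(id ⊗ Δ)(t) Φ`. -/
theorem twoSided_dOp (x : H) (y : H ⊗[k] (H ⊗[k] H)) (t : H ⊗[k] H) :
    twoSided (Δ : H →ₐ[k] H ⊗[k] H).toLinearMap SΔop (dOp x y) t = dOp x (idΔ t * y) := by
  induction t with
  | zero => simp
  | add s t hs ht => simp only [map_add, add_mul, hs, ht]
  | tmul c d =>
    rw [twoSided_tmul, SΔop_eq, idΔ_tmul]
    generalize (Δ d : H ⊗[k] H) = s
    induction s with
    | zero => simp
    | add s t hs ht => simp only [map_add, tmul_add, add_mul, mul_add, hs, ht]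
    | tmul i j =>
      induction y using induction3 with
      | h0 => simp
      | hadd y z hy hz => simp only [map_add, add_mul, mul_add, hy, hz]
      | h a b e =>
        have e₁ : c ⊗ₜ[k] (i ⊗ₜ[k] j) * a ⊗ₜ[k] (b ⊗ₜ[k] e) = app (c ⊗ₜ i * a ⊗ₜ b) (j * e) := by
          simp
        simp only [e₁, dOp_app, dOp_tmul, mul_vOp, SS, TensorProduct.comm_tmul,
          TensorProduct.map_tmul, LinearEquiv.coe_coe, AlgHom.toLinearMap_apply, S_mul]
        simp only [mul_assoc, Algebra.TensorProduct.tmul_mul_tmul, one_mul, mul_one]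

/-- `a ⊗ b ↦ Δ(S(a)) Δ(m₁) p (1 ⊗ S(m₂)) (b ⊗ 1)` -/
noncomputable def uOp : H ⊗[k] H →ₗ[k] H ⊗[k] H :=
  twoSided ((Δ : H →ₐ[k] H ⊗[k] H).toLinearMap ∘ₗ (S : H ≃ₗ[k] H).toLinearMap) inL
    (vOp (mElt k H))

theorem uOp_tmul (a b : H) :
    uOp (k := k) (a ⊗ₜ b) = Δ (S (k := k) a) * vOp (mElt k H) * b ⊗ₜ 1 := rfl

/-- The coproduct `Δ(b)` at the right end of `wOp(a ⊗ b)` is absorbed by `vOp` as `b ⊗ 1`. -/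
theorem vOp_wOp (a b : H) : vOp (wOp (k := k) (a ⊗ₜ b)) = uOp (a ⊗ₜ b) := by
  rw [wOp_tmul, vOp_mul_Δ, mul_vOp, S_one, ← Algebra.TensorProduct.one_def, mul_one, uOp_tmul]

/-- By the preceding reductions `F⁻¹` is `dOp β` applied to `(id ⊗ Δ)(m) Φ`, and `idΔ_m_mul_Φ`
rewrites this tensor in terms of `Φ⁻¹`; contracting its last two legs by `β` makes `p`. Since `uOp`
is `vOp ∘ wOp`, the result reads `F⁻¹ = vOp(wOp(p))`. -/
theorem twistInv_eq : twistInv k H = uOp (pElt k H) := by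
  have h : ∀ y : H ⊗[k] (H ⊗[k] H), dOp (β k) (TensorProduct.assoc k H H H (wOp.rTensor H
      ((TensorProduct.assoc k H H H).symm y))) = uOp (Lp k H y) := by
    intro y
    induction y using induction3 with
    | h0 => simp
    | hadd y z hy hz => simp only [map_add, hy, hz]
    | h a b c =>
      refine (dOp_app (β k) (wOp (a ⊗ₜ b)) c).trans ?_
      rw [vOp_wOp, uOp_tmul, Lp_tmul, uOp_tmul, mul_assoc, Algebra.TensorProduct.tmul_mul_tmul,
        one_mul, mul_assoc b]
  rw [twistInv_eq_twoSided, δElt_eq, twoSided_dOp, idΔ_m_mul_Φ, h]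
  rfl

/-- `Δ(h¹) δ (S ⊗ S)(Δ^op(h²)) = ε(h) δ` -/
theorem twoSided_δ_Δ (h : H) : twoSided (Δ : H →ₐ[k] H ⊗[k] H).toLinearMap SΔop (δElt k H) (Δ h) =
    (ε h : k) • δElt k H := by
  -- Right multiplication by `Δ(t₁) ⊗ t₂` only changes the inner element: `vOp` absorbs the
  -- coproduct as `t₁ ⊗ 1`, so `β` becomes `t₁ β S(t₂)`. For `t = Δ(h)` this is `ε(h) β`.
  have key : ∀ (t : H ⊗[k] H) (y : H ⊗[k] (H ⊗[k] H)), dOp (β k) (y * Δid t) =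
      dOp (sandwich LinearMap.id (S : H ≃ₗ[k] H).toLinearMap (β k) t) y := by
    intro t y
    induction y using induction3 with
    | h0 => simp
    | hadd y z hy hz => simp only [map_add, add_mul, hy, hz]
    | h a b e =>
      induction t with
      | zero => simp [dOp_tmul]
      | add s t hs ht =>
        simp only [map_add, mul_add, hs, ht, dOp_tmul, add_mul, add_tmul]
      | tmul c d =>
        have : a ⊗ₜ[k] (b ⊗ₜ[k] e) * Δid (c ⊗ₜ d) = app (a ⊗ₜ b * Δ c) (e * d) :=
          app_mul_app (a ⊗ₜ b) (Δ c) e d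
        rw [this, dOp_app, dOp_tmul, vOp_mul_Δ, mul_assoc, Algebra.TensorProduct.tmul_mul_tmul,
          S_mul, sandwich_tmul]
        simp [mul_assoc]
  rw [δElt_eq, twoSided_dOp, idΔ_Δ_mul, key, β_S]
  generalize Φₑ = y
  induction y using induction3 with
  | h0 => simp
  | hadd y z hy hz => simp only [map_add, smul_add, hy, hz]
  | h a b e => rw [dOp_tmul, dOp_tmul, smul_mul_assoc, ← smul_tmul', mul_smul_comm]

theorem mul_twoSided_δ (c d : H) (t : H ⊗[k] H) :
    twoSided (Δ : H →ₐ[k] H ⊗[k] H).toLinearMap SΔop (δElt k H) (c ⊗ₜ d * t) =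
    Δ c * twoSided (Δ : H →ₐ[k] H ⊗[k] H).toLinearMap SΔop (δElt k H) t * SΔop d := by
  induction t with
  | zero => simp
  | add x y hx hy => simp only [add_mul, mul_add, map_add, hx, hy]
  | tmul a b => simp [SΔop_mul, mul_assoc]

theorem twoSided_δ_mul_Δ (t : H ⊗[k] H) (c : H) :
    twoSided (Δ : H →ₐ[k] H ⊗[k] H).toLinearMap SΔop (δElt k H) (t * Δ c) = (ε c : k) •
    twoSided (Δ : H →ₐ[k] H ⊗[k] H).toLinearMap SΔop (δElt k H) t := by
  induction t with
  | zero => simp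
  | add x y hx hy => simp only [add_mul, smul_add, map_add, hx, hy]
  | tmul a b =>
    rw [mul_twoSided_δ, twoSided_δ_Δ, twoSided_tmul, mul_smul_comm, smul_mul_assoc]
    rfl

theorem SΔop_one : SΔop (k := k) (1 : H) = 1 := by
  rw [SΔop_eq, map_one, Algebra.TensorProduct.one_def, TensorProduct.comm_tmul, SS,
    TensorProduct.map_tmul, LinearEquiv.coe_coe, S_one]

/-- `F⁻¹ (S ⊗ S)(Δ^op(h)) = Δ(S(h)) F⁻¹` -/
theorem twistInv_mul_SΔop (h : H) :
    twistInv k H * SΔop h = Δ (S (k := k) h) * twistInv k H := by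
  -- The map `c ⊗ d ↦ Δ(c) δ (S ⊗ S)(Δ^op(d))` takes `m` to `F⁻¹`. It is applied to both sides of
  -- `(S(h¹) ⊗ 1) m Δ(h²) = (1 ⊗ h) m`: on the left `Δ(h²)` is absorbed by `δ` as a counit, giving
  -- `Δ(S(h)) F⁻¹`, and on the right `h` comes out as `(S ⊗ S)(Δ^op(h))`.
  have key : ∀ t : H ⊗[k] H,
      twoSided (Δ : H →ₐ[k] H ⊗[k] H).toLinearMap SΔop (δElt k H) (wOp t) =
      Δ (S (k := k) (Algebra.TensorProduct.rid k k H
        (Algebra.TensorProduct.map (AlgHom.id k H) ε t))) * twistInv k H := by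
    intro t
    induction t with
    | zero => simp
    | add x y hx hy => simp only [add_mul, map_add, hx, hy]
    | tmul a b =>
      rw [wOp_tmul, twoSided_δ_mul_Δ, mul_twoSided_δ, SΔop_one, mul_one, ← twistInv_eq_twoSided]
      simp
  rw [← counit_right (k := k) h, ← key, wOp_Δ, mul_twoSided_δ, map_one, one_mul, counit_right,
    ← twistInv_eq_twoSided]

/-- The counit in the last leg of `Φ` gives `1`, so `X β S(Y) ε(Z) = β`. -/
theorem rid_nElt : Algebra.TensorProduct.rid k k H
    (Algebra.TensorProduct.map (AlgHom.id k H) ε (nElt k H)) = β k := by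
  let f : H ⊗[k] (H ⊗[k] (H ⊗[k] H)) →ₗ[k] H :=
    LinearMap.mul' k H ∘ₗ (LinearMap.mul' k H).lTensor H ∘ₗ Ln
  have h : ∀ y : H ⊗[k] (H ⊗[k] H), f (Algebra.TensorProduct.map (AlgHom.id k H)
      (Algebra.TensorProduct.map (AlgHom.id k H) εε) y) = Algebra.TensorProduct.rid k k H
    (Algebra.TensorProduct.map (AlgHom.id k H) ε (Ln y)) := by
    intro y
    induction y using induction3 with
    | h0 => simp
    | hadd y z hy hz => simp only [map_add, hy, hz]
    | h a b e => simp [f, εε_apply, Algebra.TensorProduct.one_def]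
  rw [nElt, ← h, counit_last]
  simp [f, Algebra.TensorProduct.one_def, S_one]

/-- `Δ(β) F⁻¹ = δ` -/
theorem Δβ_mul_twistInv : Δ (β k) * twistInv k H = δElt k H := by
  -- Here the map `c ⊗ d ↦ Δ(c) δ (S ⊗ S)(Δ^op(d))` is applied to `(n₁ ⊗ 1) m Δ(n₂) = 1`. The left
  -- side becomes `Δ(n₁ ε(n₂)) F⁻¹ = Δ(β) F⁻¹`, the right side `δ`.
  have key : ∀ t : H ⊗[k] H,
      twoSided (Δ : H →ₐ[k] H ⊗[k] H).toLinearMap SΔop (δElt k H)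
        (twoSided inL (Δ : H →ₐ[k] H ⊗[k] H).toLinearMap (mElt k H) t) =
      Δ (Algebra.TensorProduct.rid k k H
        (Algebra.TensorProduct.map (AlgHom.id k H) ε t)) * twistInv k H := by
    intro t
    induction t with
    | zero => simp
    | add x y hx hy => simp only [add_mul, map_add, hx, hy]
    | tmul a b =>
      rw [twoSided_tmul, AlgHom.toLinearMap_apply, twoSided_δ_mul_Δ, inL_apply, mul_twoSided_δ,
        SΔop_one, mul_one, ← twistInv_eq_twoSided]
      simp
  rw [← rid_nElt, ← key, n_m, Algebra.TensorProduct.one_def, twoSided_tmul, SΔop_one, mul_one,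
    AlgHom.toLinearMap_apply, map_one, one_mul]

end TwistFormulas
end QuasiHopf

namespace QuasiHopf
open QuasiBialgebra QuasiHopfAlgebra

/-! ### The coopposite twist, and the tensors occurring in the mates -/

section MateElements

variable {k H : Type u} [Field k] [Ring H] [Algebra k H] [QuasiHopfAlgebra k H]

local notation "Φₑ" => ((Φ : (H ⊗[k] (H ⊗[k] H))ˣ) : H ⊗[k] (H ⊗[k] H))
local notation "Ψₑ" => ((Φ⁻¹ : (H ⊗[k] (H ⊗[k] H))ˣ) : H ⊗[k] (H ⊗[k] H))

/-- The linear map `S⁻¹ ⊗ S⁻¹`. -/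
noncomputable def SSinv : H ⊗[k] H →ₗ[k] H ⊗[k] H :=
  TensorProduct.map (S : H ≃ₗ[k] H).symm.toLinearMap (S : H ≃ₗ[k] H).symm.toLinearMap

theorem SSinv_mul (s t : H ⊗[k] H) : SSinv (k := k) (s * t) = SSinv t * SSinv s := by
  induction s with
  | zero => simp
  | add x y hx hy => simp only [add_mul, mul_add, map_add, hx, hy]
  | tmul a b =>
    induction t with
    | zero => simp
    | add x y hx hy => simp only [add_mul, mul_add, map_add, hx, hy]
    | tmul c d => simp [SSinv, S_symm_mul]

theorem SSinv_SΔop (h : H) : SSinv (SΔop (k := k) h) = Δop h := by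
  have key : ∀ s : H ⊗[k] H, SSinv (SS (k := k) s) = s := by
    intro s
    induction s with
    | zero => simp
    | add x y hx hy => simp only [map_add, hx, hy]
    | tmul a b => simp [SSinv, SS]
  exact key _

/-- The pentagon gives `δ` a second expression, from `(id ⊗ id ⊗ Δ)(Φ⁻¹)(1 ⊗ Φ)`. Reversing the four
legs of this tensor yields the one that defines `δ` in the coopposite algebra. -/
theorem cop_δElt : @δElt k H _ _ _ copQuasiHopf = SSinv (δElt k H) := by
  let D : H ⊗[k] (H ⊗[k] (H ⊗[k] H)) →ₗ[k] H ⊗[k] H :=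
    TensorProduct.map (sandwich LinearMap.id (S : H ≃ₗ[k] H).toLinearMap (β k))
      (sandwich LinearMap.id (S : H ≃ₗ[k] H).toLinearMap (β k)) ∘ₗ shuffle₂
  have hD : ∀ a b c d : H, D (a ⊗ₜ (b ⊗ₜ (c ⊗ₜ d))) =
    (a * β k * S (k := k) d) ⊗ₜ (b * β k * S (k := k) c) := fun _ _ _ _ => rfl
  have h₁ : ∀ (x : H ⊗[k] (H ⊗[k] H)) (y : H ⊗[k] (H ⊗[k] (H ⊗[k] H))), D (y * Δ₂ x) =
      D (y * Algebra.TensorProduct.map (AlgHom.id k H)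
        ((Algebra.TensorProduct.assoc k k k H H H).toAlgHom.comp
          (Algebra.TensorProduct.map εε (AlgHom.id k H))) x) := by
    intro x y
    induction x using induction3 with
    | h0 => simp
    | hadd y z hy hz => simp only [map_add, mul_add, hy, hz]
    | h a b c =>
      induction y using induction4 with
      | h0 => simp
      | hadd y z hy hz => simp only [map_add, add_mul, hy, hz]
      | h d e f g =>
        have key : ∀ s : H ⊗[k] H, D (d ⊗ₜ (e ⊗ₜ (f ⊗ₜ g)) * a ⊗ₜ (app s c)) =
            (d * a * β k * S (k := k) (g * c)) ⊗ₜ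
              (e * sandwich LinearMap.id (S : H ≃ₗ[k] H).toLinearMap (β k) s * S (k := k) f) := by
          intro s
          induction s with
          | zero => simp
          | add s t hs ht =>
            simp only [map_add, LinearMap.add_apply, tmul_add, add_mul, mul_add, hs, ht]
          | tmul i j => simp [hD, S_mul, mul_assoc]
        refine (key (Δ b)).trans (Eq.trans ?_ (key (εε b)).symm)
        simp [β_S, εε_apply, Algebra.TensorProduct.one_def, S_one]
  -- The two tensors differ by a right factor `(id ⊗ Δ ⊗ id)(Φ⁻¹)`, which the contraction `b² β
  -- S(b³)` reduces to `1`.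
  have h₂ : D (Δ₃ Ψₑ * ιr k H Φₑ) = δElt k H := by
    rw [(pentagon_forms (k := k) (H := H)).2.2.1, ← mul_assoc, h₁, inv_of_eq_one counit_mid',
      mul_one]
    rfl
  have h₃ : ∀ y : H ⊗[k] (H ⊗[k] (H ⊗[k] H)),
      TensorProduct.map
        (sandwich LinearMap.id (S : H ≃ₗ[k] H).symm.toLinearMap ((S : H ≃ₗ[k] H).symm (β k)))
        (sandwich LinearMap.id (S : H ≃ₗ[k] H).symm.toLinearMap ((S : H ≃ₗ[k] H).symm (β k)))
        (shuffle₂ (rev4 y)) = SSinv (D y) := by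
    intro y
    induction y using induction4 with
    | h0 => simp
    | hadd y z hy hz => simp only [map_add, hy, hz]
    | h a b c d => simp [shuffle₂_tmul, hD, SSinv, S_symm_mul, mul_assoc]
  rw [← h₂, ← h₃, map_mul, ιr_apply, rev4_c]
  exact congrArg (fun t => TensorProduct.map
        (sandwich LinearMap.id (S : H ≃ₗ[k] H).symm.toLinearMap ((S : H ≃ₗ[k] H).symm (β k)))
        (sandwich LinearMap.id (S : H ≃ₗ[k] H).symm.toLinearMap ((S : H ≃ₗ[k] H).symm (β k)))
        (shuffle₂ (t * _))) (rev4_b Ψₑ).symm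

/-- With `δ = Δ(β) F⁻¹` and the commutation rule of `F⁻¹` with `(S ⊗ S)Δ^op`, the sum collects to
`Δ(q₁ β q₂) F⁻¹`, and `q₁ β q₂ = X β S(Y) α Z = 1`. -/
theorem twoSided_δ_q : twoSided (Δ : H →ₐ[k] H ⊗[k] H).toLinearMap
    (SΔop ∘ₗ (S : H ≃ₗ[k] H).symm.toLinearMap) (δElt k H) (qElt k H) = twistInv k H := by
  have key : ∀ t : H ⊗[k] H, twoSided (Δ : H →ₐ[k] H ⊗[k] H).toLinearMap
      (SΔop ∘ₗ (S : H ≃ₗ[k] H).symm.toLinearMap) (δElt k H) t =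
      Δ (sandwich LinearMap.id LinearMap.id (β k) t) * twistInv k H := by
    intro t
    induction t with
    | zero => simp
    | add x y hx hy => simp only [add_mul, map_add, hx, hy]
    | tmul a b =>
      rw [twoSided_tmul, ← Δβ_mul_twistInv, LinearMap.comp_apply, LinearEquiv.coe_coe, mul_assoc,
        mul_assoc, twistInv_mul_SΔop, LinearEquiv.apply_symm_apply]
      simp [mul_assoc]
  rw [key]
  refine (congrArg (fun x => Δ x * twistInv k H) Φ_β_α).trans ?_
  rw [map_one, one_mul]

/-- Expanded over `rev Φ`, the coopposite definition is the image under `S⁻¹ ⊗ S⁻¹` of `Δ(q₁) δ (S ⊗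
S)(Δ^op(S⁻¹(q₂)))`, which equals `F⁻¹` by `twoSided_δ_q`. -/
theorem cop_twistInv : @twistInv k H _ _ _ copQuasiHopf = SSinv (twistInv k H) := by
  have h : ∀ y : H ⊗[k] (H ⊗[k] H), LinearMap.mul' k (H ⊗[k] H) (TensorProduct.map
      (LinearMap.mulRight k (SSinv (δElt k H)) ∘ₗ (Δop : H →ₐ[k] H ⊗[k] H).toLinearMap ∘ₗ
        sandwich (S : H ≃ₗ[k] H).symm.toLinearMap LinearMap.id ((S : H ≃ₗ[k] H).symm (α k)))
      (SSinv ∘ₗ (TensorProduct.comm k H H).toLinearMap ∘ₗ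
        (Δop : H →ₐ[k] H ⊗[k] H).toLinearMap) ((TensorProduct.assoc k H H H).symm (rev y))) =
      SSinv (twoSided (Δ : H →ₐ[k] H ⊗[k] H).toLinearMap
        (SΔop ∘ₗ (S : H ≃ₗ[k] H).symm.toLinearMap) (δElt k H) (Lq k H y)) := by
    intro y
    induction y using induction3 with
    | h0 => simp
    | hadd y z hy hz => simp only [map_add, hy, hz]
    | h a b c =>
      have e : TensorProduct.comm k H H (Δop (k := k) a) = Δ a :=
        (TensorProduct.comm k H H).apply_symm_apply (Δ a)
      rw [Lq_tmul, twoSided_tmul, SSinv_mul, SSinv_mul, LinearMap.comp_apply, SSinv_SΔop, rev_tmul,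
        TensorProduct.assoc_symm_tmul, TensorProduct.map_tmul, LinearMap.mul'_apply]
      simp only [LinearMap.comp_apply, LinearEquiv.coe_coe, AlgHom.toLinearMap_apply, e,
        sandwich_tmul, LinearMap.mulRight_apply, S_symm_mul, LinearEquiv.symm_apply_apply,
        LinearMap.id_apply, mul_assoc]
  refine Eq.trans ?_ ((h Φₑ).trans (congrArg SSinv twoSided_δ_q))
  rw [← cop_δElt]
  rfl

/-- `G = σ(F⁻¹)` for the coopposite quasi-Hopf algebra. -/
theorem twistG_eq : twistG k H =
    TensorProduct.comm k H H (@twistInv k H _ _ _ copQuasiHopf) := by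
  rw [cop_twistInv, twistG]
  generalize twistInv k H = s
  induction s with
  | zero => simp
  | add x y hx hy => simp only [map_add, hx, hy]
  | tmul a b => rfl

/-! Elements acting in the mates of the associators. -/

/-- For `t = m` the left-hand side is the expression of `twist_eq`, so `F = wOp(vOp(m))`. -/
theorem twoSided_eq_wOp_vOp (t : H ⊗[k] H) : twoSided inR ((Δ : H →ₐ[k] H ⊗[k] H).toLinearMap ∘ₗ
    (S : H ≃ₗ[k] H).toLinearMap) (wOp (pElt k H)) t = wOp (vOp t) := by
  induction t with
  | zero => simp
  | add x y hx hy => simp only [map_add, hx, hy]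
  | tmul a b =>
    rw [vOp_tmul, wOp_mul, wOp_Δ_mul, S_one, ← Algebra.TensorProduct.one_def, one_mul]
    rfl

/-- Starting from `wOp(b ⊗ c) = (S(b) ⊗ 1) m Δ(c)`, the two outer operators pull out the factors
around `m` and leave `wOp(vOp(m)) = F`. Each absorbed coproduct moves its argument to the other leg,
whence the exchange of `b` and `c`. -/
theorem wOp_vOp_wOp (b c : H) : wOp (vOp (wOp (k := k) (b ⊗ₜ c))) =
    (S (k := k) c) ⊗ₜ (S (k := k) b) * twist k H := by
  rw [twist_eq, twoSided_eq_wOp_vOp, wOp_tmul, vOp_mul_Δ, mul_vOp, S_one,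
    ← Algebra.TensorProduct.one_def, mul_one, wOp_mul, wOp_Δ_mul, map_one, mul_one, ← mul_assoc,
    Algebra.TensorProduct.tmul_mul_tmul, mul_one, one_mul]

/-- The counterpart for `uOp = vOp ∘ wOp`: the factors around `p` in `vOp(b ⊗ c)` are pulled out to
the right, leaving `vOp(wOp(p)) = F⁻¹`. -/
theorem uOp_vOp (b c : H) : uOp (vOp (k := k) (b ⊗ₜ c)) =
    twistInv k H * (S (k := k) c) ⊗ₜ (S (k := k) b) := by
  have h : ∀ t : H ⊗[k] H, uOp (k := k) t = vOp (wOp t) := by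
    intro t
    induction t with
    | zero => simp
    | add x y hx hy => simp only [map_add, hx, hy]
    | tmul a b => rw [vOp_wOp]
  rw [twistInv_eq, h, vOp_tmul, wOp_mul, wOp_Δ_mul, S_one, ← Algebra.TensorProduct.one_def, one_mul,
    vOp_mul_Δ, mul_vOp, map_one, one_mul, ← h, mul_assoc, Algebra.TensorProduct.tmul_mul_tmul,
    mul_one, one_mul]

/-- `a ⊗ s ↦ Σ q₁ a¹ ⊗ (1 ⊗ S(a²) q₂) w(s)` -/
noncomputable def assocLOp : H ⊗[k] (H ⊗[k] H) →ₗ[k] H ⊗[k] (H ⊗[k] H) :=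
  LinearMap.mul' k (H ⊗[k] (H ⊗[k] H)) ∘ₗ TensorProduct.map
    (inR.lTensor H ∘ₗ qOp ∘ₗ (Δ : H →ₐ[k] H ⊗[k] H).toLinearMap)
    (TensorProduct.mk k H (H ⊗[k] H) 1 ∘ₗ wOp)

theorem assocLOp_tmul (a : H) (s : H ⊗[k] H) : assocLOp (k := k) (a ⊗ₜ s) =
    inR.lTensor H (qOp (Δ a)) * 1 ⊗ₜ wOp s := rfl

/-- The tensor of the mate `assocL`. `Φ (Δ ⊗ id)(p)` is first traded for `P ⊗ vOp(Q ⊗ R)`; the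
factor `q` then combines with `Φ⁻¹` through `qΔOp_Ψ` into `X ⊗ wOp(Y ⊗ Z)`, and `wOp ∘ vOp ∘ wOp`
produces `F`. -/
theorem assocLOp_Φ : assocLOp (Φₑ * Δid (pElt k H)) =
    (LinearMap.mulRight k (twist k H) ∘ₗ SS ∘ₗ (TensorProduct.comm k H H).toLinearMap).lTensor H
      Φₑ := by
  have h₁ : ∀ x : H ⊗[k] (H ⊗[k] H), assocLOp (vOp.lTensor H x) =
      (wOp ∘ₗ vOp).lTensor H (TensorProduct.assoc k H H H (qΔOp.rTensor H
        ((TensorProduct.assoc k H H H).symm x))) := by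
    intro x
    induction x using induction3 with
    | h0 => simp
    | hadd y z hy hz => simp only [map_add, hy, hz]
    | h a b c =>
      rw [LinearMap.lTensor_tmul, assocLOp_tmul]
      change _ = (wOp ∘ₗ vOp).lTensor H (app (qΔOp (a ⊗ₜ b)) c)
      rw [qΔOp_tmul]
      generalize qOp (k := k) (Δ a) = s
      induction s with
      | zero => simp
      | add s t hs ht => simp only [map_add, add_mul, LinearMap.add_apply, hs, ht]
      | tmul i j =>
        rw [Algebra.TensorProduct.tmul_mul_tmul, app_tmul, LinearMap.lTensor_tmul,
          LinearMap.lTensor_tmul, LinearMap.comp_apply, ← twoSided_eq_wOp_vOp,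
          ← twoSided_eq_wOp_vOp]
        simp [← mul_assoc]
  have h₂ : ∀ x : H ⊗[k] (H ⊗[k] H), (wOp ∘ₗ vOp).lTensor H (wOp.lTensor H x) =
      (LinearMap.mulRight k (twist k H) ∘ₗ SS ∘ₗ
        (TensorProduct.comm k H H).toLinearMap).lTensor H x := by
    intro x
    induction x using induction3 with
    | h0 => simp
    | hadd y z hy hz => simp only [map_add, hy, hz]
    | h a b c =>
      rw [LinearMap.lTensor_tmul, LinearMap.lTensor_tmul, LinearMap.comp_apply, wOp_vOp_wOp]
      rfl
  rw [Φ_mul_Δid_p, h₁, qΔOp_Ψ, h₂]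

/-- `a ⊗ s ↦ Σ q₁ a¹ ⊗ Δ(S(a²) q₂) s` -/
noncomputable def homTensorOp : H ⊗[k] (H ⊗[k] H) →ₗ[k] H ⊗[k] (H ⊗[k] H) :=
  LinearMap.mul' k (H ⊗[k] (H ⊗[k] H)) ∘ₗ TensorProduct.map
    ((idΔ : H ⊗[k] H →ₐ[k] _).toLinearMap ∘ₗ qOp ∘ₗ (Δ : H →ₐ[k] H ⊗[k] H).toLinearMap)
    (TensorProduct.mk k H (H ⊗[k] H) 1)

theorem homTensorOp_tmul (a : H) (s : H ⊗[k] H) : homTensorOp (k := k) (a ⊗ₜ s) =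
    idΔ (qOp (Δ a)) * 1 ⊗ₜ s := rfl

/-- First half of the mate in the direction out of `Hom(V ⊗ W, M)`: the second of the two inserted
copies of `p`, the associator and the evaluation are combined. The remaining copy of `p` is treated
in `uOp_Φ`. -/
theorem homTensorOp_Φ : homTensorOp (Φₑ * Δid (pElt k H)) = uOp.lTensor H Φₑ := by
  have h₁ : ∀ x : H ⊗[k] (H ⊗[k] H), homTensorOp (vOp.lTensor H x) =
      vOp.lTensor H (TensorProduct.assoc k H H H (qΔOp.rTensor H
        ((TensorProduct.assoc k H H H).symm x))) := by
    intro x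
    induction x using induction3 with
    | h0 => simp
    | hadd y z hy hz => simp only [map_add, hy, hz]
    | h a b c =>
      rw [LinearMap.lTensor_tmul, homTensorOp_tmul]
      change _ = vOp.lTensor H (app (qΔOp (a ⊗ₜ b)) c)
      rw [qΔOp_tmul]
      generalize qOp (k := k) (Δ a) = s
      induction s with
      | zero => simp
      | add s t hs ht => simp only [map_add, add_mul, LinearMap.add_apply, hs, ht]
      | tmul i j =>
        rw [Algebra.TensorProduct.tmul_mul_tmul, app_tmul, LinearMap.lTensor_tmul, idΔ_tmul,
          Algebra.TensorProduct.tmul_mul_tmul, vOp_tmul, vOp_tmul]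
        simp [← mul_assoc]
  have h₂ : ∀ x : H ⊗[k] (H ⊗[k] H), vOp.lTensor H (wOp.lTensor H x) = uOp.lTensor H x := by
    intro x
    induction x using induction3 with
    | h0 => simp
    | hadd y z hy hz => simp only [map_add, hy, hz]
    | h a b c =>
      rw [LinearMap.lTensor_tmul, LinearMap.lTensor_tmul, LinearMap.lTensor_tmul, vOp_wOp]
  rw [Φ_mul_Δid_p, h₁, qΔOp_Ψ, h₂]

theorem uOp_Φ : uOp.lTensor H (Φₑ * Δid (pElt k H)) =
    (LinearMap.mulLeft k (twistInv k H) ∘ₗ SS ∘ₗ (TensorProduct.comm k H H).toLinearMap).lTensor H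
      Ψₑ := by
  rw [Φ_mul_Δid_p]
  generalize Ψₑ = x
  induction x using induction3 with
  | h0 => simp
  | hadd y z hy hz => simp only [map_add, hy, hz]
  | h a b c =>
    rw [LinearMap.lTensor_tmul, LinearMap.lTensor_tmul, LinearMap.lTensor_tmul, uOp_vOp]
    rfl

/-- `a ⊗ b ⊗ c ↦ Σ (S(a) ⊗ 1) m Δ(q₁ b¹) ⊗ S(b²) q₂ c` -/
noncomputable def assocMOp : H ⊗[k] (H ⊗[k] H) →ₗ[k] H ⊗[k] (H ⊗[k] H) :=
  (TensorProduct.assoc k H H H).toLinearMap ∘ₗ wOp.rTensor H ∘ₗ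
    (TensorProduct.assoc k H H H).symm.toLinearMap ∘ₗ qΔOp.lTensor H

variable (k H) in
/-- `a ⊗ b ⊗ c ↦ a ⊗ b ⊗ S(c)` -/
noncomputable def S₃ : H ⊗[k] (H ⊗[k] H) →ₗ[k] H ⊗[k] (H ⊗[k] H) :=
  LinearMap.lTensor H (LinearMap.lTensor H (S : H ≃ₗ[k] H).toLinearMap)

theorem S₃_tmul (a b c : H) :
    S₃ k H (a ⊗ₜ (b ⊗ₜ c)) = a ⊗ₜ[k] (b ⊗ₜ[k] (S (k := k) c)) := rfl

theorem S₃_app (s : H ⊗[k] H) (c : H) : S₃ k H (app s c) = app s (S (k := k) c) := by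
  induction s with
  | zero => simp
  | add x y hx hy => simp only [map_add, LinearMap.add_apply, hx, hy]
  | tmul a b => rfl

/-- The zigzag of the left adjunction makes `qΔOp` undo `vOp` up to an antipode, so only the
contraction `wOp` of the right evaluation remains, and `idΔ_m_mul_Φ` identifies it. -/
theorem assocMOp_Φ : assocMOp (Φₑ * Δid (pElt k H)) = S₃ k H (idΔ (mElt k H) * Φₑ) := by
  rw [Φ_mul_Δid_p, idΔ_m_mul_Φ]
  generalize Ψₑ = x
  induction x using induction3 with
  | h0 => simp
  | hadd y z hy hz => simp only [map_add, hy, hz]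
  | h a b c =>
    -- The cancellation of `p` against `q` inside `vOp(b ⊗ c) = Δ(b) p (1 ⊗ S(c))`.
    have h₁ : qΔOp (vOp (k := k) (b ⊗ₜ c)) = b ⊗ₜ[k] S (k := k) c := by
      rw [vOp_tmul, qΔOp_mul, qΔOp_Δ_mul, qΔOp_p, mul_one, Algebra.TensorProduct.tmul_mul_tmul,
        mul_one, one_mul]
    have h₂ : assocMOp (vOp.lTensor H (a ⊗ₜ[k] (b ⊗ₜ[k] c))) =
        app (wOp (a ⊗ₜ b)) (S (k := k) c) := by
      rw [LinearMap.lTensor_tmul, assocMOp, LinearMap.comp_apply, LinearMap.comp_apply,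
        LinearMap.comp_apply, LinearMap.lTensor_tmul, h₁]
      rfl
    rw [h₂, ← S₃_app]
    rfl

end MateElements
end QuasiHopf

namespace QuasiHopf
open QuasiBialgebra QuasiHopfAlgebra
namespace HMod

/-! ### The isomorphism `V ◁ (W ◁ M) ≅ (V ⊗ W) ◁ M` -/

section Mates

variable {k H : Type u} [Field k] [Ring H] [Algebra k H]

/-- `a ⊗ t` acts on `φ : U → M` by `u ↦ a φ(t u)`, for an `A`-module `U` and `t ∈ A`. -/
noncomputable def conjA {A U : Type*} [Ring A] [Algebra k A] [AddCommGroup U] [Module k U]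
    (M : HMod k H) (σ : A →ₐ[k] Module.End k U) : H ⊗[k] A →ₗ[k] Module.End k (U →ₗ[k] M) :=
  TensorProduct.lift ((LinearMap.llcomp k (U →ₗ[k] M) (U →ₗ[k] M) (U →ₗ[k] M)).compl₁₂
    (LinearMap.llcomp k U M M ∘ₗ M.ρ.toLinearMap)
    ((LinearMap.llcomp k U U M).flip ∘ₗ σ.toLinearMap))

@[simp]
theorem conjA_tmul {A U : Type*} [Ring A] [Algebra k A] [AddCommGroup U] [Module k U]
    (M : HMod k H) (σ : A →ₐ[k] Module.End k U) (a : H) (t : A) (φ : U →ₗ[k] M) :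
    conjA M σ (a ⊗ₜ t) φ = M.ρ a ∘ₗ φ ∘ₗ σ t := rfl

theorem conjA_comm {V W M : HMod k H} (φ : V ⊗[k] W →ₗ[k] M) (x : H ⊗[k] (H ⊗[k] H))
    (v : V) (w : W) :
    conjA M (box W.ρ V.ρ) x (φ ∘ₗ (TensorProduct.comm k W V).toLinearMap) (w ⊗ₜ v) =
      conjA M (box V.ρ W.ρ) ((TensorProduct.comm k H H).toLinearMap.lTensor H x) φ (v ⊗ₜ w) := by
  induction x using induction3 with
  | h0 => simp
  | hadd y z hy hz => simp only [map_add, LinearMap.add_apply, hy, hz]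
  | h a b c => rfl

/-- The bilinear map `(a, b) ↦ n(a v)(b w)`. -/
noncomputable def orbit₂ {V W M : HMod k H} (n : V →ₗ[k] W →ₗ[k] M) (v : V) (w : W) :
    H →ₗ[k] H →ₗ[k] M := n.compl₁₂ (V.orbit v) (W.orbit w)

theorem lift_orbit₂ {V W M : HMod k H} (n : V →ₗ[k] W →ₗ[k] M) (v : V) (w : W) (t : H ⊗[k] H) :
    TensorProduct.lift (orbit₂ n v w) t = TensorProduct.lift n (box V.ρ W.ρ t (v ⊗ₜ w)) := by
  induction t with
  | zero => simp
  | add y z hy hz => simp only [map_add, LinearMap.add_apply, hy, hz]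
  | tmul a b => rfl

variable [QuasiHopfAlgebra k H]

local notation "Φₑ" => ((Φ : (H ⊗[k] (H ⊗[k] H))ˣ) : H ⊗[k] (H ⊗[k] H))
local notation "Ψₑ" => ((Φ⁻¹ : (H ⊗[k] (H ⊗[k] H))ˣ) : H ⊗[k] (H ⊗[k] H))

theorem conj_qElt (V M : HMod k H) (a b : H) (φ : V →ₗ[k] M) (v : V) :
    conj V M (qElt k H) ((homL V M).ρ a φ) (V.ρ b v) = conj V M (qΔOp (a ⊗ₜ b)) φ v := by
  rw [homL_ρ, qElt, conj_Lq, ← Lq_Φ_mul_Δid]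
  rfl

/-- `a ⊗ s ↦ Σ q₁ a¹ ⊗ (1 ⊗ S(a²) q₂) s` -/
noncomputable def innerOp : H ⊗[k] (H ⊗[k] H) →ₗ[k] H ⊗[k] (H ⊗[k] H) :=
  LinearMap.mul' k (H ⊗[k] (H ⊗[k] H)) ∘ₗ TensorProduct.map
    (inR.lTensor H ∘ₗ qOp ∘ₗ (Δ : H →ₐ[k] H ⊗[k] H).toLinearMap)
    (TensorProduct.mk k H (H ⊗[k] H) 1)

theorem innerOp_tmul (a : H) (s : H ⊗[k] H) : innerOp (k := k) (a ⊗ₜ s) =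
    inR.lTensor H (qOp (Δ a)) * 1 ⊗ₜ s := rfl

theorem innerOp_wOp (x : H ⊗[k] (H ⊗[k] H)) :
    innerOp (wOp.lTensor H x) = assocLOp (k := k) x := by
  induction x with
  | zero => simp
  | add x y hx hy => simp only [map_add, hx, hy]
  | tmul a s => rfl

theorem conj_qΔOp_eq_conjA (V W M : HMod k H) (n : V →ₗ[k] W →ₗ[k] M) (a b c : H) (v : V) (w : W) :
    conj W M (qΔOp (a ⊗ₜ c)) (n (V.ρ b v)) w =
      conjA M (box V.ρ W.ρ) (innerOp (k := k) (a ⊗ₜ (b ⊗ₜ c))) (TensorProduct.lift n)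
        (v ⊗ₜ w) := by
  rw [qΔOp_tmul, innerOp_tmul]
  generalize qOp (k := k) (Δ a) = s
  induction s with
  | zero => simp
  | add s t hs ht => simp only [map_add, add_mul, LinearMap.add_apply, hs, ht]
  | tmul i j => simp

/-- The evaluation `φ ⊗ v ↦ X φ(S(Y) α Z v)`. -/
noncomputable def evL (V M : HMod k H) : homL V M ⊗[k] V →ₗ[k] M :=
  ηL (N := homL V M) (LinearMap.id : (V →ₗ[k] M) →ₗ[k] (V →ₗ[k] M))

/-- The linear map `V ⊗ W → M` of an element of `Hom^l(V, Hom^l(W, M))`. -/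
noncomputable def liftL (V W M : HMod k H) : homL V (homL W M) →ₗ[k] (V ⊗[k] W →ₗ[k] M) :=
  (TensorProduct.uncurry (RingHom.id k) V W M : (V →ₗ[k] W →ₗ[k] M) →ₗ[k] _)

/-- `a ⊗ b ↦ (φ ↦ a φ(b -))` -/
noncomputable def conjL (V M : HMod k H) : H ⊗[k] H →ₗ[k] homL V M →ₗ[k] (V →ₗ[k] M) :=
  (conj V M : H ⊗[k] H →ₗ[k] (V →ₗ[k] M) →ₗ[k] (V →ₗ[k] M))

/-- `a ⊗ b ↦ (φ ↦ a φ(S(b) -))` -/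
noncomputable def conjSL (V M : HMod k H) : H ⊗[k] H →ₗ[k] homL V M →ₗ[k] homL V M :=
  ((conjS V M).toLinearMap : H ⊗[k] H →ₗ[k] (V →ₗ[k] M) →ₗ[k] (V →ₗ[k] M))

theorem evL_box (V M : HMod k H) (a b : H) (φ : homL V M) (v : V) :
    evL V M ((homL V M).ρ a φ ⊗ₜ V.ρ b v) = conjL V M (qΔOp (a ⊗ₜ b)) φ v :=
  conj_qElt V M a b φ v

/-- The counit of `(- ⊗ V) ⊗ W ⊣ Hom^l(V, Hom^l(W, -))` composed with the associator. -/
noncomputable def evLL (V W M : HMod k H) : homL V (homL W M) ⊗[k] (V ⊗[k] W) →ₗ[k] M :=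
  evL W M ∘ₗ TensorProduct.map (evL V (homL W M)) (LinearMap.id (M := W)) ∘ₗ
    (TensorProduct.assoc k (homL V (homL W M)) V W).symm.toLinearMap ∘ₗ
      box (homL V (homL W M)).ρ (box V.ρ W.ρ) Ψₑ

/-- Evaluating at `V` turns the action of `P ⊗ Q` into `qΔOp(P ⊗ Q)`, whose first leg then acts on
`Hom(W, M)` before the evaluation at `W`. By `qΔOp_Ψ` the tensor reaching the second evaluation is
`X ⊗ wOp(Y ⊗ Z)`. -/
theorem evLL_tmul (V W M : HMod k H) (n : homL V (homL W M)) (u : V ⊗[k] W) :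
    evLL V W M (n ⊗ₜ u) = conjA M (box V.ρ W.ρ) (assocLOp Φₑ) (liftL V W M n) u := by
  have key : ∀ (x : H ⊗[k] (H ⊗[k] H)) (v : V) (w : W),
      evL W M (TensorProduct.map (evL V (homL W M)) (LinearMap.id (M := W))
        ((TensorProduct.assoc k (homL V (homL W M)) V W).symm
          (box (homL V (homL W M)).ρ (box V.ρ W.ρ) x (n ⊗ₜ (v ⊗ₜ w))))) =
      conjA M (box V.ρ W.ρ) (innerOp (TensorProduct.assoc k H H H (qΔOp.rTensor H
        ((TensorProduct.assoc k H H H).symm x)))) (liftL V W M n) (v ⊗ₜ w) := by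
    intro x v w
    induction x using induction3 with
    | h0 => simp
    | hadd y z hy hz => simp only [map_add, LinearMap.add_apply, hy, hz]
    | h a b c =>
      change evL W M (evL V (homL W M) ((homL V (homL W M)).ρ a n ⊗ₜ V.ρ b v) ⊗ₜ W.ρ c w) =
        conjA M (box V.ρ W.ρ) (innerOp (app (qΔOp (a ⊗ₜ b)) c)) (liftL V W M n) (v ⊗ₜ w)
      rw [evL_box]
      generalize qΔOp (k := k) (a ⊗ₜ b) = s
      induction s with
      | zero => simp
      | add s t hs ht => simp only [map_add, LinearMap.add_apply, add_tmul, hs, ht]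
      | tmul i j => exact (evL_box W M i c _ w).trans (conj_qΔOp_eq_conjA V W M n i j c v w)
  rw [← innerOp_wOp, ← qΔOp_Ψ]
  exact LinearMap.congr_fun (f := evLL V W M ∘ₗ TensorProduct.mk k (homL V (homL W M)) (V ⊗[k] W) n)
    (TensorProduct.ext' fun v w => key Ψₑ v w) u

/-- The value at `v` of an element of `Hom^l(V, M)`. -/
def homL.eval (V M : HMod k H) : homL V M →ₗ[k] V →ₗ[k] M :=
  (LinearMap.id : (V →ₗ[k] M) →ₗ[k] (V →ₗ[k] M))

theorem liftL_conjSL (V W M : HMod k H) (n : homL V (homL W M)) (a c : H) :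
    liftL V W M (conjSL V (homL W M) (a ⊗ₜ c) n) = conjA M (box V.ρ W.ρ)
      ((TensorProduct.mk k H H (S (k := k) c) ∘ₗ (S : H ≃ₗ[k] H).toLinearMap).lTensor H (Δ a))
        (liftL V W M n) := by
  have key : ∀ (y : H ⊗[k] H) (v : V) (w : W),
      homL.eval W M (conjSL W M y (homL.eval V (homL W M) n (V.ρ (S (k := k) c) v))) w =
      conjA M (box V.ρ W.ρ) ((TensorProduct.mk k H H (S (k := k) c) ∘ₗ
        (S : H ≃ₗ[k] H).toLinearMap).lTensor H y) (liftL V W M n) (v ⊗ₜ w) := by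
    intro y v w
    induction y with
    | zero => simp
    | add y z hy hz => simp only [map_add, LinearMap.add_apply, hy, hz]
    | tmul e f => rfl
  exact TensorProduct.ext' fun v w => key (Δ a) v w

/-- Translates right multiplication of the tensor by `Δ(a) ⊗ b` into the action of `a` on `n` and of
`b` on `V ⊗ W`. This is how the copy of `p` inserted by the unit is taken into account. -/
theorem conjA_assocLOp_mul (V W M : HMod k H) (n : homL V (homL W M)) (x : H ⊗[k] (H ⊗[k] H))
    (t : H ⊗[k] H) (b : H) :
    conjA M (box V.ρ W.ρ) (assocLOp (x * app t b)) (liftL V W M n) =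
      conjA M (box V.ρ W.ρ) (assocLOp x) (liftL V W M (conjSL V (homL W M) t n)) ∘ₗ
        box V.ρ W.ρ (Δ b) := by
  induction t with
  | zero => simp
  | add t s ht hs =>
    simp only [map_add, mul_add, LinearMap.add_apply, LinearMap.add_comp, ht, hs]
  | tmul a c =>
    rw [liftL_conjSL]
    generalize liftL V W M n = φ
    induction x with
    | zero => simp
    | add y z hy hz => simp only [map_add, add_mul, LinearMap.add_apply, LinearMap.add_comp, hy, hz]
    | tmul d s =>
      rw [app_tmul, Algebra.TensorProduct.tmul_mul_tmul, assocLOp_tmul, assocLOp_tmul,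
        map_mul Δ, wOp_mul]
      generalize Δ (k := k) a = y
      induction y with
      | zero => simp
      | add y z hy hz =>
        simp only [mul_add, add_mul, map_add, LinearMap.add_apply, LinearMap.add_comp, hy, hz]
      | tmul e f =>
        rw [qOp_mul]
        generalize qOp (k := k) (Δ d) = r
        generalize wOp (k := k) s = s
        generalize Δ (k := k) b = z
        induction r with
        | zero => simp
        | add y z hy hz =>
          simp only [mul_add, add_mul, map_add, LinearMap.add_apply, LinearMap.add_comp, hy, hz]
        | tmul i j =>
          have h : (1 : H) ⊗ₜ[k] (S (k := k) f * j) * ((S (k := k) c) ⊗ₜ 1 * s * z) =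
              (S (k := k) c) ⊗ₜ (S (k := k) f) * ((1 : H) ⊗ₜ j * s) * z := by
            simp only [← mul_assoc, Algebra.TensorProduct.tmul_mul_tmul, one_mul, mul_one]
          simp only [Algebra.TensorProduct.tmul_mul_tmul, one_mul, mul_one,
            LinearMap.lTensor_tmul, inR_apply, h, conjA_tmul, map_mul]
          rfl

theorem evLL_box (V W M : HMod k H) (n : homL V (homL W M)) (t : H ⊗[k] H) (u : V ⊗[k] W) :
    evLL V W M (box (homL V (homL W M)).ρ ((box V.ρ W.ρ).comp Δ) t (n ⊗ₜ u)) =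
      conjA M (box V.ρ W.ρ) (assocLOp (Φₑ * Δid t)) (liftL V W M n) u := by
  induction t with
  | zero => simp
  | add t s ht hs => simp only [map_add, mul_add, LinearMap.add_apply, ht, hs]
  | tmul a b =>
    rw [Δid_tmul, conjA_assocLOp_mul]
    exact evLL_tmul V W M _ _

/-- The mate is the unit of `- ⊗ (V ⊗ W)`, which inserts `p`, followed by the inverse associator and
the two evaluations; the inserted `p` acts through `Φ (Δ ⊗ id)(p)`, and `assocLOp_Φ` evaluates the
outcome. -/
theorem assocL_lin (V W M : HMod k H) (n : homL V (homL W M)) :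
    ((Contragradient.assocL V W).hom.app M).lin n =
      conjA M (box V.ρ W.ρ) ((LinearMap.mulRight k (twist k H) ∘ₗ SS ∘ₗ
        (TensorProduct.comm k H H).toLinearMap).lTensor H Φₑ) (liftL V W M n) := by
  rw [← assocLOp_Φ]
  refine LinearMap.ext fun u => Eq.trans ?_ (evLL_box V W M n (pElt k H) u)
  rw [Contragradient.assocL, conjugateIsoEquiv_apply_hom, conjugateEquiv_apply_app]
  rfl

end Mates
end HMod
end QuasiHopf

namespace QuasiHopf
open QuasiBialgebra QuasiHopfAlgebra
namespace HMod

/-! ### The isomorphism `M ▷ (V ⊗ W) ≅ (M ▷ V) ▷ W` -/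

section MatesR

variable {k H : Type u} [Field k] [Ring H] [Algebra k H] [QuasiHopfAlgebra k H]

local notation "Φₑ" => ((Φ : (H ⊗[k] (H ⊗[k] H))ˣ) : H ⊗[k] (H ⊗[k] H))
local notation "Ψₑ" => ((Φ⁻¹ : (H ⊗[k] (H ⊗[k] H))ˣ) : H ⊗[k] (H ⊗[k] H))

/-- The map `j` stands in for the identity of `V ⊗ W`. It is kept general because over the
coopposite algebra the tensor product in question is identified with `V ⊗ W` only through the flip.
-/
theorem evL_box_conjA {V W U M : HMod k H} (j : V ⊗[k] W →ₗ[k] U)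
    (hj : ∀ h, j ∘ₗ box V.ρ W.ρ (Δ h) = U.ρ h ∘ₗ j) (n : homL U M) (x : H ⊗[k] (H ⊗[k] H))
    (u : V ⊗[k] W) :
    evL U M (TensorProduct.map LinearMap.id j (box (homL U M).ρ (box V.ρ W.ρ) x (n ⊗ₜ u))) =
      conjA M (box V.ρ W.ρ) (homTensorOp x) (homL.eval U M n ∘ₗ j) u := by
  induction x with
  | zero => simp
  | add x y hx hy => simp only [map_add, LinearMap.add_apply, hx, hy]
  | tmul a s =>
    have h : evL U M ((homL U M).ρ a n ⊗ₜ j (box V.ρ W.ρ s u)) =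
        conjL U M (qOp (Δ a)) n (j (box V.ρ W.ρ s u)) := by
      have h' := evL_box U M a 1 n (j (box V.ρ W.ρ s u))
      rw [map_one, qΔOp_tmul, ← Algebra.TensorProduct.one_def, mul_one] at h'
      exact h'
    refine h.trans ?_
    rw [homTensorOp_tmul]
    generalize qOp (k := k) (Δ a) = r
    induction r with
    | zero => simp
    | add x y hx hy => simp only [map_add, add_mul, LinearMap.add_apply, hx, hy]
    | tmul b c =>
      rw [idΔ_tmul, Algebra.TensorProduct.tmul_mul_tmul, mul_one, conjA_tmul, map_mul]
      exact congrArg (fun z => M.ρ b (homL.eval U M n z))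
        (LinearMap.congr_fun (hj c) (box V.ρ W.ρ s u)).symm

theorem conjA_uOp_mul {V W U M : HMod k H} (j : V ⊗[k] W →ₗ[k] U)
    (hj : ∀ h, j ∘ₗ box V.ρ W.ρ (Δ h) = U.ρ h ∘ₗ j) (n : homL U M) (x : H ⊗[k] (H ⊗[k] H))
    (t : H ⊗[k] H) (b : H) :
    conjA M (box V.ρ W.ρ) (uOp.lTensor H (x * app t b)) (homL.eval U M n ∘ₗ j) =
      conjA M (box V.ρ W.ρ) (uOp.lTensor H x) (homL.eval U M (conjSL U M t n) ∘ₗ j) ∘ₗ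
        box V.ρ W.ρ (b ⊗ₜ 1) := by
  induction t with
  | zero => simp
  | add t s ht hs =>
    simp only [map_add, mul_add, LinearMap.add_apply, LinearMap.add_comp, ht, hs]
  | tmul a c =>
    have h : homL.eval U M (conjSL U M (a ⊗ₜ c) n) ∘ₗ j =
        M.ρ a ∘ₗ (homL.eval U M n ∘ₗ j) ∘ₗ box V.ρ W.ρ (Δ (S (k := k) c)) := by
      rw [LinearMap.comp_assoc, hj]
      rfl
    rw [h]
    generalize homL.eval U M n ∘ₗ j = φ
    induction x using induction3 with
    | h0 => simp
    | hadd y z hy hz =>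
      simp only [map_add, add_mul, LinearMap.add_apply, LinearMap.add_comp, hy, hz]
    | h d e f =>
      rw [app_tmul, Algebra.TensorProduct.tmul_mul_tmul, Algebra.TensorProduct.tmul_mul_tmul,
        LinearMap.lTensor_tmul, LinearMap.lTensor_tmul, uOp_tmul, uOp_tmul, S_mul, map_mul,
        conjA_tmul, conjA_tmul, map_mul M.ρ]
      have h' : (f * b) ⊗ₜ[k] (1 : H) = f ⊗ₜ 1 * b ⊗ₜ 1 := by simp
      rw [h']
      simp only [map_mul, mul_assoc]
      rfl

/-- The transpose of the counit of `- ⊗ U ⊣ Hom^l(U, -)` under the adjunction for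
`(- ⊗ V) ⊗ W`, for `U` isomorphic to `V ⊗ W`. -/
theorem homTensor_mate {V W U M : HMod k H} (j : V ⊗[k] W →ₗ[k] U)
    (hj : ∀ h, j ∘ₗ box V.ρ W.ρ (Δ h) = U.ρ h ∘ₗ j) (n : homL U M) (v : V) (w : W) :
    evL U M (TensorProduct.map LinearMap.id j (box (homL U M).ρ (box V.ρ W.ρ) Φₑ
      (TensorProduct.assoc k (homL U M) V W (box ((box (homL U M).ρ V.ρ).comp Δ) W.ρ (pElt k H)
        (box (homL U M).ρ V.ρ (pElt k H) (n ⊗ₜ v) ⊗ₜ w))))) =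
      conjA M (box V.ρ W.ρ) ((LinearMap.mulLeft k (twistInv k H) ∘ₗ SS ∘ₗ
        (TensorProduct.comm k H H).toLinearMap).lTensor H Ψₑ) (homL.eval U M n ∘ₗ j)
          (v ⊗ₜ w) := by
  -- The units insert `p` twice, first for `V`, then for `W`. The later copy is handled here with an
  -- arbitrary `n ⊗ v`; the earlier one is then substituted by linearity in `h₃`.
  have h₁ : ∀ (n : homL U M) (v : V),
      evL U M (TensorProduct.map LinearMap.id j (box (homL U M).ρ (box V.ρ W.ρ) Φₑ
      (TensorProduct.assoc k (homL U M) V W (box ((box (homL U M).ρ V.ρ).comp Δ) W.ρ (pElt k H)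
        ((n ⊗ₜ v) ⊗ₜ w))))) =
      conjA M (box V.ρ W.ρ) (uOp.lTensor H Φₑ) (homL.eval U M n ∘ₗ j) (v ⊗ₜ w) := by
    intro n v
    have h₂ := LinearMap.congr_fun (box_assoc (homL U M).ρ V.ρ W.ρ
      (Algebra.TensorProduct.map Δ (AlgHom.id k H) (pElt k H))) ((n ⊗ₜ v) ⊗ₜ w)
    rw [box_comp_map, AlgHom.comp_id] at h₂
    refine (congrArg (fun z => evL U M (TensorProduct.map LinearMap.id j
      (box (homL U M).ρ (box V.ρ W.ρ) Φₑ z))) h₂).trans ?_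
    rw [← homTensorOp_Φ, ← evL_box_conjA j hj, map_mul]
    rfl
  rw [← uOp_Φ]
  generalize pElt k H = t at h₁ ⊢
  have h₃ : ∀ s : H ⊗[k] H, 
      evL U M (TensorProduct.map LinearMap.id j (box (homL U M).ρ (box V.ρ W.ρ) Φₑ
      (TensorProduct.assoc k (homL U M) V W (box ((box (homL U M).ρ V.ρ).comp Δ) W.ρ t
        (box (homL U M).ρ V.ρ s (n ⊗ₜ v) ⊗ₜ w))))) =
      conjA M (box V.ρ W.ρ) (uOp.lTensor H (Φₑ * Δid s)) (homL.eval U M n ∘ₗ j) (v ⊗ₜ w) := by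
    intro s
    induction s with
    | zero => simp
    | add x y hx hy => simp only [map_add, mul_add, add_tmul, LinearMap.add_apply, hx, hy]
    | tmul a b =>
      refine (h₁ _ _).trans ?_
      rw [Δid_tmul, conjA_uOp_mul j hj, LinearMap.comp_apply, box_tmul, map_one]
      rfl
  exact h₃ t

/-- The evaluation `φ ⊗ v ↦ R φ(S⁻¹(Q) S⁻¹(α) P v)`. -/
noncomputable def evRop (V M : HMod k H) : homR V M ⊗[k] V →ₗ[k] M :=
  @evL k H _ _ _ copQuasiHopf V M

/-- The evaluation `v ⊗ φ ↦ R φ(S⁻¹(Q) S⁻¹(α) P v)`. -/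
noncomputable def evR (V M : HMod k H) : V ⊗[k] homR V M →ₗ[k] M :=
  evRop V M ∘ₗ (TensorProduct.comm k V (homR V M)).toLinearMap

/-- The value at `v` of an element of `Hom^r(V, M)`. -/
def homR.eval (V M : HMod k H) : homR V M →ₗ[k] V →ₗ[k] M :=
  (LinearMap.id : (V →ₗ[k] M) →ₗ[k] (V →ₗ[k] M))

/-- Moves all flips to one place, rewriting a right evaluation as a left evaluation of the
coopposite algebra with the legs of `x` reversed. -/
theorem evR_box {V W U M : HMod k H} (j : V ⊗[k] W →ₗ[k] U) (x : H ⊗[k] (H ⊗[k] H))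
    (t : (homR U M ⊗[k] W) ⊗[k] V) :
    evR U M (TensorProduct.map j LinearMap.id ((TensorProduct.assoc k V W (homR U M)).symm
      (box V.ρ (box W.ρ (homR U M).ρ) x (TensorProduct.comm k (W ⊗[k] homR U M) V
        (TensorProduct.map (TensorProduct.comm k (homR U M) W).toLinearMap
            LinearMap.id t))))) =
    evRop U M (TensorProduct.map LinearMap.id
      (j ∘ₗ (TensorProduct.comm k W V).toLinearMap) (box (homR U M).ρ (box W.ρ V.ρ) (rev x)
        (TensorProduct.assoc k (homR U M) W V t))) := by
  induction t with
  | zero => simp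
  | add y z hy hz => simp only [map_add, hy, hz]
  | tmul t v =>
    induction t with
    | zero => simp
    | add y z hy hz => simp only [map_add, add_tmul, hy, hz]
    | tmul n w =>
      induction x using induction3 with
      | h0 => simp
      | hadd y z hy hz => simp only [map_add, LinearMap.add_apply, hy, hz]
      | h a b c => rfl

theorem comm_twistInv (x : H ⊗[k] H) : TensorProduct.comm k H H
    (@twistInv k H _ _ _ copQuasiHopf * SSinv (TensorProduct.comm k H H x)) =
      twistG k H * SSinv x := by
  rw [twistG_eq]
  refine ((Algebra.TensorProduct.comm k H H).map_mul _ _).trans ?_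
  have h : ∀ x : H ⊗[k] H,
      TensorProduct.comm k H H (SSinv (TensorProduct.comm k H H x)) = SSinv (k := k) x := by
    intro x
    induction x with
    | zero => simp
    | add x y hx hy => simp only [map_add, hx, hy]
    | tmul a b => rfl
  exact congrArg (fun z => TensorProduct.comm k H H (@twistInv k H _ _ _ copQuasiHopf) * z) (h x)

/-- This is `homTensor_mate` for the coopposite algebra with `V` and `W` exchanged. There `P ⊗ Q ⊗
R` is `Z ⊗ Y ⊗ X`, the antipode is `S⁻¹`, and the coopposite `F⁻¹` becomes `G` after the flip. -/
theorem assocR_lin (V W M : HMod k H) (n : homR (tensor V W) M) (v : V) (w : W) :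
    homR.eval V M (homR.eval W (homR V M) (((Contragradient.assocR V W).hom.app M).lin n) w) v =
      conjA M (box V.ρ W.ρ) ((LinearMap.mulLeft k (twistG k H) ∘ₗ SSinv).lTensor H (rev Φₑ)) n
        (v ⊗ₜ w) := by
  rw [Contragradient.assocR, conjugateIsoEquiv_apply_hom, conjugateEquiv_apply_app]
  let N := homR (tensor V W) M
  let j : V ⊗[k] W →ₗ[k] tensor V W := (LinearMap.id : V ⊗[k] W →ₗ[k] V ⊗[k] W)
  refine Eq.trans (b := evR (tensor V W) M ((TensorProduct.assoc k V W N).symm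
    (box V.ρ (box W.ρ N.ρ) Ψₑ (TensorProduct.comm k (W ⊗[k] N) V
      (box ((box W.ρ N.ρ).comp Δ) V.ρ (@pElt k H _ _ _ copQuasiHopf)
        (TensorProduct.comm k N W (box N.ρ W.ρ (@pElt k H _ _ _ copQuasiHopf) (n ⊗ₜ w))
          ⊗ₜ v)))))) rfl ?_
  have h₁ : ∀ (y : N ⊗[k] W) (v : V) (p : H ⊗[k] H),
      box ((box W.ρ N.ρ).comp Δ) V.ρ p (TensorProduct.comm k N W y ⊗ₜ v) =
      TensorProduct.map (TensorProduct.comm k N W).toLinearMap LinearMap.id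
        (box ((box N.ρ W.ρ).comp Δop) V.ρ p (y ⊗ₜ v)) := fun y v p =>
    (LinearMap.congr_fun (box_natural ((box N.ρ W.ρ).comp Δop) V.ρ ((box W.ρ N.ρ).comp Δ) V.ρ
      (TensorProduct.comm k N W).toLinearMap LinearMap.id (fun h => box_comm W N (Δ h))
      (fun _ => rfl) p) (y ⊗ₜ v)).symm
  rw [h₁]
  have h₂ := evR_box (M := M) j Ψₑ (box ((box N.ρ W.ρ).comp Δop) V.ρ
    (@pElt k H _ _ _ copQuasiHopf) ((box N.ρ W.ρ (@pElt k H _ _ _ copQuasiHopf) (n ⊗ₜ w)) ⊗ₜ v))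
  have h₃ := @homTensor_mate k H _ _ _ copQuasiHopf W V (tensor V W) M
    (j ∘ₗ (TensorProduct.comm k W V).toLinearMap) (fun h => box_comm V W (Δ h)) n w v
  have h₄ : ∀ z, TensorProduct.map j (LinearMap.id (M := N)) z = z := fun z =>
    LinearMap.congr_fun (TensorProduct.map_id (R := k) (M := V ⊗[k] W) (N := N)) z
  -- Flipping back from `W ⊗ V` to `V ⊗ W` exchanges the last two legs, which is exactly the flip in
  -- the definition of `G`.
  have h₅ : ∀ x : H ⊗[k] (H ⊗[k] H), (TensorProduct.comm k H H).toLinearMap.lTensor H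
      ((LinearMap.mulLeft k (@twistInv k H _ _ _ copQuasiHopf) ∘ₗ SSinv ∘ₗ
        (TensorProduct.comm k H H).toLinearMap).lTensor H x) =
      (LinearMap.mulLeft k (twistG k H) ∘ₗ SSinv).lTensor H x := by
    intro x
    rw [← LinearMap.comp_apply, ← LinearMap.lTensor_comp]
    refine congrArg (fun f => LinearMap.lTensor H f x) (LinearMap.ext fun y => ?_)
    exact comm_twistInv y
  refine ((congrArg (evR (tensor V W) M) (h₄ _).symm).trans (h₂.trans h₃)).trans ?_
  rw [← h₅]
  exact conjA_comm (show V ⊗[k] W →ₗ[k] M from n) _ v w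

end MatesR
end HMod
end QuasiHopf

namespace QuasiHopf
open QuasiBialgebra QuasiHopfAlgebra

/-! ### The coopposite `p` and `q` in terms of `n` and `m` -/

section CopElements

variable {k H : Type u} [Field k] [Ring H] [Algebra k H] [QuasiHopfAlgebra k H]

local notation "Φₑ" => ((Φ : (H ⊗[k] (H ⊗[k] H))ˣ) : H ⊗[k] (H ⊗[k] H))
local notation "Ψₑ" => ((Φ⁻¹ : (H ⊗[k] (H ⊗[k] H))ˣ) : H ⊗[k] (H ⊗[k] H))

/-- `a ⊗ b ↦ b ⊗ S⁻¹(a)` -/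
noncomputable def flipS : H ⊗[k] H →ₗ[k] H ⊗[k] H :=
  (S : H ≃ₗ[k] H).symm.toLinearMap.lTensor H ∘ₗ (TensorProduct.comm k H H).toLinearMap

theorem flipS_tmul (a b : H) :
    flipS (k := k) (a ⊗ₜ b) = b ⊗ₜ[k] ((S : H ≃ₗ[k] H).symm a) := rfl

theorem cop_qElt : @qElt k H _ _ _ copQuasiHopf = flipS (mElt k H) := by
  have h : ∀ x : H ⊗[k] (H ⊗[k] H), @Lq k H _ _ _ copQuasiHopf (rev x) = flipS (Lm x) := by
    intro x
    induction x using induction3 with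
    | h0 => simp
    | hadd y z hy hz => simp only [map_add, hy, hz]
    | h a b c =>
      refine (@Lq_tmul k H _ _ _ copQuasiHopf c b a).trans ?_
      rw [Lm_tmul, flipS_tmul, S_symm_mul, S_symm_mul, LinearEquiv.symm_apply_apply, ← mul_assoc]
      rfl
  exact h Ψₑ

theorem cop_pElt : @pElt k H _ _ _ copQuasiHopf = flipS (nElt k H) := by
  have h : ∀ x : H ⊗[k] (H ⊗[k] H), @Lp k H _ _ _ copQuasiHopf (rev x) = flipS (Ln x) := by
    intro x
    induction x using induction3 with
    | h0 => simp
    | hadd y z hy hz => simp only [map_add, hy, hz]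
    | h a b c =>
      refine (@Lp_tmul k H _ _ _ copQuasiHopf c b a).trans ?_
      rw [Ln_tmul, flipS_tmul, S_symm_mul, S_symm_mul, LinearEquiv.symm_apply_apply, ← mul_assoc]
      rfl
  exact h Φₑ

/-- Right evaluation expressed by data of `H` itself. This is needed for `V ◁ (M ▷ W)`, where left
and right evaluations occur together and passing to the coopposite algebra does not help. -/
theorem cop_qΔOp (r x : H) :
    @qΔOp k H _ _ _ copQuasiHopf (r ⊗ₜ x) = flipS (wOp (x ⊗ₜ r)) := by
  have h : ∀ y : H ⊗[k] H, @qOp k H _ _ _ copQuasiHopf (TensorProduct.comm k H H y) * 1 ⊗ₜ x =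
      flipS ((S (k := k) x) ⊗ₜ 1 * mElt k H * y) := by
    intro y
    induction y with
    | zero => simp
    | add y z hy hz => simp only [map_add, add_mul, mul_add, hy, hz]
    | tmul a b =>
      refine (congrArg (fun z => z * (1 : H) ⊗ₜ[k] x)
        (@qOp_tmul k H _ _ _ copQuasiHopf b a)).trans ?_
      rw [cop_qElt]
      change 1 ⊗ₜ[k] ((S : H ≃ₗ[k] H).symm a) * flipS (mElt k H) * b ⊗ₜ 1 * 1 ⊗ₜ x = _
      generalize mElt k H = m
      induction m with
      | zero => simp
      | add y z hy hz => simp only [map_add, add_mul, mul_add, hy, hz]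
      | tmul c d =>
        simp only [flipS_tmul, Algebra.TensorProduct.tmul_mul_tmul, one_mul, mul_one, S_symm_mul,
          LinearEquiv.symm_apply_apply, mul_assoc]
  exact h (Δ r)

/-- `a ⊗ b ⊗ c ↦ b ⊗ c ⊗ S⁻¹(a)` -/
noncomputable def rotS : H ⊗[k] (H ⊗[k] H) →ₗ[k] H ⊗[k] (H ⊗[k] H) :=
  flipS.lTensor H ∘ₗ (TensorProduct.leftComm k H H H).toLinearMap

theorem rotS_tmul (a b c : H) :
    rotS (k := k) (a ⊗ₜ (b ⊗ₜ c)) = b ⊗ₜ[k] (c ⊗ₜ[k] ((S : H ≃ₗ[k] H).symm a)) := rfl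

end CopElements

namespace HMod

/-! ### The isomorphism `V ◁ (M ▷ W) ≅ (V ◁ M) ▷ W` -/

section MatesM

variable {k H : Type u} [Field k] [Ring H] [Algebra k H] [QuasiHopfAlgebra k H]

local notation "Φₑ" => ((Φ : (H ⊗[k] (H ⊗[k] H))ˣ) : H ⊗[k] (H ⊗[k] H))
local notation "Ψₑ" => ((Φ⁻¹ : (H ⊗[k] (H ⊗[k] H))ˣ) : H ⊗[k] (H ⊗[k] H))

/-- `a ⊗ b ↦ (φ ↦ a φ(b -))` -/
noncomputable def conjR (V M : HMod k H) : H ⊗[k] H →ₗ[k] homR V M →ₗ[k] (V →ₗ[k] M) :=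
  (conj V M : H ⊗[k] H →ₗ[k] (V →ₗ[k] M) →ₗ[k] (V →ₗ[k] M))

theorem evR_tmul (V M : HMod k H) (a r : H) (v : V) (φ : homR V M) :
    evR V M (V.ρ a v ⊗ₜ (homR V M).ρ r φ) = conjR V M (flipS (wOp (a ⊗ₜ r))) φ v := by
  rw [← cop_qΔOp]
  exact @evL_box k H _ _ _ copQuasiHopf V M r a φ v

/-- The linear map `V ⊗ W → M` of an element of `Hom^l(V, Hom^r(W, M))`. -/
noncomputable def liftM (V W M : HMod k H) : homL V (homR W M) →ₗ[k] (V ⊗[k] W →ₗ[k] M) :=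
  (TensorProduct.uncurry (RingHom.id k) V W M : (V →ₗ[k] W →ₗ[k] M) →ₗ[k] _)

theorem conjR_eq_conjA (V W M : HMod k H) (n : homL V (homR W M)) (s : H ⊗[k] H) (l : H)
    (v : V) (w : W) :
    conjR W M (flipS s) (homL.eval V (homR W M) n (V.ρ l v)) w =
      conjA M (box V.ρ W.ρ) (rotS (app s l)) (liftM V W M n) (v ⊗ₜ w) := by
  induction s with
  | zero => simp
  | add y z hy hz => simp only [map_add, LinearMap.add_apply, hy, hz]
  | tmul a b => rfl

/-- `w ⊗ (n ⊗ v) ↦ n(v)(w)` with the actions of the two evaluations -/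
noncomputable def evM (V W M : HMod k H) : W ⊗[k] (homL V (homR W M) ⊗[k] V) →ₗ[k] M :=
  evR W M ∘ₗ TensorProduct.map LinearMap.id (evL V (homR W M))

/-- The left evaluation contributes `qΔOp` on the legs of `n` and `v`; the leg left acting on
`Hom^r(W, M)` meets the leg of `w` in the right evaluation as `wOp`. Together they form `assocMOp`.
-/
theorem evM_box (V W M : HMod k H) (n : homL V (homR W M)) (x : H ⊗[k] (H ⊗[k] H))
    (v : V) (w : W) :
    evM V W M (box W.ρ (box (homL V (homR W M)).ρ V.ρ) x (w ⊗ₜ (n ⊗ₜ v))) =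
      conjA M (box V.ρ W.ρ) (rotS (assocMOp x)) (liftM V W M n) (v ⊗ₜ w) := by
  induction x using induction3 with
  | h0 => simp
  | hadd y z hy hz => simp only [map_add, LinearMap.add_apply, hy, hz]
  | h a b c =>
    have h : evM V W M (box W.ρ (box (homL V (homR W M)).ρ V.ρ) (a ⊗ₜ (b ⊗ₜ c))
        (w ⊗ₜ (n ⊗ₜ v))) = evR W M (W.ρ a w ⊗ₜ conjL V (homR W M) (qΔOp (b ⊗ₜ c)) n v) :=
      congrArg (fun z => evR W M (W.ρ a w ⊗ₜ z)) (evL_box V (homR W M) b c n v)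
    have h' : assocMOp (a ⊗ₜ (b ⊗ₜ c)) = TensorProduct.assoc k H H H (wOp.rTensor H
      ((TensorProduct.assoc k H H H).symm (a ⊗ₜ[k] (qΔOp (b ⊗ₜ[k] c))))) := rfl
    rw [h, h']
    generalize qΔOp (k := k) (b ⊗ₜ c) = s
    induction s with
    | zero => simp
    | add y z hy hz => simp only [map_add, tmul_add, LinearMap.add_apply, hy, hz]
    | tmul i l =>
      exact (evR_tmul W M a i w (homL.eval V (homR W M) n (V.ρ l v))).trans
        (conjR_eq_conjA V W M n (wOp (a ⊗ₜ i)) l v w)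

/-- `a ⊗ b ↦ (φ ↦ b φ(S⁻¹(a) -))` -/
noncomputable def conjSR (V M : HMod k H) : H ⊗[k] H →ₗ[k] homR V M →ₗ[k] homR V M :=
  ((@conjS k H _ _ _ copQuasiHopf V M).toLinearMap ∘ₗ (TensorProduct.comm k H H).toLinearMap :
    H ⊗[k] H →ₗ[k] (V →ₗ[k] M) →ₗ[k] (V →ₗ[k] M))

theorem liftM_conjSL (V W M : HMod k H) (n : homL V (homR W M)) (a b : H) :
    liftM V W M (conjSL V (homR W M) (a ⊗ₜ b) n) =
      conjA M (box V.ρ W.ρ) (rotS (S₃ k H (app (Δ a) b))) (liftM V W M n) := by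
  have key : ∀ (y : H ⊗[k] H) (v : V) (w : W),
      homR.eval W M (conjSR W M y (homL.eval V (homR W M) n (V.ρ (S (k := k) b) v))) w =
      conjA M (box V.ρ W.ρ) (rotS (S₃ k H (app y b))) (liftM V W M n) (v ⊗ₜ w) := by
    intro y v w
    induction y with
    | zero => simp
    | add y z hy hz => simp only [map_add, LinearMap.add_apply, hy, hz]
    | tmul e f => rfl
  exact TensorProduct.ext' fun v w => key (Δ a) v w

/-- Records how a coopposite `p` acting on `n ⊗ w` changes the tensor: the part acting on `w`
multiplies on the left and the part acting on `n` multiplies on the right. -/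
theorem conjA_rotS_mul (V W M : HMod k H) (n : homL V (homR W M)) (x : H ⊗[k] (H ⊗[k] H))
    (t : H ⊗[k] H) (c : H) (v : V) (w : W) :
    conjA M (box V.ρ W.ρ) (rotS (S₃ k H x)) (liftM V W M (conjSL V (homR W M) t n))
      (v ⊗ₜ W.ρ ((S : H ≃ₗ[k] H).symm c) w) =
    conjA M (box V.ρ W.ρ) (rotS (S₃ k H (c ⊗ₜ 1 * x * Δid t))) (liftM V W M n) (v ⊗ₜ w) := by
  induction t with
  | zero => simp
  | add y z hy hz => simp only [map_add, mul_add, LinearMap.add_apply, hy, hz]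
  | tmul a b =>
    rw [liftM_conjSL, Δid_tmul]
    generalize liftM V W M n = φ
    generalize app (k := k) (Δ a) b = y
    induction x using induction3 with
    | h0 => simp
    | hadd x z hx hz => simp only [map_add, add_mul, mul_add, LinearMap.add_apply, hx, hz]
    | h d e f =>
      induction y using induction3 with
      | h0 => simp
      | hadd x z hx hz =>
        simp only [map_add, mul_add, LinearMap.add_apply, hx, hz]
      | h i j l =>
        simp only [Algebra.TensorProduct.tmul_mul_tmul, S₃_tmul, rotS_tmul, conjA_tmul, S_mul,
          S_symm_mul, one_mul, map_mul, Algebra.TensorProduct.one_def, box_tmul,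
          LinearMap.comp_apply, TensorProduct.map_tmul, Module.End.mul_apply]

theorem assoc_box_Δ {U V W : HMod k H} (t : H ⊗[k] H) (z : (U ⊗[k] V) ⊗[k] W) :
    TensorProduct.assoc k U V W (box ((box U.ρ V.ρ).comp Δ) W.ρ t z) =
      box U.ρ (box V.ρ W.ρ) (Δid t) (TensorProduct.assoc k U V W z) := by
  have h := LinearMap.congr_fun (box_assoc U.ρ V.ρ W.ρ
    (Algebra.TensorProduct.map Δ (AlgHom.id k H) t)) z
  rw [box_comp_map, AlgHom.comp_id] at h
  exact h

/-- The left unit and both evaluations give `(id ⊗ Δ)(m) Φ` by `assocMOp_Φ`. The right unit inserts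
the legs of `n = X β S(Y) ⊗ Z` on its two sides; quasi-coassociativity carries the right one across
`Φ`, and the product `(n₁ ⊗ 1) m Δ(n₂)` so formed is `1`. Only `Φ` survives. -/
theorem evM_mate (V W M : HMod k H) (n : homL V (homR W M)) (v : V) (w : W) :
    evM V W M (box W.ρ (box (homL V (homR W M)).ρ V.ρ) Φₑ (TensorProduct.assoc k W _ V
      (box ((box W.ρ (homL V (homR W M)).ρ).comp Δ) V.ρ (pElt k H)
        (TensorProduct.comm k (homL V (homR W M)) W
          (box (homL V (homR W M)).ρ W.ρ (@pElt k H _ _ _ copQuasiHopf) (n ⊗ₜ w)) ⊗ₜ v)))) =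
      conjA M (box V.ρ W.ρ) (rotS (S₃ k H Φₑ)) (liftM V W M n) (v ⊗ₜ w) := by
  rw [assoc_box_Δ, ← Module.End.mul_apply, ← map_mul, cop_pElt]
  have h : ∀ s : H ⊗[k] H, evM V W M (box W.ρ (box (homL V (homR W M)).ρ V.ρ)
      (Φₑ * Δid (pElt k H)) (TensorProduct.assoc k W _ V (TensorProduct.comm k
        (homL V (homR W M)) W (box (homL V (homR W M)).ρ W.ρ (flipS s) (n ⊗ₜ w)) ⊗ₜ v))) =
      conjA M (box V.ρ W.ρ) (rotS (S₃ k H (idΔ (twoSided inL (Δ : H →ₐ[k] H ⊗[k] H).toLinearMap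
        (mElt k H) s) * Φₑ))) (liftM V W M n) (v ⊗ₜ w) := by
    intro s
    induction s with
    | zero => simp
    | add y z hy hz => simp only [map_add, add_mul, add_tmul, LinearMap.add_apply, hy, hz]
    | tmul c d =>
      refine (evM_box V W M _ _ v _).trans ?_
      rw [assocMOp_Φ]
      refine (conjA_rotS_mul V W M n _ (Δ d) c v w).trans ?_
      rw [twoSided_tmul, map_mul idΔ, map_mul idΔ, mul_assoc _ (idΔ _) Φₑ]
      refine congrArg (fun z => conjA M (box V.ρ W.ρ) (rotS (S₃ k H z)) (liftM V W M n)
        (v ⊗ₜ w)) ?_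
      -- `Φ (Δ ⊗ id)Δ(d) = (id ⊗ Δ)Δ(d) Φ` puts every factor except `Φ` under the common
      -- homomorphism `id ⊗ Δ`.
      refine Eq.trans ?_ (congrArg (fun z => idΔ (inL (k := k) c) * idΔ (mElt k H) * z)
        (idΔ_Δ_mul d).symm)
      rw [inL_apply, idΔ_tmul, map_one]
      simp only [mul_assoc]
  rw [h, n_m, map_one, one_mul]

theorem assocM_lin (V W M : HMod k H) (n : homL V (homR W M)) (v : V) (w : W) :
    homL.eval V M (homR.eval W (homL V M) (((Contragradient.assocM V W).hom.app M).lin n) w) v =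
      conjA M (box V.ρ W.ρ) (rotS (S₃ k H Φₑ)) (liftM V W M n) (v ⊗ₜ w) := by
  rw [Contragradient.assocM, conjugateIsoEquiv_apply_hom, conjugateEquiv_apply_app]
  exact evM_mate V W M n v w

end MatesM
end HMod
end QuasiHopf

namespace QuasiHopf
open QuasiBialgebra QuasiHopfAlgebra

/-! ### The counit on `α` and on the antipode -/

section CounitAntipode

variable {k H : Type u} [Field k] [Ring H] [Algebra k H] [QuasiHopfAlgebra k H]

local notation "Φₑ" => ((Φ : (H ⊗[k] (H ⊗[k] H))ˣ) : H ⊗[k] (H ⊗[k] H))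

/-- Applying `ε` to `X β S(Y) α Z = 1` gives a sum whose terms all contain `ε(α)`. -/
theorem ε_α_ne_zero : ε (α k : H) ≠ (0 : k) := by
  intro h
  have key : ∀ x : H ⊗[k] (H ⊗[k] H), ε (k := k) (sandwich LinearMap.id LinearMap.id (β k)
      ((sandwich (S : H ≃ₗ[k] H).toLinearMap LinearMap.id (α k)).lTensor H x)) = 0 := by
    intro x
    induction x using induction3 with
    | h0 => simp
    | hadd y z hy hz => simp only [map_add, hy, hz, add_zero]
    | h a b c => simp [h]
  have h1 := key Φₑ
  rw [Φ_β_α, map_one] at h1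
  exact one_ne_zero h1

/-- Applying `ε` to `S(h¹) α h² = ε(h) α` gives `ε(S(h)) ε(α) = ε(h) ε(α)`, and `ε(α)` cancels. -/
theorem ε_S (h : H) : ε (S (k := k) h) = (ε h : k) := by
  have key : ∀ t : H ⊗[k] H, ε (sandwich (S : H ≃ₗ[k] H).toLinearMap LinearMap.id (α k) t) =
      ε (S (k := k) (Algebra.TensorProduct.rid k k H
        (Algebra.TensorProduct.map (AlgHom.id k H) ε t))) * (ε (α k : H) : k) := by
    intro t
    induction t with
    | zero => simp
    | add y z hy hz => simp only [map_add, hy, hz, add_mul]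
    | tmul a b => simp; ring
  have h1 := key (Δ h)
  rw [S_α, counit_right, map_smul, smul_eq_mul] at h1
  exact (mul_right_cancel₀ ε_α_ne_zero h1).symm

theorem ε_S_symm (h : H) : ε ((S : H ≃ₗ[k] H).symm h) = (ε h : k) := by
  rw [← ε_S, LinearEquiv.apply_symm_apply]

theorem rid_qElt : Algebra.TensorProduct.rid k k H
    (Algebra.TensorProduct.map (AlgHom.id k H) ε (qElt k H)) = (ε (α k : H) : k) • 1 := by
  have key : ∀ x : H ⊗[k] (H ⊗[k] H), Algebra.TensorProduct.rid k k H
      (Algebra.TensorProduct.map (AlgHom.id k H) ε (Lq k H x)) =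
      (ε (α k : H) : k) • Algebra.TensorProduct.rid k k H (Algebra.TensorProduct.map
        (AlgHom.id k H) ε ((LinearMap.mul' k H ∘ₗ
          (LinearMap.mul' k H).lTensor H).lTensor H (Algebra.TensorProduct.map
          (AlgHom.id k H) (Algebra.TensorProduct.map (AlgHom.id k H) εε) x))) := by
    intro x
    induction x using induction3 with
    | h0 => simp
    | hadd y z hy hz => simp only [map_add, hy, hz, smul_add]
    | h a b c =>
      simp only [Lq_tmul, Algebra.TensorProduct.map_tmul, LinearMap.lTensor_tmul, AlgHom.coe_id,
        id_eq, LinearMap.mul'_apply, Algebra.TensorProduct.rid_tmul, map_mul, ε_S, smul_smul,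
        εε_apply, map_smul, tmul_smul, LinearMap.comp_apply,
        Algebra.TensorProduct.one_def, mul_one]
      congr 1
      ring
  rw [qElt, key, counit_last]
  simp [Algebra.TensorProduct.one_def]

end CounitAntipode

namespace HMod

/-! ### Unit isomorphisms and functoriality in the acting module -/

section Units

variable {k H : Type u} [Field k] [Ring H] [Algebra k H] [QuasiHopfAlgebra k H]

variable (k H) in
/-- The generator `1` of the trivial module. -/
def trivOne : triv k H := (1 : k)

theorem evL_triv (M : HMod k H) (φ : homL (triv k H) M) :
    evL (triv k H) M (φ ⊗ₜ (trivOne k H)) =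
      (ε (α k : H) : k) • homL.eval (triv k H) M φ (trivOne k H) := by
  have key : ∀ x : H ⊗[k] H, conjL (triv k H) M x φ (trivOne k H) =
      M.ρ (Algebra.TensorProduct.rid k k H (Algebra.TensorProduct.map (AlgHom.id k H) ε x))
        (homL.eval (triv k H) M φ (trivOne k H)) := by
    intro x
    induction x with
    | zero => simp
    | add y z hy hz => simp only [map_add, LinearMap.add_apply, hy, hz]
    | tmul a b =>
      have h : (triv k H).ρ b (trivOne k H) = (ε b : k) • trivOne k H := rfl
      refine (congrArg (fun z => M.ρ a (homL.eval (triv k H) M φ z)) h).trans ?_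
      rw [map_smul, map_smul, Algebra.TensorProduct.map_tmul, Algebra.TensorProduct.rid_tmul,
        map_smul]
      rfl
  refine (key (qElt k H)).trans ?_
  rw [rid_qElt, map_smul, map_one]
  rfl

/-- The mate of the unitor is evaluation at `1 ∈ k`. On the trivial module `q` acts through `(id ⊗
ε)(q) = ε(α) 1`, which produces the scalar; `unitR_lin` has the same one since `ε(S⁻¹(α)) = ε(α)`.
-/
theorem unitL_lin (M : HMod k H) (φ : homL (triv k H) M) :
    (Contragradient.unitL.hom.app M).lin φ =
      (ε (α k : H) : k) • homL.eval (triv k H) M φ (trivOne k H) := by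
  rw [← evL_triv]
  rw [Contragradient.unitL, conjugateIsoEquiv_apply_hom, conjugateEquiv_apply_app]
  rfl

theorem unitR_lin (M : HMod k H) (φ : homR (triv k H) M) :
    (Contragradient.unitR.hom.app M).lin φ =
      (ε (α k : H) : k) • homR.eval (triv k H) M φ (trivOne k H) := by
  rw [← ε_S_symm (α k : H)]
  refine Eq.trans ?_ (@evL_triv k H _ _ _ copQuasiHopf M φ)
  rw [Contragradient.unitR, conjugateIsoEquiv_apply_hom, conjugateEquiv_apply_app]
  rfl

/-- The zigzag identity for the identity map of `Hom^l(V, M)`: inserting `p` and evaluating is plain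
application. -/
theorem evL_pElt (V M : HMod k H) (φ : homL V M) (v : V) :
    evL V M (box (homL V M).ρ V.ρ (pElt k H) (φ ⊗ₜ v)) = homL.eval V M φ v :=
  LinearMap.congr_fun (LinearMap.congr_fun (ζL_ηL (N := homL V M) (V := V) (M := M)
    (LinearMap.id : (V →ₗ[k] M) →ₗ[k] (V →ₗ[k] M)) (fun _ => rfl)) φ) v

/-- Functoriality, defined as a mate, is precomposition: `p` commutes with the `H`-linear map `f`
and then cancels against the evaluation. -/
theorem actLPre_lin {V W : HMod k H} (f : V ⟶ W) (M : HMod k H) (φ : homL W M) (v : V) :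
    homL.eval V M (((Contragradient.actLPre f).app M).lin φ) v = homL.eval W M φ (f.lin v) := by
  rw [← evL_pElt, Contragradient.actLPre, conjugateEquiv_apply_app]
  have h := LinearMap.congr_fun (box_natural (homL W M).ρ V.ρ (homL W M).ρ W.ρ LinearMap.id f.lin
    (fun _ => rfl) f.comm (pElt k H)) (φ ⊗ₜ v)
  exact congrArg (evL W M) h

theorem actRPre_lin {V W : HMod k H} (f : V ⟶ W) (M : HMod k H) (φ : homR W M) (v : V) :
    homR.eval V M (((Contragradient.actRPre f).app M).lin φ) v = homR.eval W M φ (f.lin v) := by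
  refine Eq.trans ?_ (@evL_pElt k H _ _ _ copQuasiHopf W M φ (f.lin v))
  rw [Contragradient.actRPre, conjugateEquiv_apply_app]
  have h := LinearMap.congr_fun (box_natural (homR W M).ρ V.ρ (homR W M).ρ W.ρ LinearMap.id f.lin
    (fun _ => rfl) f.comm (@pElt k H _ _ _ copQuasiHopf)) (φ ⊗ₜ v)
  refine Eq.trans ?_ (congrArg (evRop W M) h)
  have h' : ∀ t : homR W M ⊗[k] V, evR W M (TensorProduct.map f.lin LinearMap.id
      (TensorProduct.comm k (homR W M) V t)) =
      evRop W M (TensorProduct.map LinearMap.id f.lin t) := by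
    intro t
    induction t with
    | zero => simp
    | add y z hy hz => simp only [map_add, hy, hz]
    | tmul a b => rfl
  exact h' _

end Units
end HMod
end QuasiHopf

namespace QuasiHopf
open QuasiBialgebra QuasiHopfAlgebra
namespace HMod

/-! ### The two sides of the hexagon in terms of `μ` -/

section Hexagon

variable {k H : Type u} [Field k] [Ring H] [Algebra k H] [QuasiHopfAlgebra k H]

local notation "Φₑ" => ((Φ : (H ⊗[k] (H ⊗[k] H))ˣ) : H ⊗[k] (H ⊗[k] H))

theorem assocL_sum (V W M : HMod k H) (n : homL V (homL W M)) (m : ℕ) (X Y Z : Fin m → H)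
    (e : Φₑ = ∑ i, X i ⊗ₜ[k] (Y i ⊗ₜ[k] Z i)) :
    homL.eval (tensor V W) M (((Contragradient.assocL V W).hom.app M).lin n) =
      ∑ i, M.ρ (X i) ∘ₗ liftL V W M n ∘ₗ box V.ρ W.ρ
        (((S : H ≃ₗ[k] H) (Z i) ⊗ₜ[k] (S : H ≃ₗ[k] H) (Y i)) * twist k H) := by
  refine (assocL_lin V W M n).trans ?_
  rw [e]
  simp only [map_sum, LinearMap.sum_apply]
  rfl

theorem assocR_sum (V W M : HMod k H) (n : homR (tensor V W) M) (m : ℕ) (X Y Z : Fin m → H)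
    (e : Φₑ = ∑ i, X i ⊗ₜ[k] (Y i ⊗ₜ[k] Z i)) (v : V) (w : W) :
    homR.eval V M (homR.eval W (homR V M) (((Contragradient.assocR V W).hom.app M).lin n) w) v =
      ∑ i, M.ρ (Z i) (homR.eval (tensor V W) M n (box V.ρ W.ρ (twistG k H *
        ((S : H ≃ₗ[k] H).symm (Y i) ⊗ₜ[k] (S : H ≃ₗ[k] H).symm (X i))) (v ⊗ₜ w))) := by
  have key : ∀ φ : V ⊗[k] W →ₗ[k] M, conjA M (box V.ρ W.ρ)
      ((LinearMap.mulLeft k (twistG k H) ∘ₗ SSinv).lTensor H (rev Φₑ)) φ (v ⊗ₜ w) =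
      ∑ i, M.ρ (Z i) (φ (box V.ρ W.ρ (twistG k H *
        ((S : H ≃ₗ[k] H).symm (Y i) ⊗ₜ[k] (S : H ≃ₗ[k] H).symm (X i))) (v ⊗ₜ w))) := by
    intro φ
    rw [e]
    simp only [map_sum, LinearMap.sum_apply]
    rfl
  exact (assocR_lin V W M n v w).trans (key n)

theorem assocM_sum (V W M : HMod k H) (n : homL V (homR W M)) (m : ℕ) (X Y Z : Fin m → H)
    (e : Φₑ = ∑ i, X i ⊗ₜ[k] (Y i ⊗ₜ[k] Z i)) (v : V) (w : W) :
    homL.eval V M (homR.eval W (homL V M) (((Contragradient.assocM V W).hom.app M).lin n) w) v =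
      ∑ i, M.ρ (Y i) (homR.eval W M (homL.eval V (homR W M) n (V.ρ ((S : H ≃ₗ[k] H) (Z i)) v))
        (W.ρ ((S : H ≃ₗ[k] H).symm (X i)) w)) := by
  refine (assocM_lin V W M n v w).trans ?_
  rw [e]
  simp only [map_sum, LinearMap.sum_apply]
  rfl

variable {M : HMod k H} (μ : (H →ₗ[k] M) →ₗ[k] M)

/-- The left hand side of contraassociativity, for `Φ = Σ X ⊗ Y ⊗ Z`. -/
noncomputable def contraL {m : ℕ} (X Y Z : Fin m → H) (f : H →ₗ[k] H →ₗ[k] M) : M :=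
  ∑ i, μ (M.ρ (Y i) ∘ₗ μ ∘ₗ
    LinearMap.lcomp k M (LinearMap.mulRight k ((S : H ≃ₗ[k] H).symm (X i))) ∘ₗ
      f ∘ₗ LinearMap.mulLeft k ((S : H ≃ₗ[k] H) (Z i)))

/-- The right hand side of contraassociativity, for `Φ = Σ X ⊗ Y ⊗ Z`. -/
noncomputable def contraR {m : ℕ} (X Y Z : Fin m → H) (f : H →ₗ[k] H →ₗ[k] M) : M :=
  ∑ j, ∑ i, M.ρ (Z j) (μ (M.ρ (X i) ∘ₗ TensorProduct.lift f ∘ₗ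
    LinearMap.mulLeft k (((S : H ≃ₗ[k] H) (Z i) ⊗ₜ[k] (S : H ≃ₗ[k] H) (Y i)) * twist k H) ∘ₗ
    LinearMap.mulRight k (twistG k H *
      ((S : H ≃ₗ[k] H).symm (Y j) ⊗ₜ[k] (S : H ≃ₗ[k] H).symm (X j))) ∘ₗ
    (Δ : H →ₐ[k] H ⊗[k] H).toLinearMap))

/-- The index `j` comes from `assocR`, the index `i` from `assocL`. Between them stands `τ` at `V ⊗
W`, where the orbit of a tensor runs through `Δ(h)`; hence `Δ(h)` between `F` and `G`. -/
theorem hexagon_left {μ : (H →ₗ[k] M) →ₗ[k] M} (τ : ∀ V : HMod k H, homL V M ⟶ homR V M)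
    (hτ : ∀ (V : HMod k H) (φ : homL V M) (v : V),
      homR.eval V M ((τ V).lin φ) v = μ (homL.eval V M φ ∘ₗ V.orbit v))
    {m : ℕ} (X Y Z : Fin m → H)
    (e : Φₑ = ∑ i, X i ⊗ₜ[k] (Y i ⊗ₜ[k] Z i)) (V W : HMod k H) (n : homL V (homL W M))
    (v : V) (w : W) :
    homR.eval V M (homR.eval W (homR V M) (((Contragradient.assocL V W).hom.app M ≫
      τ (V ⊗ W) ≫ (Contragradient.assocR V W).hom.app M).lin n) w) v =
      contraR μ X Y Z (orbit₂ (n : V →ₗ[k] W →ₗ[k] M) v w) := by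
  refine (assocR_sum V W M _ m X Y Z e v w).trans ?_
  refine Finset.sum_congr rfl fun j _ => ?_
  rw [← map_sum, ← map_sum]
  refine congrArg (M.ρ (Z j)) ((hτ (tensor V W) _ _).trans (congrArg μ ?_))
  refine LinearMap.ext fun h => ?_
  refine (congrArg (fun g : V ⊗[k] W →ₗ[k] M => g (box V.ρ W.ρ (Δ h) (box V.ρ W.ρ (twistG k H *
    ((S : H ≃ₗ[k] H).symm (Y j) ⊗ₜ[k] (S : H ≃ₗ[k] H).symm (X j))) (v ⊗ₜ w))))
    (assocL_sum V W M n m X Y Z e)).trans ?_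
  rw [LinearMap.sum_apply, LinearMap.sum_apply]
  refine Finset.sum_congr rfl fun i _ => ?_
  refine congrArg (M.ρ (X i)) ?_
  refine Eq.trans ?_ (lift_orbit₂ (n : V →ₗ[k] W →ₗ[k] M) v w _).symm
  refine congrArg (liftL V W M n) ?_
  change box V.ρ W.ρ _ (box V.ρ W.ρ (Δ h) (box V.ρ W.ρ _ (v ⊗ₜ w))) = _
  rw [← Module.End.mul_apply, ← Module.End.mul_apply, ← map_mul, ← map_mul, mul_assoc]
  rfl

/-- The component at `V` gives the outer `μ`, with `v` replaced by `h v`, and the one at `W` the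
inner `μ`; the middle associativity isomorphism in between supplies `Y`, `S(Z)` and `S⁻¹(X)`. -/
theorem hexagon_right {μ : (H →ₗ[k] M) →ₗ[k] M} (τ : ∀ V : HMod k H, homL V M ⟶ homR V M)
    (hτ : ∀ (V : HMod k H) (φ : homL V M) (v : V),
      homR.eval V M ((τ V).lin φ) v = μ (homL.eval V M φ ∘ₗ V.orbit v))
    {m : ℕ} (X Y Z : Fin m → H)
    (e : Φₑ = ∑ i, X i ⊗ₜ[k] (Y i ⊗ₜ[k] Z i)) (V W : HMod k H) (n : homL V (homL W M))
    (v : V) (w : W) :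
    homR.eval V M (homR.eval W (homR V M) (((Contragradient.actL V).map (τ W) ≫
      (Contragradient.assocM V W).hom.app M ≫ (Contragradient.actR W).map (τ V)).lin n) w) v =
      contraL μ X Y Z (orbit₂ (n : V →ₗ[k] W →ₗ[k] M) v w) := by
  refine (hτ V _ v).trans ?_
  rw [contraL, ← map_sum]
  refine congrArg μ (LinearMap.ext fun h => ?_)
  refine (assocM_sum V W M _ m X Y Z e (V.ρ h v) w).trans ?_
  rw [LinearMap.sum_apply]
  refine Finset.sum_congr rfl fun i _ => ?_
  refine congrArg (M.ρ (Y i)) ((hτ W _ _).trans (congrArg μ (LinearMap.ext fun x => ?_)))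
  have h₁ : V.ρ ((S : H ≃ₗ[k] H) (Z i)) (V.ρ h v) = V.ρ ((S : H ≃ₗ[k] H) (Z i) * h) v := by
    rw [map_mul]; rfl
  have h₂ : W.ρ x (W.ρ ((S : H ≃ₗ[k] H).symm (X i)) w) =
      W.ρ (x * (S : H ≃ₗ[k] H).symm (X i)) w := by rw [map_mul]; rfl
  exact congrArg₂ (fun a b => (show V →ₗ[k] W →ₗ[k] M from n) a b) h₁ h₂

end Hexagon

/-! ### The regular module and the isomorphism of categories -/

section Equivalence

variable {k H : Type u} [Field k] [Ring H] [Algebra k H]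

variable (k H) in
/-- The left regular module. -/
def reg : HMod k H where
  carrier := H
  ρ := Algebra.lmul k H

/-- The morphism `x ↦ x v` from the regular module to `V`. -/
def orbitHom (V : HMod k H) (v : V) : reg k H ⟶ V where
  lin := V.orbit v
  comm h := LinearMap.ext fun x => LinearMap.congr_fun (map_mul V.ρ h x) v

variable [QuasiHopfAlgebra k H]

local notation "Φₑ" => ((Φ : (H ⊗[k] (H ⊗[k] H))ˣ) : H ⊗[k] (H ⊗[k] H))

/-- The linear map `φ ↦ (v ↦ μ(x ↦ φ(x v)))`. -/
noncomputable def tauLin {M : HMod k H} (μ : (H →ₗ[k] M) →ₗ[k] M) (V : HMod k H) :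
    (V →ₗ[k] M) →ₗ[k] (V →ₗ[k] M) :=
  LinearMap.mk₂ k (fun φ v => μ (φ ∘ₗ V.orbit v))
    (fun φ ψ v => by rw [LinearMap.add_comp, map_add])
    (fun c φ v => by rw [LinearMap.smul_comp, map_smul])
    (fun φ v w => by rw [orbit, map_add, LinearMap.comp_add, map_add]; rfl)
    (fun c φ v => by rw [orbit, map_smul, LinearMap.comp_smul, map_smul]; rfl)

/-- The `H`-linear map `V ◁ M ⟶ M ▷ V` of a type I contramodule. -/
noncomputable def tau (A : AYDContramodule k H) (V : HMod k H) : homL V A.obj ⟶ homR V A.obj where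
  lin := tauLin A.μ V
  comm h := by
    refine LinearMap.ext fun φ => LinearMap.ext fun v => ?_
    obtain ⟨n, a, b, e⟩ := exists_sum₂ (k := k) (Δ h)
    have h₁ := homL_ρ_sum V A.obj h n a b e φ
    have h₂ := homR_ρ_sum V A.obj h n a b e (tauLin A.μ V φ)
    refine (congrArg (fun g => A.μ (g ∘ₗ V.orbit v)) h₁).trans
      (Eq.trans ?_ (congrArg (fun g : V →ₗ[k] A.obj => g v) h₂).symm)
    have h₃ : ∀ c : H, V.ρ c ∘ₗ V.orbit v = V.orbit v ∘ₗ LinearMap.mulLeft k c := fun c =>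
      LinearMap.ext fun x => (LinearMap.congr_fun (map_mul V.ρ c x) v).symm
    have h₄ : ∀ c : H, V.orbit (V.ρ c v) = V.orbit v ∘ₗ LinearMap.mulRight k c := fun c =>
      LinearMap.ext fun x => (LinearMap.congr_fun (map_mul V.ρ x c) v).symm
    -- The aYD condition for `f(x) = φ(x v)`; the actions of `S(h²)` and `S⁻¹(h¹)` on `V` become
    -- left and right multiplication of `x`.
    refine Eq.trans ?_ ((A.ayd h n a b e (LinearMap.comp (M₂ := V) φ (V.orbit v))).symm.trans ?_)
    · rw [← map_sum]
      refine congrArg A.μ (LinearMap.ext fun x => ?_)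
      rw [LinearMap.comp_apply, LinearMap.sum_apply, LinearMap.sum_apply]
      exact Finset.sum_congr rfl fun i _ => congrArg (fun g : H →ₗ[k] V => A.obj.ρ (a i)
        ((show V →ₗ[k] A.obj from φ) (g x))) (h₃ (S (k := k) (b i)))
    · rw [LinearMap.sum_apply]
      exact Finset.sum_congr rfl fun i _ => congrArg (fun g : H →ₗ[k] V => A.obj.ρ (b i)
        (A.μ (LinearMap.comp (M₂ := V) φ g))) (h₄ ((S : H ≃ₗ[k] H).symm (a i))).symm

/-- The half braiding of a type I contramodule. -/
noncomputable def halfBraiding (A : AYDContramodule k H) :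
    Contragradient.WeakHalfBraiding A.obj where
  τ := tau A
  naturality {V W} f := by
    refine hom_ext (LinearMap.ext fun φ => LinearMap.ext fun v => ?_)
    refine Eq.trans ?_ (actRPre_lin f A.obj ((tau A W).lin φ) v).symm
    refine congrArg A.μ (LinearMap.ext fun x => ?_)
    refine (actLPre_lin f A.obj φ _).trans ?_
    exact congrArg (homL.eval W A.obj φ) (comm_apply f x v)
  hexagon V W := by
    refine hom_ext (LinearMap.ext fun n => LinearMap.ext fun w => LinearMap.ext fun v => ?_)
    obtain ⟨m, X, Y, Z, e⟩ := exists_sum₃ (k := k) Φₑ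
    refine (hexagon_left (tau A) (fun _ _ _ => rfl) X Y Z e V W n v w).trans (Eq.trans ?_
      (hexagon_right (tau A) (fun _ _ _ => rfl) X Y Z e V W n v w).symm)
    exact (A.contraassoc m X Y Z e _).symm
  unit := by
    refine hom_ext (LinearMap.ext fun φ => ?_)
    refine (unitR_lin A.obj ((tau A (triv k H)).lin φ)).trans (Eq.trans ?_ (unitL_lin A.obj φ).symm)
    -- Both unit isomorphisms carry the factor `ε(α)`, so it is enough to compare values at `1`,
    -- where `φ(x · 1) = ε(x) φ(1)` reduces the claim to the unit condition.
    refine congrArg (fun z => (ε (α k : H) : k) • z) ?_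
    refine Eq.trans (congrArg A.μ ?_) (A.unit (homL.eval (triv k H) A.obj φ (trivOne k H)))
    refine LinearMap.ext fun x => ?_
    exact map_smul (homL.eval (triv k H) A.obj φ) (ε x : k) (trivOne k H)

variable {M : HMod k H}

/-- The contramodule structure map `f ↦ τ_H(f)(1)` of a half braiding. -/
noncomputable def mu (b : Contragradient.WeakHalfBraiding M) : (H →ₗ[k] M) →ₗ[k] M :=
  LinearMap.applyₗ (1 : H) ∘ₗ (halfBraidingMap b (reg k H) : (H →ₗ[k] M) →ₗ[k] (H →ₗ[k] M))

/-- A half braiding is determined by its component at the regular module. -/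
theorem τ_eq_mu (b : Contragradient.WeakHalfBraiding M) (V : HMod k H) (φ : homL V M) (v : V) :
    homR.eval V M ((b.τ V).lin φ) v = mu b (homL.eval V M φ ∘ₗ V.orbit v) := by
  -- Naturality along `x ↦ x v` evaluated at `1 ∈ H`: precomposition on the target side gives the
  -- value at `v`, and on the source side it gives `x ↦ φ(x v)`.
  have h := b.naturality (orbitHom V v)
  have h₁ := congrArg (fun t : homL V M ⟶ homR (reg k H) M =>
    homR.eval (reg k H) M (t.lin φ) (1 : H)) h
  have h₂ := actRPre_lin (orbitHom V v) M ((b.τ V).lin φ) (1 : H)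
  have h₃ : (orbitHom V v).lin (1 : H) = v := LinearMap.congr_fun (map_one V.ρ) v
  rw [h₃] at h₂
  have h₄ : ((Contragradient.actLPre (orbitHom V v)).app M).lin φ =
      (show H →ₗ[k] M from homL.eval V M φ ∘ₗ V.orbit v) :=
    LinearMap.ext fun x => actLPre_lin (orbitHom V v) M φ x
  refine h₂.symm.trans (h₁.symm.trans ?_)
  exact congrArg (fun z => homR.eval (reg k H) M ((b.τ (reg k H)).lin z) (1 : H)) h₄

/-- `H`-linearity of `τ_H`, evaluated at `1`. The value of `τ_H(f)` at `S⁻¹(h¹)` is rewritten by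
`τ_eq_mu` as `μ(x ↦ f(x S⁻¹(h¹)))`. -/
theorem mu_ayd (b : Contragradient.WeakHalfBraiding M) (h : H) (n : ℕ) (h₁ h₂ : Fin n → H)
    (e : Δ h = ∑ i, h₁ i ⊗ₜ[k] h₂ i) (f : H →ₗ[k] M) :
    ∑ i, M.ρ (h₂ i) (mu b (f ∘ₗ LinearMap.mulRight k ((S : H ≃ₗ[k] H).symm (h₁ i)))) =
      ∑ i, mu b (M.ρ (h₁ i) ∘ₗ f ∘ₗ LinearMap.mulLeft k ((S : H ≃ₗ[k] H) (h₂ i))) := by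
  have e₁ := homL_ρ_sum (reg k H) M h n h₁ h₂ e f
  have e₂ := homR_ρ_sum (reg k H) M h n h₁ h₂ e ((b.τ (reg k H)).lin f)
  have e₃ := congrArg (fun g : reg k H →ₗ[k] M => g (1 : H))
    (LinearMap.congr_fun ((b.τ (reg k H)).comm h) f)
  have e₄ : mu b (show H →ₗ[k] M from (homL (reg k H) M).ρ h f) =
      ∑ i, mu b (M.ρ (h₁ i) ∘ₗ f ∘ₗ LinearMap.mulLeft k ((S : H ≃ₗ[k] H) (h₂ i))) := by
    rw [← map_sum]
    exact congrArg (mu b) e₁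
  refine Eq.trans ?_ (e₃.symm.trans e₄)
  refine Eq.trans ?_ (congrArg (fun g : reg k H →ₗ[k] M => g (1 : H)) e₂).symm
  refine Eq.trans ?_ (LinearMap.sum_apply _ _ _).symm
  refine Finset.sum_congr rfl fun i _ => congrArg (M.ρ (h₂ i)) ?_
  refine Eq.trans ?_ (τ_eq_mu b (reg k H) f _).symm
  refine congrArg (mu b) (LinearMap.ext fun x => congrArg f ?_)
  exact congrArg (fun y => x * y) (mul_one _).symm

theorem orbit₂_reg (f : reg k H →ₗ[k] reg k H →ₗ[k] M) :
    orbit₂ f (1 : H) (1 : H) = (show H →ₗ[k] H →ₗ[k] M from f) :=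
  LinearMap.ext fun x => LinearMap.ext fun y =>
    congrArg₂ (fun a b => (show H →ₗ[k] H →ₗ[k] M from f) a b) (mul_one x) (mul_one y)

/-- The hexagon for `V = W = H` at `v = w = 1`, where the bilinear map `(a, b) ↦ f(a · 1)(b · 1)` is
`f` itself. -/
theorem mu_contraassoc (b : Contragradient.WeakHalfBraiding M) (m : ℕ) (X Y Z : Fin m → H)
    (e : Φₑ = ∑ i, X i ⊗ₜ[k] (Y i ⊗ₜ[k] Z i)) (f : H →ₗ[k] H →ₗ[k] M) :
    contraL (mu b) X Y Z f = contraR (mu b) X Y Z f := by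
  have h₁ := hexagon_left b.τ (τ_eq_mu b) X Y Z e (reg k H) (reg k H) f (1 : H) (1 : H)
  have h₂ := hexagon_right b.τ (τ_eq_mu b) X Y Z e (reg k H) (reg k H) f (1 : H) (1 : H)
  have h₃ := orbit₂_reg (show reg k H →ₗ[k] reg k H →ₗ[k] M from f)
  refine (congrArg (contraL (mu b) X Y Z) h₃).symm.trans (h₂.symm.trans (Eq.trans ?_
    (h₁.trans (congrArg (contraR (mu b) X Y Z) h₃))))
  exact congrArg (fun t : homL (reg k H) (homL (reg k H) M) ⟶ homR (reg k H) (homR (reg k H) M) =>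
    homR.eval (reg k H) M (homR.eval (reg k H) (homR (reg k H) M) (t.lin f) (1 : H)) (1 : H))
    (b.hexagon (reg k H) (reg k H)).symm

theorem mu_unit (b : Contragradient.WeakHalfBraiding M) (m : M) :
    mu b ((ε : H →ₐ[k] k).toLinearMap.smulRight m) = m := by
  -- The map `c ↦ c m`, chosen because its composite with the orbit of `1 ∈ k` is `x ↦ ε(x) m`.
  let φ : homL (triv k H) M := (LinearMap.id : k →ₗ[k] k).smulRight m
  have h := congrArg (fun t : homL (triv k H) M ⟶ M => t.lin φ) b.unit
  have h₁ := (unitR_lin M ((b.τ (triv k H)).lin φ)).symm.trans (h.trans (unitL_lin M φ))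
  -- The common scalar `ε(α)` of the two unit isomorphisms is cancelled.
  have h₂ := smul_right_injective M (ε_α_ne_zero (k := k) (H := H)) h₁
  have h₃ : homL.eval (triv k H) M φ (trivOne k H) = m := one_smul k m
  rw [h₃] at h₂
  refine Eq.trans (congrArg (mu b) ?_) ((τ_eq_mu b (triv k H) φ (trivOne k H)).symm.trans h₂)
  exact LinearMap.ext fun x => congrArg (fun c : k => c • m) (mul_one (ε x : k)).symm

/-- The type I contramodule of an object of the weak center. -/
noncomputable def contramodule (X : Contragradient.WeakCenter (HMod k H)) :
    AYDContramodule k H where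
  obj := X.obj
  μ := mu X.braiding
  ayd := mu_ayd X.braiding
  contraassoc := mu_contraassoc X.braiding
  unit := mu_unit X.braiding

theorem mu_halfBraiding (A : AYDContramodule k H) : mu (halfBraiding A) = A.μ :=
  LinearMap.ext fun f => congrArg A.μ (LinearMap.ext fun x => congrArg f (mul_one (M := H) x))

/-- Uniqueness in the Yoneda argument: by `τ_eq_mu` every component is a function of `μ` alone. -/
theorem braiding_ext {b c : Contragradient.WeakHalfBraiding M} (h : mu b = mu c) : b = c := by
  have h' : b.τ = c.τ := funext fun V => hom_ext (LinearMap.ext fun φ => LinearMap.ext fun v =>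
    (τ_eq_mu b V φ v).trans ((LinearMap.congr_fun h _).trans (τ_eq_mu c V φ v).symm))
  cases b
  cases c
  cases h'
  rfl

/-- The functor `(M, μ) ↦ (M, τ)` with `τ_V(f)(v) = μ(x ↦ f(x v))`. -/
noncomputable def toWeakCenter : AYDContramodule k H ⥤ Contragradient.WeakCenter (HMod k H) where
  obj A := ⟨A.obj, halfBraiding A⟩
  map {A B} t := ⟨AYDContramodule.Hom.hom t, fun V => hom_ext (LinearMap.ext fun φ =>
    LinearMap.ext fun v => ((AYDContramodule.Hom.comm t)
      (homL.eval V A.obj φ ∘ₗ V.orbit v)).symm)⟩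

/-- The functor `(M, τ) ↦ (M, μ)` with `μ(f) = τ_H(f)(1)`. -/
noncomputable def ofWeakCenter : Contragradient.WeakCenter (HMod k H) ⥤ AYDContramodule k H where
  obj := contramodule
  map {X Y} t := ⟨Contragradient.WeakCenter.Hom.hom t, fun f =>
    (congrArg (fun s : homL (reg k H) X.obj ⟶ homR (reg k H) Y.obj =>
      homR.eval (reg k H) Y.obj (s.lin f) (1 : H))
        (Contragradient.WeakCenter.Hom.comm t (reg k H))).symm⟩

theorem contramodule_ext {A B : AYDContramodule k H} (h : A.obj = B.obj) (h' : HEq A.μ B.μ) :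
    A = B := by
  cases A
  cases B
  cases h
  cases h'
  rfl

/-- Equality of functors compares morphisms up to transport along equalities of objects. Passing to
underlying modules, where these equalities have the form `M = M`, makes the transports trivial. -/
theorem contramodule_hom_comp_eqToHom {A A' B B' : AYDContramodule k H} (hA : A = A')
    (hB : B' = B) (t : A' ⟶ B') : AYDContramodule.Hom.hom (eqToHom hA ≫ t ≫ eqToHom hB) =
      eqToHom (congrArg AYDContramodule.obj hA) ≫ AYDContramodule.Hom.hom t ≫
        eqToHom (congrArg AYDContramodule.obj hB) := by
  cases hA
  cases hB
  simp

theorem weakCenter_hom_comp_eqToHom {X X' Y Y' : Contragradient.WeakCenter (HMod k H)}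
    (hX : X = X') (hY : Y' = Y) (t : X' ⟶ Y') :
    Contragradient.WeakCenter.Hom.hom (eqToHom hX ≫ t ≫ eqToHom hY) =
      eqToHom (congrArg Contragradient.WeakCenter.obj hX) ≫ Contragradient.WeakCenter.Hom.hom t ≫
        eqToHom (congrArg Contragradient.WeakCenter.obj hY) := by
  cases hX
  cases hY
  simp

theorem comp_eqToHom_self {M N : HMod k H} (t : M ⟶ N) (hM : M = M) (hN : N = N) :
    t = eqToHom hM ≫ t ≫ eqToHom hN := by
  simp

theorem contramodule_halfBraiding (A : AYDContramodule k H) :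
    contramodule ⟨A.obj, halfBraiding A⟩ = A :=
  contramodule_ext rfl (heq_of_eq (mu_halfBraiding A))

theorem halfBraiding_contramodule (X : Contragradient.WeakCenter (HMod k H)) :
    (⟨X.obj, halfBraiding (contramodule X)⟩ : Contragradient.WeakCenter (HMod k H)) = X :=
  congrArg (fun b => (⟨X.obj, b⟩ : Contragradient.WeakCenter (HMod k H)))
    (braiding_ext (M := X.obj) (mu_halfBraiding (contramodule X)))

theorem toWeakCenter_ofWeakCenter_map {A B : AYDContramodule k H} (t : A ⟶ B) :
    (toWeakCenter ⋙ ofWeakCenter).map t = eqToHom (contramodule_halfBraiding A) ≫ t ≫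
      eqToHom (contramodule_halfBraiding B).symm := by
  refine AYDContramodule.Hom.ext ?_
  refine Eq.trans ?_ (contramodule_hom_comp_eqToHom _ _ _).symm
  exact comp_eqToHom_self (AYDContramodule.Hom.hom t) rfl rfl

theorem toWeakCenter_ofWeakCenter :
    (toWeakCenter : AYDContramodule k H ⥤ _) ⋙ ofWeakCenter = 𝟭 _ :=
  CategoryTheory.Functor.ext (fun A => contramodule_halfBraiding A)
    (fun _ _ t => toWeakCenter_ofWeakCenter_map t)

theorem ofWeakCenter_toWeakCenter_map {X Y : Contragradient.WeakCenter (HMod k H)} (t : X ⟶ Y) :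
    (ofWeakCenter ⋙ toWeakCenter).map t = eqToHom (halfBraiding_contramodule X) ≫ t ≫
      eqToHom (halfBraiding_contramodule Y).symm := by
  refine Contragradient.WeakCenter.Hom.ext ?_
  refine Eq.trans ?_ (weakCenter_hom_comp_eqToHom _ _ _).symm
  exact comp_eqToHom_self (Contragradient.WeakCenter.Hom.hom t) rfl rfl

theorem ofWeakCenter_toWeakCenter :
    (ofWeakCenter : Contragradient.WeakCenter (HMod k H) ⥤ _) ⋙ toWeakCenter = 𝟭 _ :=
  CategoryTheory.Functor.ext (fun X => halfBraiding_contramodule X)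
    (fun _ _ t => ofWeakCenter_toWeakCenter_map t)

end Equivalence
end HMod
end QuasiHopf

theorem mainTheorem1 (k H : Type u) [Field k] [Ring H] [Algebra k H]
    [QuasiHopfAlgebra k H] :
    ∃ (F : QuasiHopf.AYDContramodule k H ⥤ Contragradient.WeakCenter (QuasiHopf.HMod k H))
      (G : Contragradient.WeakCenter (QuasiHopf.HMod k H) ⥤ QuasiHopf.AYDContramodule k H),
      F ⋙ G = 𝟭 (QuasiHopf.AYDContramodule k H) ∧
      G ⋙ F = 𝟭 (Contragradient.WeakCenter (QuasiHopf.HMod k H)) ∧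
      F ⋙ Contragradient.WeakCenter.forget (QuasiHopf.HMod k H) =
        QuasiHopf.AYDContramodule.forget k H ∧
      ∀ A : QuasiHopf.AYDContramodule k H, ∃ b : Contragradient.WeakHalfBraiding A.obj,
        F.obj A = ⟨A.obj, b⟩ ∧
        ∀ (V : QuasiHopf.HMod k H) (f : V →ₗ[k] A.obj) (v : V),
          QuasiHopf.halfBraidingMap b V f v = A.μ (f ∘ₗ V.orbit v) :=
  ⟨QuasiHopf.HMod.toWeakCenter, QuasiHopf.HMod.ofWeakCenter,
    QuasiHopf.HMod.toWeakCenter_ofWeakCenter, QuasiHopf.HMod.ofWeakCenter_toWeakCenter, rfl,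
    fun A => ⟨QuasiHopf.HMod.halfBraiding A, rfl, fun _ _ _ => rfl⟩⟩
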